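/- Let $d\ge 3$ and let $\Delta$ be the discrete Laplacian on $\ell^2(\mathbb Z^d)$ (complex sequences), $(\Delta f)_n=\frac12\sum_{j=1}^d (f_{n+e_j}+f_{n-e_j})$, whose spectrum is contained in $[-d,d]$. Let $\mathcal B_2$ be the Hilbert–Schmidt class of $\ell^2(\mathbb Z^d)$ with norm $\|\cdot\|_{\mathcal B_2}$. Let $q$ be real with $$2\le q<\frac{12}{5}\ \text{ if } d=3,\qquad 2\le q<\frac{6d}{2d+1}\ \text{ if } d\ge 4,$$ let $u,v\in\ell^q(\mathbb Z^d)$ be complex sequences, also denoting the multiplication operators they define, and put $Y_0(z)=u(\Delta-z)^{-1}v$ for $z\in\mathbb C\setminus[-d,d]$. Set $$\gamma_{d,q}=\begin{cases}\frac6q-\frac52,& d=3,\\ \frac{2d}{q}-\frac{2d+1}{3},& d\ge4,\end{cases}\qquad C_d^\gamma=\begin{cases}\frac{8}{1-2\gamma}+8,& d=3,\\ \frac{4}{1-\gamma},& d=4,\\ \frac{14\cdot 2^{d/4}}{d-4},& d>4,\end{cases}\qquad D_{q,d}=\Bigl(\frac q2\Bigr)^{\frac{d(q-2)}{q}}\ (\text{so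 } D_{2,d}=1),$$ and, for $q>2$, $$\Gamma(q,d,\gamma)=\begin{cases}\Bigl(3+\frac{12(q-2)}{12-(5+2\gamma)q}\Bigr)^{\frac{3(q-2)}{q}},& d=3,\\ \Bigl(3+2\bigl(\frac{5q-2}{8-(3+\gamma)q}\bigr)^{1+\frac{q}{4(q-2)}}\Bigr)^{\frac{4(q-2)}{q}},& d=4,\\ \Bigl(3+\frac{6d(q-2)}{6d-(2d+1+3\gamma)q}\Bigr)^{\frac{d(q-2)}{q}},& d>4,\end{cases}$$ while $\Gamma(2,d,\gamma)=1$ for $d\ne4$ and $\Gamma(2,4,\gamma)=(1-\gamma)^{-1}$. Then $Y_0$ takes values in $\mathcal B_2$, is analytic as a map $\mathbb C\setminus[-d,d]\to\mathcal B_2$, and is Hölder continuous up to the boundary. More precisely: (a) For all $z\in\mathbb C\setminus[-d,d]$, $$\|Y_0(z)\|_{\mathcal B_2}\le\bigl(D_{q,d}+C_d^0\,\Gamma(q,d,0)\bigr)\|u\|_q\|v\|_q.$$ (b) For all $\gamma\in[0,1]$ with $\gamma<\gamma_{d,q}$ and all $z,z'\in\mathbb C\setminus[-d,d]$ with $\operatorname{Im}z,\operatorname{Im}z'\ge0$,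 $$\|Y_0(z)-Y_0(z')\|_{\mathcal B_2}\le|z-z'|^\gamma\bigl(D_{q,d}+C_d^\gamma\,\Gamma(q,d,\gamma)\bigr)\|u\|_q\|v\|_q$$ (with $|z-z'|^0=1$). Moreover, $Y_0$ restricted to $\{\operatorname{Im}z\ge0\}\setminus[-d,d]$, respectively to $\{\operatorname{Im}z\le0\}\setminus[-d,d]$, extends to a $\mathcal B_2$-valued function on the whole closed half-plane $\{\operatorname{Im}z\ge0\}$, respectively $\{\operatorname{Im}z\le0\}$, that satisfies the same Hölder estimates there for all these $\gamma$. -/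

import Mathlib

open scoped ENNReal lp

noncomputable section

namespace LatticeResolvent

/-! ### The Hilbert space `ℓ²` and Hilbert-Schmidt operators on it -/

/-- The complex Hilbert space `ℓ²(ι)`. -/
abbrev L2 (ι : Type) : Type := lp (fun _ : ι => ℂ) 2

/-- Membership in the Hilbert-Schmidt class `𝓑₂` of `ℓ²(ι)`: the operator `T` satisfies
`∑ₙ ‖T eₙ‖² < ∞`, where `eₙ` is the canonical orthonormal basis. -/
def hilbertSchmidtClass (ι : Type) [DecidableEq ι] : Submodule ℂ (L2 ι →L[ℂ] L2 ι) where
  carrier := {T | Memℓp (fun n : ι => T (lp.single 2 n (1 : ℂ))) 2}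
  add_mem' {S T} hS hT := by
    have h : Memℓp (fun n : ι => S (lp.single 2 n (1 : ℂ)) + T (lp.single 2 n (1 : ℂ))) 2 :=
      Memℓp.add hS hT
    simpa using h
  zero_mem' := by
    have h : Memℓp (fun _ : ι => (0 : L2 ι)) 2 := zero_mem_ℓp'
    simpa using h
  smul_mem' c T hT := by
    have h : Memℓp (fun n : ι => c • T (lp.single 2 n (1 : ℂ))) 2 := Memℓp.const_smul hT c
    simpa using h

/-- The Hilbert-Schmidt class as a type of its own, so that it carries the Hilbert-Schmidt norm
and not the operator norm. -/
def HSOp (ι : Type) [DecidableEq ι] : Type := ↥(hilbertSchmidtClass ι)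

namespace HSOp

variable {ι : Type} [DecidableEq ι]

instance : AddCommGroup (HSOp ι) := inferInstanceAs (AddCommGroup ↥(hilbertSchmidtClass ι))

instance : Module ℂ (HSOp ι) := inferInstanceAs (Module ℂ ↥(hilbertSchmidtClass ι))

/-- The bounded operator underlying a Hilbert-Schmidt operator. -/
def toCLM : HSOp ι →ₗ[ℂ] (L2 ι →L[ℂ] L2 ι) := (hilbertSchmidtClass ι).subtype

/-- The family `(T eₙ)ₙ` of columns of a Hilbert-Schmidt operator. -/
def columns : HSOp ι →ₗ[ℂ] lp (fun _ : ι => L2 ι) 2 where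
  toFun T := ⟨fun n => toCLM T (lp.single 2 n (1 : ℂ)), T.2⟩
  map_add' S T := by
    apply lp.ext
    funext n
    simp
    rfl
  map_smul' c T := by
    apply lp.ext
    funext n
    simp

theorem columns_injective : Function.Injective (columns : HSOp ι →ₗ[ℂ] _) := by
  intro S T h
  apply Subtype.ext
  change toCLM S = toCLM T
  ext1 f
  have hf := lp.hasSum_single (p := 2) (by norm_num) f
  have key : ∀ n, toCLM S (lp.single 2 n (f n)) = toCLM T (lp.single 2 n (f n)) := by
    intro n
    have h1 : toCLM S (lp.single 2 n (1 : ℂ)) = toCLM T (lp.single 2 n (1 : ℂ)) :=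
      congrArg (fun g : lp (fun _ : ι => L2 ι) 2 => g n) h
    have h2 : lp.single (E := fun _ : ι => ℂ) 2 n (f n) = f n • lp.single 2 n (1 : ℂ) := by
      rw [← lp.single_smul]
      simp
    rw [h2, map_smul, map_smul, h1]
  have hS := hf.mapL (toCLM S)
  have hT := hf.mapL (toCLM T)
  simp only [key] at hS
  exact hS.unique hT

/-- The Hilbert-Schmidt norm `‖T‖ = (∑ₙ ‖T eₙ‖²)^{1/2}`. -/
instance : NormedAddCommGroup (HSOp ι) :=
  NormedAddCommGroup.induced (HSOp ι) (lp (fun _ : ι => L2 ι) 2) columns columns_injective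

instance : NormedSpace ℂ (HSOp ι) :=
  NormedSpace.induced ℂ (HSOp ι) (lp (fun _ : ι => L2 ι) 2) columns

theorem norm_sq_eq_tsum (T : HSOp ι) :
    ‖T‖ ^ 2 = ∑' n : ι, ‖toCLM T (lp.single 2 n (1 : ℂ))‖ ^ 2 := by
  have h := lp.norm_rpow_eq_tsum (p := 2) (by norm_num) (columns T)
  have h2 : ‖T‖ = ‖columns T‖ := rfl
  rw [h2]
  simpa [columns] using h

end HSOp

/-! ### Multiplication operators and the discrete Laplacian -/

/-- Multiplication by a bounded sequence, `(a f)ₙ = aₙ fₙ`, as a bounded operator on `ℓ²(ι)`. -/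
def mulBounded {ι : Type} (a : lp (fun _ : ι => ℂ) ∞) : L2 ι →L[ℂ] L2 ι :=
  LinearMap.mkContinuous
    { toFun := fun f => ⟨fun n => a n * f n, by
        refine Memℓp.mono (g := fun n => ‖a‖ * ‖f n‖) ?_ ?_
        · exact (lp.memℓp f).norm.const_mul ‖a‖
        · intro n
          rw [norm_mul]
          exact mul_le_mul_of_nonneg_right (lp.norm_apply_le_norm (by simp) a n)
            (norm_nonneg _)⟩
      map_add' := fun f g => by
        apply lp.ext
        funext n
        simp [mul_add]
        rfl
      map_smul' := fun c f => by
        apply lp.ext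
        funext n
        simp [mul_left_comm] }
    ‖a‖ (fun f => by
      refine lp.norm_le_of_forall_sum_le (by norm_num) (by positivity) ?_
      intro s
      have h := lp.sum_rpow_le_norm_rpow (p := 2) (by norm_num) f s
      simp only [ENNReal.toReal_ofNat, Real.rpow_ofNat, mul_pow] at h ⊢
      refine le_trans ?_ (mul_le_mul_of_nonneg_left h (by positivity))
      rw [Finset.mul_sum]
      refine Finset.sum_le_sum fun n _ => ?_
      rw [← mul_pow]
      refine pow_le_pow_left₀ (norm_nonneg _) ?_ 2
      change ‖a n * f n‖ ≤ _
      rw [norm_mul]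
      exact mul_le_mul_of_nonneg_right (lp.norm_apply_le_norm (by simp) a n) (norm_nonneg _))

/-- Multiplication by a sequence `u ∈ ℓ^p(ι)`, which is a bounded sequence. -/
def mulOp {ι : Type} {p : ℝ≥0∞} (u : lp (fun _ : ι => ℂ) p) : L2 ι →L[ℂ] L2 ι :=
  mulBounded ⟨u, (lp.memℓp u).of_exponent_ge le_top⟩

theorem mulOp_apply {ι : Type} {p : ℝ≥0∞} (u : lp (fun _ : ι => ℂ) p) (f : L2 ι) (n : ι) :
    mulOp u f n = u n * f n := rfl

/-- The lattice `ℤ^d`. -/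
abbrev Zd (d : ℕ) : Type := Fin d → ℤ

/-- The translation `(S f)ₙ = f_{n+a}` on `ℓ²(ℤ^d)`. -/
def shift {d : ℕ} (a : Zd d) : L2 (Zd d) →ₗᵢ[ℂ] L2 (Zd d) where
  toFun f := ⟨fun n => f (n + a), by
    have h := (lp.memℓp f).summable (by norm_num)
    exact memℓp_gen ((Equiv.addRight a).summable_iff.mpr h)⟩
  map_add' f g := by
    apply lp.ext
    funext n
    simp
    rfl
  map_smul' c f := by
    apply lp.ext
    funext n
    simp
  norm_map' f := by
    rw [lp.norm_eq_tsum_rpow (by norm_num), lp.norm_eq_tsum_rpow (by norm_num)]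
    congr 1
    exact (Equiv.addRight a).tsum_eq (fun n => ‖f n‖ ^ (2 : ℝ≥0∞).toReal)

/-- The discrete Laplacian `(Δ f)ₙ = ½ ∑ⱼ (f_{n+eⱼ} + f_{n-eⱼ})` on `ℓ²(ℤ^d)`. -/
def laplacian (d : ℕ) : L2 (Zd d) →L[ℂ] L2 (Zd d) :=
  (1 / 2 : ℂ) • ∑ j : Fin d,
    ((shift (Pi.single j (1 : ℤ))).toContinuousLinearMap +
      (shift (-Pi.single j (1 : ℤ))).toContinuousLinearMap)

theorem laplacian_apply {d : ℕ} (f : L2 (Zd d)) (n : Zd d) :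
    laplacian d f n =
      (1 / 2 : ℂ) * ∑ j : Fin d, (f (n + Pi.single j 1) + f (n - Pi.single j 1)) := by
  simp only [laplacian, smul_apply, sum_apply,
    add_apply, lp.coeFn_smul, Pi.smul_apply, smul_eq_mul, lp.coeFn_sum,
    Finset.sum_apply, lp.coeFn_add, Pi.add_apply]
  rfl

theorem norm_laplacian_le (d : ℕ) : ‖laplacian d‖ ≤ d := by
  have h1 : ∀ a : Zd d, ‖(shift a).toContinuousLinearMap‖ ≤ 1 :=
    fun a => (shift a).norm_toContinuousLinearMap_le
  have h2 : ‖∑ j : Fin d, ((shift (Pi.single j (1 : ℤ))).toContinuousLinearMap +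
      (shift (-Pi.single j (1 : ℤ) : Zd d)).toContinuousLinearMap)‖ ≤ ∑ _j : Fin d, (2 : ℝ) := by
    refine norm_sum_le_of_le _ fun j _ => ?_
    refine (norm_add_le _ _).trans ?_
    linarith [h1 (Pi.single j (1 : ℤ)), h1 (-Pi.single j (1 : ℤ))]
  rw [laplacian, norm_smul]
  simp only [Finset.sum_const, Finset.card_univ, Fintype.card_fin, nsmul_eq_mul] at h2
  norm_num
  linarith

theorem inner_shift_left {d : ℕ} (a : Zd d) (f g : L2 (Zd d)) :
    inner ℂ (shift a f) g = inner ℂ f (shift (-a) g) := by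
  rw [lp.inner_eq_tsum, lp.inner_eq_tsum,
    ← (Equiv.addRight a).tsum_eq (fun n => inner ℂ (f n) (shift (-a) g n))]
  refine tsum_congr fun n => ?_
  change inner ℂ (f (n + a)) (g n) = inner ℂ (f (n + a)) (g (n + a + -a))
  rw [add_neg_cancel_right]

theorem isSelfAdjoint_laplacian (d : ℕ) : IsSelfAdjoint (laplacian d) := by
  rw [ContinuousLinearMap.isSelfAdjoint_iff_isSymmetric]
  intro f g
  simp only [laplacian, ContinuousLinearMap.coe_coe, smul_apply,
    sum_apply, add_apply, inner_smul_left,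
    inner_smul_right, sum_inner, inner_sum, inner_add_left, inner_add_right,
    LinearIsometry.coe_toContinuousLinearMap, inner_shift_left, neg_neg]
  congr 1
  · exact (map_div₀ (starRingEnd ℂ) 1 2).trans (by rw [map_one, map_ofNat])
  · exact Finset.sum_congr rfl fun j _ => add_comm _ _

/-! ### The weighted resolvent -/

/-- The domain `ℂ \ [-d, d]`. -/
def cutPlane (d : ℕ) : Set ℂ := (Complex.ofReal '' Set.Icc (-(d : ℝ)) (d : ℝ))ᶜ

/-- `Δ - z` is boundedly invertible for every `z ∈ ℂ \ [-d, d]`. -/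
theorem isUnit_laplacian_sub {d : ℕ} {z : ℂ} (hz : z ∈ cutPlane d) :
    IsUnit (laplacian d - algebraMap ℂ (L2 (Zd d) →L[ℂ] L2 (Zd d)) z) := by
  by_contra hu
  have hmem : z ∈ spectrum ℂ (laplacian d) := by
    rw [spectrum.mem_iff]
    intro h
    exact hu (by simpa using h.neg)
  have hre := (isSelfAdjoint_laplacian d).mem_spectrum_eq_re hmem
  have hle : ‖z‖ ≤ ‖laplacian d‖ * ‖(1 : L2 (Zd d) →L[ℂ] L2 (Zd d))‖ :=
    spectrum.norm_le_norm_mul_of_mem hmem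
  have h1 : ‖(1 : L2 (Zd d) →L[ℂ] L2 (Zd d))‖ ≤ 1 := ContinuousLinearMap.norm_id_le
  have h2 : ‖z‖ ≤ d := by
    refine hle.trans ((mul_le_of_le_one_right (norm_nonneg _) h1).trans (norm_laplacian_le d))
  refine hz ⟨z.re, ?_, hre.symm⟩
  have h3 := (Complex.abs_re_le_norm z).trans h2
  exact ⟨(abs_le.mp h3).1, (abs_le.mp h3).2⟩

/-- The weighted free resolvent `Y₀(z) = u (Δ - z)⁻¹ v`. It is used for `z ∈ ℂ \ [-d, d]` only,
where the ring inverse is the true inverse. -/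
def weightedResolvent {d : ℕ} {p : ℝ≥0∞} (u v : lp (fun _ : Zd d => ℂ) p) (z : ℂ) :
    L2 (Zd d) →L[ℂ] L2 (Zd d) :=
  mulOp u ∘L
    Ring.inverse (laplacian d - algebraMap ℂ (L2 (Zd d) →L[ℂ] L2 (Zd d)) z) ∘L mulOp v

/-! ### The constants -/

/-- The upper bound for the exponent `q`. -/
def qMax (d : ℕ) : ℝ := if d = 3 then 12 / 5 else 6 * d / (2 * d + 1)

/-- The upper bound `γ_{d,q}` for the Hölder exponent. -/
def gammaMax (d : ℕ) (q : ℝ) : ℝ :=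
  if d = 3 then 6 / q - 5 / 2 else 2 * d / q - (2 * d + 1) / 3

/-- The constant `C_d^γ`. -/
def Cconst (d : ℕ) (γ : ℝ) : ℝ :=
  if d = 3 then 8 / (1 - 2 * γ) + 8
  else if d = 4 then 4 / (1 - γ)
  else 14 * (2 : ℝ) ^ ((d : ℝ) / 4) / (d - 4)

/-- The constant `Γ(q, d, γ)`. -/
def Gconst (q : ℝ) (d : ℕ) (γ : ℝ) : ℝ :=
  if q = 2 then (if d = 4 then (1 - γ)⁻¹ else 1)
  else if d = 3 then
    (3 + 12 * (q - 2) / (12 - (5 + 2 * γ) * q)) ^ (3 * (q - 2) / q)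
  else if d = 4 then
    (3 + 2 * ((5 * q - 2) / (8 - (3 + γ) * q)) ^ (1 + q / (4 * (q - 2)))) ^ (4 * (q - 2) / q)
  else
    (3 + 6 * d * (q - 2) / (6 * d - (2 * d + 1 + 3 * γ) * q)) ^ (d * (q - 2) / q)

/-- The constant `D_{q,d} = (q/2)^{d(q-2)/q}`; in particular `D_{2,d} = 1`. -/
def Dconst (q : ℝ) (d : ℕ) : ℝ := (q / 2) ^ (d * (q - 2) / q)

end LatticeResolvent

end

open LatticeResolvent

noncomputable section

namespace LatticeResolvent

/-! ### Bessel functions of integer order -/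

/-! The unitary group `exp(-itΔ)` has the convolution kernel `∏ⱼ (-i)^{nⱼ} J_{nⱼ}(t)` on `ℤ^d`, so
for `Im z > 0` the resolvent has the Laplace transform kernel `G_z(n) = i ∫₀^∞ e^{itz} ∏ⱼ (-i)^{nⱼ}
J_{nⱼ}(t) dt`. Since `|J_n(t)|` decays like `t^{-1/2}`, this integral converges absolutely for `d ≥
3` even when `z` is real; this defines the boundary values. As `|e^{itz} - e^{itz'}| ≤ 2 |z - z'|^γ
t^γ` in the closed upper half-plane, Hölder continuity costs only a weight `t^γ`.

Hölder's inequality in `t` separates the coordinates: `∫ t^γ ∏ⱼ |J_{nⱼ}| ≤ ∏ⱼ (∫ t^γ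
|J_{nⱼ}|^d)^{1/d}` (`lintegral_evolutionKernel_le`). What is needed are therefore explicit bounds,
uniform in `n`, for the one-dimensional moments. They decay like `n^{γ-1/2}` for `d = 3`, `n^{γ-1}(1
+ (log n)/4)` for `d = 4` and `n^{γ-(d-1)/3}` for `d ≥ 5` (`besselMoment_three_le`,
`besselMoment_four_le`, `besselMoment_le_of_five_le`). Three estimates from Bessel's equation give
them: `√(t²-n²) J_n(t)² ≤ 3/4` for `t > n`, from a monotone Sonin energy (`sqrt_mul_sq_besselJ_le`);
control of the maximum of `|J_n|` up to distance of order `n^{1/3}` beyond the turning point `t = n`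
(`abs_besselJ_le_of_le_add`); and exponential smallness below it (`abs_besselJ_le_exp`).

The product of the one-dimensional bounds lies in `ℓ^p(ℤ^d)`, `p = q/(q-2)`, exactly when the decay
exponent times `p/d` exceeds one, which is the condition `γ < γ_{d,q}`; the value of the sum is the
source of `Γ(q,d,γ)` (`exists_moment_weight`, `convolutionBound_of_prod`). Young's inequality then
bounds the Hilbert-Schmidt norm of `u_n K(n-m) v_m` by `‖K‖_p ‖u‖_q ‖v‖_q` (`tsum_young_lp_le`).

The kernel `G_z` is identified with the resolvent because it is an `ℓ²` solution of `(Δ-z)G = δ₀`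
for `Im z > 0`; real `z` outside the spectrum follow by continuity, and the lower half-plane by
complex conjugation. Analyticity comes from the resolvent itself: `(Δ-z)⁻¹δ₀` is analytic in `ℓ²`,
and `K ↦ uKv` is bounded from `ℓ²` to the Hilbert-Schmidt class. The argument never uses the summand
`D_{q,d}`, which is nonnegative and only enlarges the bound. -/

/-- The Bessel function `J_n`, given by Bessel's integral. -/
def besselJ (n : ℤ) (t : ℝ) : ℝ :=
  Real.pi⁻¹ * ∫ θ in (0 : ℝ)..Real.pi, Real.cos (n * θ - t * Real.sin θ)

theorem abs_besselJ_le_one (n : ℤ) (t : ℝ) : |besselJ n t| ≤ 1 := by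
  have h : ‖∫ θ in (0 : ℝ)..Real.pi, Real.cos (n * θ - t * Real.sin θ)‖
      ≤ 1 * |Real.pi - 0| :=
    intervalIntegral.norm_integral_le_of_norm_le_const fun θ _ => Real.abs_cos_le_one _
  rw [sub_zero, abs_of_pos Real.pi_pos, one_mul, Real.norm_eq_abs] at h
  rw [besselJ, abs_mul, abs_of_pos (inv_pos.mpr Real.pi_pos), inv_mul_le_iff₀ Real.pi_pos, mul_one]
  exact h

theorem hasDerivAt_besselJ (n : ℤ) (t : ℝ) :
    HasDerivAt (besselJ n) ((besselJ (n - 1) t - besselJ (n + 1) t) / 2) t := by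
  have key : HasDerivAt (fun t : ℝ => ∫ θ in (0 : ℝ)..Real.pi, Real.cos (n * θ - t * Real.sin θ))
      (∫ θ in (0 : ℝ)..Real.pi, Real.sin (n * θ - t * Real.sin θ) * Real.sin θ) t := by
    refine (intervalIntegral.hasDerivAt_integral_of_dominated_loc_of_deriv_le
      (F := fun (t : ℝ) θ => Real.cos (n * θ - t * Real.sin θ))
      (F' := fun (t : ℝ) θ => Real.sin (n * θ - t * Real.sin θ) * Real.sin θ)
      (bound := fun _ => 1) (s := Set.univ) Filter.univ_mem ?_ ?_ ?_ ?_ ?_ ?_).2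
    · exact Filter.Eventually.of_forall fun x =>
        (Continuous.aestronglyMeasurable (by fun_prop))
    · exact Continuous.intervalIntegrable (by fun_prop) _ _
    · exact Continuous.aestronglyMeasurable (by fun_prop)
    · refine Filter.Eventually.of_forall fun θ _ x _ => ?_
      rw [norm_mul]
      exact mul_le_one₀ (Real.abs_sin_le_one _) (norm_nonneg _) (Real.abs_sin_le_one _)
    · exact intervalIntegrable_const
    · refine Filter.Eventually.of_forall fun θ _ x _ => ?_
      have h1 : HasDerivAt (fun x : ℝ => n * θ - x * Real.sin θ) (-(1 * Real.sin θ)) x :=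
        ((hasDerivAt_id x).mul_const (Real.sin θ)).const_sub _
      exact h1.cos.congr_deriv (by ring)
  refine (key.const_mul Real.pi⁻¹).congr_deriv ?_
  simp only [besselJ]
  rw [← mul_sub, ← intervalIntegral.integral_sub
    (Continuous.intervalIntegrable (by fun_prop) _ _)
    (Continuous.intervalIntegrable (by fun_prop) _ _), mul_div_assoc,
    ← intervalIntegral.integral_div]
  congr 1
  refine intervalIntegral.integral_congr fun θ _ => ?_
  have h1 : ((n - 1 : ℤ) : ℝ) * θ - t * Real.sin θ = (n * θ - t * Real.sin θ) - θ := by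
    push_cast; ring
  have h2 : ((n + 1 : ℤ) : ℝ) * θ - t * Real.sin θ = (n * θ - t * Real.sin θ) + θ := by
    push_cast; ring
  simp only [h1, h2, Real.cos_sub (_ - _), Real.cos_add (_ - _)]
  ring

theorem continuous_besselJ (n : ℤ) : Continuous (besselJ n) :=
  continuous_iff_continuousAt.mpr fun t => (hasDerivAt_besselJ n t).continuousAt

/-- The three-term recurrence `2 n J_n = t (J_{n-1} + J_{n+1})`. -/
theorem besselJ_recurrence (n : ℤ) (t : ℝ) :
    2 * n * besselJ n t = t * (besselJ (n - 1) t + besselJ (n + 1) t) := by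
  -- The integrand is the derivative of `sin(nθ - t sin θ)`, which vanishes at both end points
  -- because `n` is an integer.
  have h0 : ∫ θ in (0 : ℝ)..Real.pi,
      Real.cos (n * θ - t * Real.sin θ) * (n - t * Real.cos θ) = 0 := by
    rw [intervalIntegral.integral_eq_sub_of_hasDerivAt
      (f := fun θ => Real.sin (n * θ - t * Real.sin θ))]
    · simp
    · intro θ _
      have h1 : HasDerivAt (fun θ : ℝ => n * θ - t * Real.sin θ) (n * 1 - t * Real.cos θ) θ :=
        ((hasDerivAt_id θ).const_mul (n : ℝ)).sub ((Real.hasDerivAt_sin θ).const_mul t)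
      exact h1.sin.congr_deriv (by ring)
    · exact Continuous.intervalIntegrable (by fun_prop) _ _
  have h3 : ∫ θ in (0 : ℝ)..Real.pi, Real.cos (n * θ - t * Real.sin θ) * (n - t * Real.cos θ) =
      n * (∫ θ in (0 : ℝ)..Real.pi, Real.cos (n * θ - t * Real.sin θ)) -
      t / 2 * ((∫ θ in (0 : ℝ)..Real.pi, Real.cos ((n - 1 : ℤ) * θ - t * Real.sin θ)) +
        ∫ θ in (0 : ℝ)..Real.pi, Real.cos ((n + 1 : ℤ) * θ - t * Real.sin θ)) := by
    rw [← intervalIntegral.integral_add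
      (Continuous.intervalIntegrable (by fun_prop) _ _)
      (Continuous.intervalIntegrable (by fun_prop) _ _), ← intervalIntegral.integral_const_mul,
      ← intervalIntegral.integral_const_mul, ← intervalIntegral.integral_sub
      (Continuous.intervalIntegrable (by fun_prop) _ _)
      (Continuous.intervalIntegrable (by fun_prop) _ _)]
    refine intervalIntegral.integral_congr fun θ _ => ?_
    have h1 : ((n - 1 : ℤ) : ℝ) * θ - t * Real.sin θ = (n * θ - t * Real.sin θ) - θ := by
      push_cast; ring
    have h2 : ((n + 1 : ℤ) : ℝ) * θ - t * Real.sin θ = (n * θ - t * Real.sin θ) + θ := by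
      push_cast; ring
    simp only [h1, h2, Real.cos_sub (_ - _), Real.cos_add (_ - _)]
    ring
  rw [h0] at h3
  simp only [besselJ]
  linear_combination (-2 * Real.pi⁻¹) * h3

theorem besselJ_zero_right (n : ℤ) : besselJ n 0 = if n = 0 then 1 else 0 := by
  simp only [besselJ, zero_mul, sub_zero]
  split_ifs with h
  · subst h
    simp [Real.pi_ne_zero]
  · have hn : (n : ℝ) ≠ 0 := by exact_mod_cast h
    rw [intervalIntegral.integral_comp_mul_left (fun x => Real.cos x) hn]
    simp

/-- Substitute `θ ↦ π - θ` in Bessel's integral. -/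
theorem besselJ_neg (n : ℤ) (t : ℝ) : besselJ (-n) t = (-1) ^ n * besselJ n t := by
  have h := intervalIntegral.integral_comp_sub_left
    (fun θ => Real.cos (n * θ - t * Real.sin θ)) (a := 0) (b := Real.pi) Real.pi
  rw [sub_self, sub_zero] at h
  simp only [besselJ]
  rw [← h, mul_left_comm, ← intervalIntegral.integral_const_mul ((-1 : ℝ) ^ n)]
  congr 1
  refine intervalIntegral.integral_congr fun θ _ => ?_
  have h1 : (n : ℝ) * (Real.pi - θ) - t * Real.sin (Real.pi - θ) =
      n * Real.pi - (n * θ + t * Real.sin θ) := by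
    rw [Real.sin_pi_sub]; ring
  have h2 : ((-n : ℤ) : ℝ) * θ - t * Real.sin θ = -(n * θ + t * Real.sin θ) := by
    push_cast; ring
  simp only [h1, h2, Real.cos_neg]
  rw [Real.cos_int_mul_pi_sub, ← mul_assoc, ← mul_zpow]
  simp

theorem abs_besselJ_natAbs (n : ℤ) (t : ℝ) : |besselJ n.natAbs t| = |besselJ n t| := by
  rcases Int.natAbs_eq n with h | h
  · rw [← h]
  · conv_rhs => rw [h, besselJ_neg, abs_mul, abs_zpow, abs_neg, abs_one, one_zpow, one_mul]

/-- Bessel's inequality for the Fourier coefficients of `θ ↦ exp (i t sin θ)`. -/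
theorem sum_sq_besselJ_le_one (s : Finset ℤ) (t : ℝ) : ∑ n ∈ s, besselJ n t ^ 2 ≤ 1 := by
  have hpi := Real.pi_pos
  have hab : -Real.pi < Real.pi := by linarith
  set f : ℝ → ℂ := fun θ => Complex.exp ((t * Real.sin θ : ℝ) * Complex.I) with hf
  have hfc : Continuous f := by fun_prop
  have hfn : ∀ θ, ‖f θ‖ = 1 := fun θ => Complex.norm_exp_ofReal_mul_I _
  have hL2 : MeasureTheory.MemLp f 2 (MeasureTheory.volume.restrict (Set.Ioc (-Real.pi) Real.pi)) :=
    MeasureTheory.MemLp.of_bound hfc.aestronglyMeasurable 1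
      (Filter.Eventually.of_forall fun θ => (hfn θ).le)
  have hsum := hasSum_sq_fourierCoeffOn hab hL2
  have hone : (Real.pi - -Real.pi)⁻¹ • ∫ x in (-Real.pi)..Real.pi, ‖f x‖ ^ 2 = 1 := by
    simp only [hfn, one_pow, intervalIntegral.integral_const, smul_eq_mul, mul_one]
    exact inv_mul_cancel₀ (by linarith)
  rw [hone] at hsum
  -- The real part of the Fourier coefficient is already `J_n`, so its imaginary part need not be
  -- shown to vanish.
  have hle : ∀ n, besselJ n t ^ 2 ≤ ‖fourierCoeffOn hab f n‖ ^ 2 := by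
    intro n
    have hre : besselJ n t = (fourierCoeffOn hab f n).re := by
      rw [fourierCoeffOn_eq_integral]
      have hint : ∀ x : ℝ, (fourier (-n) (x : AddCircle (Real.pi - -Real.pi)) • f x) =
          Complex.exp ((t * Real.sin x - n * x : ℝ) * Complex.I) := by
        intro x
        rw [fourier_coe_apply, smul_eq_mul, ← Complex.exp_add]
        congr 1
        push_cast
        have : (Real.pi : ℂ) ≠ 0 := by exact_mod_cast hpi.ne'
        field_simp
        ring
      simp only [hint]
      have hcont : Continuous fun x : ℝ =>
          Complex.exp ((t * Real.sin x - n * x : ℝ) * Complex.I) := by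
        fun_prop
      have h2 : (∫ x in (-Real.pi)..Real.pi,
          Complex.exp ((t * Real.sin x - n * x : ℝ) * Complex.I)).re =
          ∫ x in (-Real.pi)..Real.pi, Real.cos (n * x - t * Real.sin x) := by
        have := intervalIntegral.intervalIntegral_re (𝕜 := ℂ)
          (hcont.intervalIntegrable (μ := MeasureTheory.volume) (-Real.pi) Real.pi)
        refine this.symm.trans (intervalIntegral.integral_congr fun x _ => ?_)
        change (Complex.exp _).re = _
        rw [Complex.exp_ofReal_mul_I_re, ← Real.cos_neg]
        congr 1; ring
      have h3 : ∫ x in (-Real.pi)..Real.pi, Real.cos (n * x - t * Real.sin x) =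
          2 * ∫ x in (0 : ℝ)..Real.pi, Real.cos (n * x - t * Real.sin x) := by
        have hc : Continuous fun x : ℝ => Real.cos (n * x - t * Real.sin x) := by fun_prop
        rw [← intervalIntegral.integral_add_adjacent_intervals (b := 0)
          (hc.intervalIntegrable _ _) (hc.intervalIntegrable _ _), two_mul]
        congr 1
        have := intervalIntegral.integral_comp_neg (a := 0) (b := Real.pi)
          (fun x : ℝ => Real.cos (n * x - t * Real.sin x))
        rw [neg_zero] at this
        rw [← this]
        refine intervalIntegral.integral_congr fun x _ => ?_
        simp only [Real.sin_neg]
        rw [← Real.cos_neg]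
        congr 1; ring
      rw [Complex.smul_re, h2, h3, besselJ, smul_eq_mul]
      field_simp
      ring
    rw [hre, ← sq_abs]
    exact pow_le_pow_left₀ (abs_nonneg _) (Complex.abs_re_le_norm _) 2
  exact (Finset.sum_le_sum fun n _ => hle n).trans
    (sum_le_hasSum s (fun n _ => sq_nonneg _) hsum)

end LatticeResolvent

namespace LatticeResolvent

/-! ### Bounds for Bessel functions from Bessel's equation -/

/-- The logarithmic derivative `t J_n'(t)`, written as `n J_n - t J_{n+1}`. -/
def besselLogDeriv (n : ℤ) (t : ℝ) : ℝ := n * besselJ n t - t * besselJ (n + 1) t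

theorem continuous_besselLogDeriv (n : ℤ) : Continuous (besselLogDeriv n) :=
  ((continuous_besselJ n).const_mul _).sub (continuous_id.mul (continuous_besselJ (n + 1)))

theorem hasDerivAt_besselJ_of_ne (n : ℤ) {t : ℝ} (ht : t ≠ 0) :
    HasDerivAt (besselJ n) (besselLogDeriv n t / t) t := by
  refine (hasDerivAt_besselJ n t).congr_deriv ?_
  have h := besselJ_recurrence n t
  rw [besselLogDeriv]
  field_simp
  linarith

theorem hasDerivAt_besselJ_succ (n : ℤ) {t : ℝ} (ht : t ≠ 0) :
    HasDerivAt (besselJ (n + 1)) (besselJ n t - (n + 1) / t * besselJ (n + 1) t) t := by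
  refine (hasDerivAt_besselJ (n + 1) t).congr_deriv ?_
  have h := besselJ_recurrence (n + 1) t
  rw [add_sub_cancel_right] at h ⊢
  push_cast at h
  field_simp
  linarith

/-- With `Q = t J_n'`, Bessel's equation is the first-order system `t J' = Q`, `t Q' = -(t² - n²)
J`. All later estimates on the size of `J_n` rest on this pair. -/
theorem hasDerivAt_besselLogDeriv (n : ℤ) {t : ℝ} (ht : t ≠ 0) :
    HasDerivAt (besselLogDeriv n) (-((t ^ 2 - n ^ 2) / t * besselJ n t)) t := by
  have h1 := (hasDerivAt_besselJ_of_ne n ht).const_mul (n : ℝ)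
  have h2 := (hasDerivAt_id t).mul (hasDerivAt_besselJ_succ n ht)
  refine (h1.sub h2).congr_deriv ?_
  rw [besselLogDeriv]
  simp only [id]
  field_simp
  ring

/-! #### The amplitude at infinity -/

theorem monotoneOn_of_hasDerivAt_nonneg {D : Set ℝ} (hD : Convex ℝ D) {f f' : ℝ → ℝ}
    (hf : ContinuousOn f D) (hf' : ∀ x ∈ interior D, HasDerivAt f (f' x) x)
    (hf'₀ : ∀ x ∈ interior D, 0 ≤ f' x) : MonotoneOn f D :=
  monotoneOn_of_hasDerivWithinAt_nonneg hD hf (fun x hx => (hf' x hx).hasDerivWithinAt) hf'₀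

theorem nonneg_of_hasDerivAt_nonneg {f f' : ℝ → ℝ} (hf : Continuous f) (h0 : f 0 = 0)
    (hf' : ∀ x, 0 < x → HasDerivAt f (f' x) x) (hf'₀ : ∀ x, 0 < x → 0 ≤ f' x) {t : ℝ}
    (ht : 0 ≤ t) : 0 ≤ f t := by
  have h : MonotoneOn f (Set.Ici 0) :=
    monotoneOn_of_hasDerivAt_nonneg (convex_Ici 0) hf.continuousOn
      (fun x hx => hf' x (by simpa using hx)) (fun x hx => hf'₀ x (by simpa using hx))
  rw [← h0]
  exact h Set.self_mem_Ici ht ht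

/-! ### Alternating Taylor bounds for `J_0` and `J_1` -/

theorem hasDerivAt_besselJ_zero (t : ℝ) : HasDerivAt (besselJ 0) (-besselJ 1 t) t := by
  refine (hasDerivAt_besselJ 0 t).congr_deriv ?_
  have h := besselJ_neg 1 t
  norm_num at h ⊢
  rw [h]
  ring

theorem hasDerivAt_mul_besselJ_one {t : ℝ} (ht : t ≠ 0) :
    HasDerivAt (fun t => t * besselJ 1 t) (t * besselJ 0 t) t := by
  have h := (hasDerivAt_id t).mul (hasDerivAt_besselJ_succ 0 ht)
  rw [zero_add] at h
  refine h.congr_deriv ?_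
  simp only [id, Int.cast_zero]
  field_simp
  ring

/-- Start of a bootstrap: `J_0 ≤ 1` is integrated alternately through `(t J_1)' = t J_0` and `J_0' =
-J_1`, each step adding one Taylor term and reversing the inequality. The bounds serve only to
evaluate an energy at `t = 1`. -/
theorem besselJ_one_le {t : ℝ} (ht : 0 ≤ t) : besselJ 1 t ≤ t / 2 := by
  have h : 0 ≤ t ^ 2 / 2 - t * besselJ 1 t := by
    refine nonneg_of_hasDerivAt_nonneg (f := fun t => t ^ 2 / 2 - t * besselJ 1 t)
      (f' := fun t => t - t * besselJ 0 t) ?_ (by simp) ?_ ?_ ht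
    · have := continuous_besselJ 1
      fun_prop
    · intro x hx
      exact ((((hasDerivAt_id x).pow 2).div_const 2).sub
        (hasDerivAt_mul_besselJ_one hx.ne')).congr_deriv (by simp)
    · intro x hx
      nlinarith [(abs_le.mp (abs_besselJ_le_one 0 x)).2]
  rcases ht.eq_or_lt with rfl | ht
  · simp [besselJ_zero_right]
  · refine le_of_mul_le_mul_left ?_ ht
    linarith

theorem le_besselJ_zero {t : ℝ} (ht : 0 ≤ t) : 1 - t ^ 2 / 4 ≤ besselJ 0 t := by
  have h : 0 ≤ besselJ 0 t - (1 - t ^ 2 / 4) := by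
    refine nonneg_of_hasDerivAt_nonneg (f := fun t => besselJ 0 t - (1 - t ^ 2 / 4))
      (f' := fun t => t / 2 - besselJ 1 t) ?_ (by simp [besselJ_zero_right]) ?_ ?_ ht
    · have := continuous_besselJ 0
      fun_prop
    · intro x hx
      refine ((hasDerivAt_besselJ_zero x).sub
        ((((hasDerivAt_id x).pow 2).div_const 4).const_sub 1)).congr_deriv ?_
      simp only [id]
      ring
    · intro x hx
      linarith [besselJ_one_le hx.le]
  linarith

theorem le_besselJ_one {t : ℝ} (ht : 0 ≤ t) : t / 2 - t ^ 3 / 16 ≤ besselJ 1 t := by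
  have h : 0 ≤ t * besselJ 1 t - (t ^ 2 / 2 - t ^ 4 / 16) := by
    refine nonneg_of_hasDerivAt_nonneg (f := fun t => t * besselJ 1 t - (t ^ 2 / 2 - t ^ 4 / 16))
      (f' := fun t => t * (besselJ 0 t - (1 - t ^ 2 / 4))) ?_ (by simp) ?_ ?_ ht
    · have := continuous_besselJ 1
      fun_prop
    · intro x hx
      refine ((hasDerivAt_mul_besselJ_one hx.ne').sub
        ((((hasDerivAt_id x).pow 2).div_const 2).sub
          (((hasDerivAt_id x).pow 4).div_const 16))).congr_deriv ?_
      simp only [id]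
      ring
    · intro x hx
      exact mul_nonneg hx.le (by linarith [le_besselJ_zero hx.le])
  rcases ht.eq_or_lt with rfl | ht
  · simp [besselJ_zero_right]
  · refine le_of_mul_le_mul_left ?_ ht
    linarith

theorem besselJ_zero_le {t : ℝ} (ht : 0 ≤ t) : besselJ 0 t ≤ 1 - t ^ 2 / 4 + t ^ 4 / 64 := by
  have h : 0 ≤ 1 - t ^ 2 / 4 + t ^ 4 / 64 - besselJ 0 t := by
    refine nonneg_of_hasDerivAt_nonneg
      (f := fun t => 1 - t ^ 2 / 4 + t ^ 4 / 64 - besselJ 0 t)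
      (f' := fun t => besselJ 1 t - (t / 2 - t ^ 3 / 16)) ?_ (by simp [besselJ_zero_right])
      ?_ ?_ ht
    · have := continuous_besselJ 0
      fun_prop
    · intro x hx
      refine ((((((hasDerivAt_id x).pow 2).div_const 4).const_sub 1).add
          (((hasDerivAt_id x).pow 4).div_const 64)).sub
          (hasDerivAt_besselJ_zero x)).congr_deriv ?_
      simp only [id]
      ring
    · intro x hx
      linarith [le_besselJ_one hx.le]
  linarith

theorem besselJ_one_le' {t : ℝ} (ht : 0 ≤ t) :
    besselJ 1 t ≤ t / 2 - t ^ 3 / 16 + t ^ 5 / 384 := by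
  have h : 0 ≤ t ^ 2 / 2 - t ^ 4 / 16 + t ^ 6 / 384 - t * besselJ 1 t := by
    refine nonneg_of_hasDerivAt_nonneg
      (f := fun t => t ^ 2 / 2 - t ^ 4 / 16 + t ^ 6 / 384 - t * besselJ 1 t)
      (f' := fun t => t * (1 - t ^ 2 / 4 + t ^ 4 / 64 - besselJ 0 t)) ?_ (by simp) ?_ ?_ ht
    · have := continuous_besselJ 1
      fun_prop
    · intro x hx
      refine ((((((hasDerivAt_id x).pow 2).div_const 2).sub
          (((hasDerivAt_id x).pow 4).div_const 16)).add
          (((hasDerivAt_id x).pow 6).div_const 384)).sub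
          (hasDerivAt_mul_besselJ_one hx.ne')).congr_deriv ?_
      simp only [id]
      ring
    · intro x hx
      exact mul_nonneg hx.le (by linarith [besselJ_zero_le hx.le])
  rcases ht.eq_or_lt with rfl | ht
  · simp [besselJ_zero_right]
  · refine le_of_mul_le_mul_left ?_ ht
    linarith

/-- Sonin's energy for `J_0` is decreasing; its value at `t = 1` bounds the amplitude. -/
theorem besselJ_zero_energy_le {t : ℝ} (ht : 1 ≤ t) :
    t * (besselJ 0 t ^ 2 + besselJ 1 t ^ 2) - besselJ 0 t * besselJ 1 t ≤ 37 / 50 := by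
  -- With `w = √t J_0` one has `w'' + (1 + 1/(4t²)) w = 0`, and `E = w'² + (1 + 1/(4t²)) w²`. It
  -- decreases because the coefficient does.
  set E : ℝ → ℝ := fun t => t * (besselJ 0 t ^ 2 + besselJ 1 t ^ 2) - besselJ 0 t * besselJ 1 t
    + besselJ 0 t ^ 2 / (2 * t) with hE
  have hd : ∀ x, x ≠ 0 → HasDerivAt E (-(besselJ 0 x ^ 2 / (2 * x ^ 2))) x := by
    intro x hx
    have h0 := hasDerivAt_besselJ_zero x
    have h1 := hasDerivAt_besselJ_succ 0 hx
    rw [zero_add] at h1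
    refine ((((hasDerivAt_id x).mul ((h0.pow 2).add (h1.pow 2))).sub (h0.mul h1)).add
      ((h0.pow 2).div ((hasDerivAt_id x).const_mul 2) (by simpa using hx))).congr_deriv ?_
    simp only [id, Pi.pow_apply, Pi.add_apply, Int.cast_zero]
    field_simp
    ring
  have hanti : MonotoneOn (fun t => -E t) (Set.Ici 1) := by
    have hne : ∀ x ∈ Set.Ici (1 : ℝ), x ≠ 0 := fun x hx =>
      (lt_of_lt_of_le zero_lt_one (Set.mem_Ici.mp hx)).ne'
    refine monotoneOn_of_hasDerivAt_nonneg (convex_Ici 1)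
      (fun x hx => (hd x (hne x hx)).neg.continuousAt.continuousWithinAt)
      (fun x hx => (hd x (hne x (interior_subset hx))).neg) ?_
    intro x _
    rw [neg_neg]
    positivity
  have h1 : E t ≤ E 1 := by
    have := hanti Set.self_mem_Ici (Set.mem_Ici.mpr ht) ht
    simpa using this
  have h2 : 0 ≤ besselJ 0 t ^ 2 / (2 * t) := by positivity
  -- Numerically `E(1) ≈ 0.735`; the limit at infinity is `2/π`, but any bound slightly below `3/4`
  -- is enough.
  have h3 : E 1 ≤ 37 / 50 := by
    have a1 := le_besselJ_zero zero_le_one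
    have a2 := besselJ_zero_le zero_le_one
    have a3 := le_besselJ_one zero_le_one
    have a4 := besselJ_one_le' zero_le_one
    simp only [hE]
    norm_num at a1 a2 a3 a4 ⊢
    nlinarith
  have h4 : E t = t * (besselJ 0 t ^ 2 + besselJ 1 t ^ 2) - besselJ 0 t * besselJ 1 t
    + besselJ 0 t ^ 2 / (2 * t) := rfl
  linarith

-- For `J_0` and `J_1` the energy bound gives decay like `t^{-1/2}`; the three-term recurrence
-- carries decay to higher orders.
open Filter Topology in
theorem tendsto_besselJ_atTop (n : ℕ) :
    Tendsto (besselJ n) atTop (𝓝 0) ∧ Tendsto (besselJ (n + 1)) atTop (𝓝 0) := by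
  induction n with
  | zero =>
    have hb : ∀ t : ℝ, 1 ≤ t → besselJ 0 t ^ 2 + besselJ 1 t ^ 2 ≤ 2 / t := by
      intro t ht
      have h := besselJ_zero_energy_le ht
      rw [le_div_iff₀ (by linarith)]
      nlinarith [sq_nonneg (besselJ 0 t - besselJ 1 t), sq_nonneg (besselJ 0 t),
        sq_nonneg (besselJ 1 t)]
    have hlim : Tendsto (fun t : ℝ => Real.sqrt (2 / t)) atTop (𝓝 0) := by
      have := (tendsto_const_nhds (x := (2 : ℝ))).div_atTop (tendsto_id (α := ℝ))
      simpa using this.sqrt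
    constructor
    · refine squeeze_zero_norm' ?_ hlim
      filter_upwards [eventually_ge_atTop 1] with t ht
      refine Real.le_sqrt_of_sq_le ?_
      rw [Real.norm_eq_abs, sq_abs]
      have := hb t ht
      simp only [Nat.cast_zero]
      nlinarith [sq_nonneg (besselJ 1 t)]
    · refine squeeze_zero_norm' ?_ hlim
      filter_upwards [eventually_ge_atTop 1] with t ht
      refine Real.le_sqrt_of_sq_le ?_
      rw [Real.norm_eq_abs, sq_abs]
      have := hb t ht
      simp only [Nat.cast_zero, zero_add]
      nlinarith [sq_nonneg (besselJ 0 t)]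
  | succ n ih =>
    refine ⟨by exact_mod_cast ih.2, ?_⟩
    have h1 : Tendsto (fun t : ℝ => 2 * (n + 1) / t * besselJ (n + 1) t - besselJ n t) atTop
        (𝓝 (0 * 0 - 0)) :=
      ((tendsto_const_nhds.div_atTop tendsto_id).mul ih.2).sub ih.1
    rw [mul_zero, sub_zero] at h1
    refine h1.congr' ?_
    filter_upwards [eventually_gt_atTop 0] with t ht
    have h := besselJ_recurrence (n + 1) t
    rw [add_sub_cancel_right] at h
    push_cast at h ⊢
    field_simp
    linarith

-- The amplitude is asymptotically independent of `n`: by the recurrence `t (J_{n+2}² - J_n²) =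
-- 2(n+1) J_{n+1} (J_{n+2} - J_n) → 0`. Hence the bound `37/50` for `n = 0` passes to every `n` with
-- an arbitrarily small loss, here `1/200`.
open Filter Topology in
theorem eventually_besselJ_amplitude_le (n : ℕ) :
    ∀ᶠ t in atTop, t * (besselJ n t ^ 2 + besselJ (n + 1) t ^ 2) ≤ 149 / 200 := by
  have hdiff : ∀ n : ℕ, Tendsto (fun t => t * (besselJ n t ^ 2 + besselJ (n + 1) t ^ 2) -
      t * (besselJ 0 t ^ 2 + besselJ 1 t ^ 2)) atTop (𝓝 0) := by
    intro n
    induction n with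
    | zero => simp
    | succ n ih =>
      have h1 := (tendsto_besselJ_atTop n).1
      have h2 := (tendsto_besselJ_atTop n).2
      have h3 := (tendsto_besselJ_atTop (n + 1)).2
      have h4 := ((h2.const_mul (2 * (n + 1) : ℝ)).mul (h3.sub h1)).add ih
      simp only [mul_zero, sub_zero, add_zero] at h4
      refine h4.congr fun t => ?_
      have h := besselJ_recurrence (n + 1) t
      rw [add_sub_cancel_right] at h
      push_cast at h ⊢
      linear_combination (besselJ (n + 1 + 1) t - besselJ n t) * h
  have h0 := (tendsto_besselJ_atTop 0).1.mul (tendsto_besselJ_atTop 0).2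
  rw [mul_zero] at h0
  have h := (h0.add (hdiff n)).eventually_le_const (show (0 : ℝ) + 0 < 1 / 200 by norm_num)
  filter_upwards [h, eventually_ge_atTop 1] with t ht ht1
  have := besselJ_zero_energy_le ht1
  norm_num at ht
  linarith

/-! #### The oscillatory region -/

/-- Sonin's energy for the Liouville-Green transform of `J_n` on `t > n`. -/
def besselEnergy (n : ℤ) (t : ℝ) : ℝ :=
  Real.sqrt (t ^ 2 - n ^ 2) * (besselJ n t ^ 2 +
    (2 * (t ^ 2 - n ^ 2) * besselLogDeriv n t + t ^ 2 * besselJ n t) ^ 2 /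
      (4 * (t ^ 2 - n ^ 2) ^ 3 + t ^ 2 * (t ^ 2 + 4 * n ^ 2)))

/-- In the variable `log t` Bessel's equation reads `J'' + φJ = 0` with `φ = t² - n²`. The
Liouville-Green substitution `w = φ^{1/4} J`, `dξ = √φ d(log t)` gives `w_ξξ + (1+ψ) w = 0` with `ψ
= t²(t² + 4n²)/(4φ³)`, and the energy is `w² + w_ξ²/(1+ψ)`. Its derivative is `-ψ_ξ w_ξ²/(1+ψ)²`,
which is nonnegative because `ψ` decreases on `t > n`. -/
theorem hasDerivAt_besselEnergy (n : ℤ) {t : ℝ} (ht : 0 < t) (htn : 0 < t ^ 2 - (n : ℝ) ^ 2) :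
    HasDerivAt (besselEnergy n)
      (Real.sqrt (t ^ 2 - n ^ 2) / (t ^ 2 - n ^ 2) *
      (2 * (t ^ 2 - n ^ 2) * besselLogDeriv n t + t ^ 2 * besselJ n t) ^ 2 /
      (4 * (t ^ 2 - n ^ 2) ^ 3 + t ^ 2 * (t ^ 2 + 4 * n ^ 2)) ^ 2 *
      (t * (2 * t ^ 4 + 20 * n ^ 2 * t ^ 2 + 8 * n ^ 4))) t := by
  have hP := hasDerivAt_besselJ_of_ne n ht.ne'
  have hQ := hasDerivAt_besselLogDeriv n ht.ne'
  have hφ : HasDerivAt (fun t : ℝ => t ^ 2 - (n : ℝ) ^ 2) (2 * t) t := by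
    simpa using (hasDerivAt_pow 2 t).sub_const ((n : ℝ) ^ 2)
  have ht2 : HasDerivAt (fun t : ℝ => t ^ 2) (2 * t) t := by simpa using hasDerivAt_pow 2 t
  have hS := hφ.sqrt htn.ne'
  have hN0 : 0 < 4 * (t ^ 2 - (n : ℝ) ^ 2) ^ 3 + t ^ 2 * (t ^ 2 + 4 * n ^ 2) := by positivity
  have hN := ((hφ.pow 3).const_mul 4).add (ht2.mul (ht2.add_const (4 * (n : ℝ) ^ 2)))
  have hR := ((hφ.const_mul 2).mul hQ).add (ht2.mul hP)
  refine (hS.mul ((hP.pow 2).add ((hR.pow 2).div hN hN0.ne'))).congr_deriv ?_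
  have hS2 := Real.sq_sqrt htn.le
  have hS0 : Real.sqrt (t ^ 2 - n ^ 2) ≠ 0 := (Real.sqrt_pos.mpr htn).ne'
  simp only [Pi.pow_apply, Pi.add_apply, Pi.mul_apply, Pi.div_apply]
  set S := Real.sqrt (t ^ 2 - n ^ 2)
  set P := besselJ n t
  set Q := besselLogDeriv n t
  have hne := htn.ne'
  have hdS : 2 * t / (2 * S) = S * t / (t ^ 2 - n ^ 2) := by
    rw [← hS2]
    field_simp
  rw [hdS]
  field_simp
  ring

theorem besselEnergy_monotoneOn (n : ℕ) : MonotoneOn (besselEnergy n) (Set.Ioi (n : ℝ)) := by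
  have hpos : ∀ x ∈ Set.Ioi (n : ℝ), 0 < x ∧ 0 < x ^ 2 - ((n : ℤ) : ℝ) ^ 2 := by
    intro x hx
    have hn : (0 : ℝ) ≤ n := n.cast_nonneg
    have hx : (n : ℝ) < x := hx
    refine ⟨hn.trans_lt hx, ?_⟩
    push_cast
    nlinarith
  refine monotoneOn_of_hasDerivAt_nonneg (convex_Ioi _)
    (fun x hx => (hasDerivAt_besselEnergy n (hpos x hx).1
      (hpos x hx).2).continuousAt.continuousWithinAt)
    (fun x hx => hasDerivAt_besselEnergy n (hpos x (interior_subset hx)).1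
      (hpos x (interior_subset hx)).2) ?_
  intro x hx
  have h := hpos x (interior_subset hx)
  have h1 := h.1
  have h2 := h.2
  positivity

/-- For `t` much larger than `n`, `φ ≈ t²` and `Q ≈ -t J_{n+1}`, so the energy is close to the
amplitude. The threshold `2000 (n+1)` makes all corrections fit into the factor `1003/1000`. -/
theorem besselEnergy_le_amplitude (n : ℕ) {t : ℝ} (ht : 2000 * ((n : ℝ) + 1) ≤ t) :
    besselEnergy n t ≤ 1003 / 1000 * (t * (besselJ n t ^ 2 + besselJ (n + 1) t ^ 2)) := by
  have hn : (0 : ℝ) ≤ n := n.cast_nonneg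
  have ht0 : 0 < t := by linarith
  rw [besselEnergy, besselLogDeriv]
  push_cast
  set P := besselJ n t
  set V := besselJ (n + 1) t
  have htn : (n : ℝ) ≤ t / 2000 := by linarith
  set φ := t ^ 2 - (n : ℝ) ^ 2 with hφ
  have hφ1 : φ ≤ t ^ 2 := by rw [hφ]; nlinarith
  have hφ2 : 9999 / 10000 * t ^ 2 ≤ φ := by rw [hφ]; nlinarith
  have hφ0 : 0 < φ := lt_of_lt_of_le (by positivity) hφ2
  have hS : Real.sqrt φ ≤ t := Real.sqrt_le_iff.mpr ⟨ht0.le, hφ1⟩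
  -- Weighted square: `(x+y)² ≤ (1 + 1/1000) x² + (1 + 1000) y²`, with `x` the main term in
  -- `J_{n+1}`.
  have hR : (2 * φ * (n * P - t * V) + t ^ 2 * P) ^ 2 ≤
      1001 / 1000 * (2 * φ * t * V) ^ 2 + 1001 * ((2 * n + 1) * t ^ 2 * P) ^ 2 := by
    have h1 : ((2 * φ * n + t ^ 2) * P) ^ 2 ≤ ((2 * n + 1) * t ^ 2 * P) ^ 2 := by
      rw [mul_pow, mul_pow]
      refine mul_le_mul_of_nonneg_right (pow_le_pow_left₀ (by positivity) ?_ 2) (sq_nonneg _)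
      nlinarith
    nlinarith [sq_nonneg (2 * φ * t * V + 1000 * ((2 * φ * n + t ^ 2) * P))]
  have hN : 4 * φ ^ 3 ≤ 4 * φ ^ 3 + t ^ 2 * (t ^ 2 + 4 * n ^ 2) :=
    le_add_of_nonneg_right (by positivity)
  have hV : 1001 / 1000 * (2 * φ * t * V) ^ 2 / (4 * φ ^ 3) ≤ 1003 / 1000 * V ^ 2 := by
    rw [div_le_iff₀ (by positivity)]
    have h1 : 1001 / 1000 * t ^ 2 ≤ 1003 / 1000 * φ := by nlinarith
    have h2 := mul_le_mul_of_nonneg_left h1 (show 0 ≤ 4 * φ ^ 2 * V ^ 2 by positivity)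
    nlinarith
  have hP : 1001 * ((2 * n + 1) * t ^ 2 * P) ^ 2 / (4 * φ ^ 3) ≤ 3 / 1000 * P ^ 2 := by
    rw [div_le_iff₀ (by positivity)]
    have h1 : (2 * (n : ℝ) + 1) ^ 2 ≤ (t / 1000) ^ 2 :=
      pow_le_pow_left₀ (by positivity) (by linarith) 2
    have h2 : (9999 / 10000 * t ^ 2) ^ 3 ≤ φ ^ 3 := pow_le_pow_left₀ (by positivity) hφ2 3
    have h3 := mul_le_mul_of_nonneg_left h1 (show 0 ≤ 1001 * t ^ 4 * P ^ 2 by positivity)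
    have h4 := mul_le_mul_of_nonneg_left h2 (show 0 ≤ 12 / 1000 * P ^ 2 by positivity)
    have h5 : 0 ≤ t ^ 6 * P ^ 2 := by positivity
    nlinarith
  have hsum : P ^ 2 + (2 * φ * (n * P - t * V) + t ^ 2 * P) ^ 2 /
      (4 * φ ^ 3 + t ^ 2 * (t ^ 2 + 4 * n ^ 2)) ≤ 1003 / 1000 * (P ^ 2 + V ^ 2) := by
    have h1 : (2 * φ * (n * P - t * V) + t ^ 2 * P) ^ 2 /
      (4 * φ ^ 3 + t ^ 2 * (t ^ 2 + 4 * n ^ 2)) ≤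
      (1001 / 1000 * (2 * φ * t * V) ^ 2 + 1001 * ((2 * n + 1) * t ^ 2 * P) ^ 2) / (4 * φ ^ 3) :=
      div_le_div₀ (by positivity) hR (by positivity) hN
    rw [add_div] at h1
    linarith
  calc _ ≤ t * (1003 / 1000 * (P ^ 2 + V ^ 2)) := by
        refine mul_le_mul hS hsum ?_ ht0.le
        positivity
    _ = _ := by ring

/-- A uniform amplitude bound of Krasikov's type: `√(t² - n²) J_n(t)² ≤ 3/4` for `t > n`
(the optimal constant is `2 / π`). -/
theorem sqrt_mul_sq_besselJ_le (n : ℕ) {t : ℝ} (ht : (n : ℝ) < t) :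
    Real.sqrt (t ^ 2 - n ^ 2) * besselJ n t ^ 2 ≤ 3 / 4 := by
  have hn : (0 : ℝ) ≤ n := n.cast_nonneg
  -- The energy increases, so its value at `t` is at most that at a remote `T`, where it is bounded
  -- by `1003/1000 · 149/200 < 3/4`.
  obtain ⟨T, h1, h2, h3⟩ := ((eventually_besselJ_amplitude_le n).and
    ((Filter.eventually_ge_atTop t).and
      (Filter.eventually_ge_atTop (2000 * ((n : ℝ) + 1))))).exists
  have h4 := besselEnergy_monotoneOn n ht (lt_of_lt_of_le ht h2) h2
  have h5 := besselEnergy_le_amplitude n h3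
  have h6 : Real.sqrt (t ^ 2 - n ^ 2) * besselJ n t ^ 2 ≤ besselEnergy n t := by
    rw [besselEnergy]
    push_cast
    refine mul_le_mul_of_nonneg_left (le_add_of_nonneg_right ?_) (Real.sqrt_nonneg _)
    have : 0 < t ^ 2 - (n : ℝ) ^ 2 := by nlinarith
    positivity
  linarith

/-! #### The transition region and the exponential region -/

/-- The difference of the two sides vanishes at `0` and has derivative `2t J_n²`. It shows that,
below the turning point, `J_n` grows at least at rate `√(n²/t² - 1)` in modulus and has no nonzero
critical value at a positive argument. -/
theorem sq_besselLogDeriv_ge (n : ℕ) (hn : n ≠ 0) {t : ℝ} (ht : 0 ≤ t) :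
    ((n : ℝ) ^ 2 - t ^ 2) * besselJ n t ^ 2 ≤ besselLogDeriv n t ^ 2 := by
  have h : 0 ≤ besselLogDeriv n t ^ 2 - ((n : ℝ) ^ 2 - t ^ 2) * besselJ n t ^ 2 := by
    refine nonneg_of_hasDerivAt_nonneg
      (f := fun t => besselLogDeriv n t ^ 2 - ((n : ℝ) ^ 2 - t ^ 2) * besselJ n t ^ 2)
      (f' := fun t => 2 * t * besselJ n t ^ 2) ?_ ?_ ?_ ?_ ht
    · have h1 := continuous_besselJ n
      have h2 := continuous_besselLogDeriv n
      fun_prop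
    · simp [besselLogDeriv, besselJ_zero_right, hn]
    · intro x hx
      refine (((hasDerivAt_besselLogDeriv n hx.ne').pow 2).sub
        ((((hasDerivAt_id x).pow 2).const_sub ((n : ℝ) ^ 2)).mul
          ((hasDerivAt_besselJ_of_ne n hx.ne').pow 2))).congr_deriv ?_
      simp only [id, Pi.pow_apply]
      push_cast
      field_simp
      ring
    · intro x hx
      positivity
  linarith

/-- The product starts at `0` and its derivative `(Q² + (n² - t²) J²)/t` is nonnegative up to `t =
n`. This supplies the sign that `sq_besselLogDeriv_ge` leaves open. -/
theorem besselJ_mul_besselLogDeriv_nonneg (n : ℕ) (hn : n ≠ 0) {t : ℝ} (ht : 0 ≤ t)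
    (htn : t ≤ n) : 0 ≤ besselJ n t * besselLogDeriv n t := by
  have h : MonotoneOn (fun t => besselJ n t * besselLogDeriv n t) (Set.Icc 0 (n : ℝ)) := by
    refine monotoneOn_of_hasDerivAt_nonneg (convex_Icc _ _)
      (f' := fun t => besselLogDeriv n t ^ 2 / t + ((n : ℝ) ^ 2 - t ^ 2) / t * besselJ n t ^ 2)
      ((continuous_besselJ n).mul (continuous_besselLogDeriv n)).continuousOn ?_ ?_
    · intro x hx
      rw [interior_Icc] at hx
      refine ((hasDerivAt_besselJ_of_ne n hx.1.ne').mul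
        (hasDerivAt_besselLogDeriv n hx.1.ne')).congr_deriv ?_
      push_cast
      field_simp
      ring
    · intro x hx
      rw [interior_Icc] at hx
      have h1 := hx.1
      have h2 : 0 ≤ (n : ℝ) ^ 2 - x ^ 2 := by nlinarith [hx.2]
      positivity
  have h0 := h ⟨le_rfl, n.cast_nonneg⟩ ⟨ht, htn⟩ ht
  simpa [besselJ_zero_right, hn] using h0

/-- The maximum of `|J_n|` on `[0, n + τ]` is controlled by its value at the right end point. -/
theorem abs_besselJ_le_of_le_add (n : ℕ) (hn : n ≠ 0) {τ : ℝ} (hτ : 0 ≤ τ) {t : ℝ} (ht : 0 ≤ t)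
    (ht' : t ≤ n + τ) :
    (1 - τ ^ 3 / (3 * n)) * |besselJ n t| ≤ |besselJ n (n + τ)| := by
  have hn0 : (0 : ℝ) < n := by exact_mod_cast Nat.pos_of_ne_zero hn
  -- At an interior maximum `x` of `|J_n|` with nonzero value one has `Q(x) = 0`, hence `x ≥ n`.
  -- From there the system shows that `J_n` can change only slowly up to `n + τ`.
  obtain ⟨x, hx, hmax⟩ := isCompact_Icc.exists_isMaxOn (s := Set.Icc (0 : ℝ) (n + τ))
    ⟨0, le_rfl, by positivity⟩ (continuous_besselJ n).abs.continuousOn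
  set M := |besselJ n x| with hM
  have hM0 : 0 ≤ M := abs_nonneg _
  have hle : ∀ s ∈ Set.Icc (0 : ℝ) (n + τ), |besselJ n s| ≤ M := fun s hs => hmax hs
  suffices h : (1 - τ ^ 3 / (3 * n)) * M ≤ |besselJ n (n + τ)| by
    rcases le_total 0 (1 - τ ^ 3 / (3 * (n : ℝ))) with h1 | h1
    · exact (mul_le_mul_of_nonneg_left (hle t ⟨ht, ht'⟩) h1).trans h
    · exact (mul_nonpos_of_nonpos_of_nonneg h1 (abs_nonneg _)).trans (abs_nonneg _)
  rcases hM0.eq_or_lt with h0 | hMpos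
  · rw [← h0, mul_zero]
    exact abs_nonneg _
  rcases hx.2.eq_or_lt with hend | hlt
  · rw [hM, ← hend]
    exact mul_le_of_le_one_left (abs_nonneg _) (sub_le_self _ (by positivity))
  have hPx : besselJ n x ≠ 0 := abs_pos.mp hMpos
  have hx0 : 0 < x := by
    refine hx.1.lt_of_ne fun h => hPx ?_
    rw [← h, besselJ_zero_right]
    simp [hn]
  have hcrit : besselLogDeriv n x = 0 := by
    have hloc : IsLocalMax (fun s => besselJ n s ^ 2) x := by
      filter_upwards [Icc_mem_nhds hx0 hlt] with s hs
      exact sq_le_sq.mpr (hle s hs)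
    have hd := hloc.hasDerivAt_eq_zero ((hasDerivAt_besselJ_of_ne n hx0.ne').pow 2)
    simpa [hPx, hx0.ne'] using hd
  have hnx : (n : ℝ) ≤ x := by
    by_contra! hlt'
    have h1 := sq_besselLogDeriv_ge n hn hx0.le
    rw [hcrit] at h1
    have h2 : 0 < ((n : ℝ) ^ 2 - x ^ 2) * besselJ n x ^ 2 :=
      mul_pos (by nlinarith) (by positivity)
    norm_num at h1
    linarith
  -- `|Q'| ≤ M (s² - n²)/s ≤ 2M (s - n)`; integrating once bounds `Q`, and integrating `J' = Q/s`
  -- with `s ≥ n` gives the cubic error term below.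
  have hQ : ∀ s ∈ Set.Icc x (n + τ), ‖besselLogDeriv n s‖ ≤ M * (s - n) ^ 2 := by
    refine image_norm_le_of_norm_deriv_right_le_deriv_boundary
      (f' := fun s => -((s ^ 2 - ((n : ℤ) : ℝ) ^ 2) / s * besselJ n s))
      (B' := fun s => M * (2 * (s - n)))
      (continuous_besselLogDeriv n).continuousOn ?_ ?_ ?_ ?_
    · intro s hs
      exact (hasDerivAt_besselLogDeriv n (hx0.trans_le hs.1).ne').hasDerivWithinAt
    · rw [hcrit, norm_zero]
      positivity
    · intro s
      exact ((((hasDerivAt_id s).sub_const (n : ℝ)).pow 2).const_mul M).congr_deriv (by simp)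
    · intro s hs
      have hs0 : 0 < s := hx0.trans_le hs.1
      have hns : (n : ℝ) ≤ s := hnx.trans hs.1
      rw [norm_neg, norm_mul, Real.norm_eq_abs, Real.norm_eq_abs, mul_comm]
      refine mul_le_mul (hle s ⟨hs0.le, hs.2.le⟩) ?_ (abs_nonneg _) hM0
      push_cast
      rw [abs_of_nonneg (div_nonneg (by nlinarith) hs0.le), div_le_iff₀ hs0]
      nlinarith
  have hP : ∀ s ∈ Set.Icc x (n + τ), ‖besselJ n s - besselJ n x‖ ≤ M * ((s - n) ^ 3 / (3 * n)) := by
    refine image_norm_le_of_norm_deriv_right_le_deriv_boundary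
      (f := fun s => besselJ n s - besselJ n x)
      (f' := fun s => besselLogDeriv n s / s)
      (B' := fun s => M * ((s - n) ^ 2 / n))
      ((continuous_besselJ n).sub continuous_const).continuousOn ?_ ?_ ?_ ?_
    · intro s hs
      exact ((hasDerivAt_besselJ_of_ne n (hx0.trans_le hs.1).ne').sub_const _).hasDerivWithinAt
    · rw [sub_self, norm_zero]
      have : 0 ≤ x - n := by linarith
      positivity
    · intro s
      refine (((((hasDerivAt_id s).sub_const (n : ℝ)).pow 3).div_const (3 * (n : ℝ))).const_mul
        M).congr_deriv ?_
      simp only [id]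
      field_simp
      ring
    · intro s hs
      have hs0 : 0 < s := hx0.trans_le hs.1
      have hns : (n : ℝ) ≤ s := hnx.trans hs.1
      rw [norm_div, ← mul_div_assoc]
      refine div_le_div₀ (by positivity) (hQ s ⟨hs.1, hs.2.le⟩) hn0 ?_
      exact hns.trans (le_abs_self s)
  have h1 := hP (n + τ) ⟨hlt.le, le_rfl⟩
  rw [add_sub_cancel_left] at h1
  have h2 := norm_sub_norm_le (besselJ n x) (besselJ n (n + τ))
  rw [norm_sub_rev, Real.norm_eq_abs (besselJ n x), ← hM, Real.norm_eq_abs] at h2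
  linarith

/-- The hypothesis on `T` says `n²/T² - 1 ≥ 1/a²` when `T ≠ 0`. Thus the logarithmic derivative of
`|J_n|` is at least `1/a` on `(0, T)`, wherever `J_n ≠ 0`; equivalently `J_n² e^{-2t/a}` increases.
-/
theorem abs_besselJ_le_exp (n : ℕ) (hn : n ≠ 0) {a T t : ℝ} (ha : 0 < a)
    (hT : T ^ 2 * (1 + a ^ 2) ≤ n ^ 2 * a ^ 2) (ht : 0 ≤ t) (htT : t ≤ T) :
    |besselJ n t| ≤ |besselJ n T| * Real.exp (-((T - t) / a)) := by
  have hTn : T ≤ n := by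
    refine le_of_sq_le_sq ?_ n.cast_nonneg
    refine le_of_mul_le_mul_right ?_ (show 0 < 1 + a ^ 2 by positivity)
    nlinarith [sq_nonneg (n : ℝ)]
  have hmono : MonotoneOn (fun t => besselJ n t ^ 2 * Real.exp (-(2 * t / a))) (Set.Icc 0 T) := by
    refine monotoneOn_of_hasDerivAt_nonneg (convex_Icc _ _)
      (f' := fun t => 2 * Real.exp (-(2 * t / a)) / t *
        (besselJ n t * besselLogDeriv n t - t / a * besselJ n t ^ 2)) ?_ ?_ ?_
    · have := continuous_besselJ n
      exact Continuous.continuousOn (by fun_prop)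
    · intro x hx
      rw [interior_Icc] at hx
      have hexp : HasDerivAt (fun t => Real.exp (-(2 * t / a)))
          (Real.exp (-(2 * x / a)) * -(2 * 1 / a)) x :=
        ((((hasDerivAt_id x).const_mul 2).div_const a).neg).exp
      refine (((hasDerivAt_besselJ_of_ne n hx.1.ne').pow 2).mul hexp).congr_deriv ?_
      simp only [Pi.pow_apply]
      have := hx.1.ne'
      field_simp
      ring
    · intro x hx
      rw [interior_Icc] at hx
      have hx0 := hx.1
      have h1 := besselJ_mul_besselLogDeriv_nonneg n hn hx0.le (hx.2.le.trans hTn)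
      have h2 := sq_besselLogDeriv_ge n hn hx0.le
      have h3 : x ^ 2 / a ^ 2 ≤ (n : ℝ) ^ 2 - x ^ 2 := by
        rw [div_le_iff₀ (by positivity)]
        have : x ^ 2 ≤ T ^ 2 := pow_le_pow_left₀ hx0.le hx.2.le 2
        nlinarith [mul_le_mul_of_nonneg_right this (show 0 ≤ 1 + a ^ 2 by positivity)]
      refine mul_nonneg (by positivity) (sub_nonneg.mpr ?_)
      refine le_of_sq_le_sq ?_ h1
      have h4 : (x / a * besselJ n x ^ 2) ^ 2 =
          besselJ n x ^ 2 * (x ^ 2 / a ^ 2 * besselJ n x ^ 2) := by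
        ring
      rw [h4, mul_pow]
      refine mul_le_mul_of_nonneg_left ?_ (sq_nonneg _)
      exact (mul_le_mul_of_nonneg_right h3 (sq_nonneg _)).trans h2
  have h := hmono ⟨ht, htT⟩ ⟨ht.trans htT, le_rfl⟩ htT
  refine le_of_sq_le_sq ?_ (by positivity)
  rw [mul_pow, sq_abs, sq_abs, ← Real.exp_nat_mul]
  have h5 : Real.exp ((2 : ℕ) * -((T - t) / a)) =
      Real.exp (-(2 * T / a)) * Real.exp (2 * t / a) := by
    rw [← Real.exp_add]; congr 1; push_cast; ring
  rw [h5, ← mul_assoc]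
  refine le_trans ?_ (mul_le_mul_of_nonneg_right h (Real.exp_pos _).le)
  rw [mul_assoc, ← Real.exp_add, neg_add_cancel, Real.exp_zero, mul_one]

end LatticeResolvent

namespace LatticeResolvent

/-! ### Moments of Bessel functions -/

open MeasureTheory Set Filter Topology

theorem lintegral_Ioc_of_hasDerivAt {F f : ℝ → ℝ} {a b : ℝ} (hab : a ≤ b)
    (hF : ContinuousOn F (Icc a b)) (hd : ∀ x ∈ Ioo a b, HasDerivAt F (f x) x)
    (hf : ∀ x ∈ Ioo a b, 0 ≤ f x) :
    ∫⁻ x in Ioc a b, ENNReal.ofReal (f x) = ENNReal.ofReal (F b - F a) := by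
  have hint : IntegrableOn f (Ioc a b) := intervalIntegral.integrableOn_deriv_of_nonneg hF hd hf
  rw [← intervalIntegral.integral_eq_sub_of_hasDerivAt_of_le hab hF hd
    ((intervalIntegrable_iff_integrableOn_Ioc_of_le hab).mpr hint),
    intervalIntegral.integral_of_le hab, ofReal_integral_eq_lintegral_ofReal hint]
  rw [← restrict_Ioo_eq_restrict_Ioc]
  exact (ae_restrict_iff' measurableSet_Ioo).mpr (Eventually.of_forall hf)

theorem lintegral_Ioi_of_hasDerivAt {F f : ℝ → ℝ} {a m : ℝ}
    (hF : ContinuousWithinAt F (Ici a) a) (hd : ∀ x ∈ Ioi a, HasDerivAt F (f x) x)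
    (hf : ∀ x ∈ Ioi a, 0 ≤ f x) (hm : Tendsto F atTop (𝓝 m)) :
    ∫⁻ x in Ioi a, ENNReal.ofReal (f x) = ENNReal.ofReal (m - F a) := by
  rw [← integral_Ioi_of_hasDerivAt_of_nonneg hF hd hf hm,
    ofReal_integral_eq_lintegral_ofReal (integrableOn_Ioi_deriv_of_nonneg hF hd hf hm)]
  exact (ae_restrict_iff' measurableSet_Ioi).mpr (Eventually.of_forall hf)

theorem lintegral_Ioi_rpow {b s : ℝ} (hb : 0 < b) (hs : s < -1) :
    ∫⁻ x in Ioi b, ENNReal.ofReal (x ^ s) = ENNReal.ofReal (b ^ (s + 1) / (-s - 1)) := by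
  have h := integral_Ioi_rpow_of_lt hs hb
  rw [← ofReal_integral_eq_lintegral_ofReal (integrableOn_Ioi_rpow_of_lt hs hb), h]
  · congr 1
    rw [neg_div, ← div_neg]
    congr 1
    ring
  · exact (ae_restrict_iff' measurableSet_Ioi).mpr
      (Eventually.of_forall fun x hx => Real.rpow_nonneg (hb.trans hx).le _)

/-- The moment `∫₀^∞ t^γ |J_n(t)|^d dt`. -/
def besselMoment (d : ℕ) (n : ℤ) (γ : ℝ) : ℝ≥0∞ :=
  ∫⁻ t in Ioi (0 : ℝ), ENNReal.ofReal (t ^ γ * |besselJ n t| ^ d)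

theorem besselMoment_natAbs (d : ℕ) (n : ℤ) (γ : ℝ) :
    besselMoment d n.natAbs γ = besselMoment d n γ := by
  simp only [besselMoment, abs_besselJ_natAbs]

theorem setLIntegral_ofReal_mono {s : Set ℝ} (hs : MeasurableSet s) {f g : ℝ → ℝ}
    (h : ∀ x ∈ s, f x ≤ g x) :
    ∫⁻ x in s, ENNReal.ofReal (f x) ≤ ∫⁻ x in s, ENNReal.ofReal (g x) :=
  setLIntegral_mono' hs fun x hx => ENNReal.ofReal_le_ofReal (h x hx)

theorem setLIntegral_ofReal_const_mul (s : Set ℝ) {c : ℝ} (hc : 0 ≤ c) (f : ℝ → ℝ) :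
    ∫⁻ x in s, ENNReal.ofReal (c * f x) = ENNReal.ofReal c * ∫⁻ x in s, ENNReal.ofReal (f x) := by
  simp only [ENNReal.ofReal_mul hc]
  exact lintegral_const_mul' _ _ ENNReal.ofReal_ne_top

/-- The constant `3/4` is relaxed to `1` here; only `d = 4` keeps its square `9/16`. -/
theorem pow_abs_besselJ_le (n : ℕ) (d : ℕ) {t : ℝ} (ht : (n : ℝ) < t) :
    |besselJ n t| ^ d ≤ (t ^ 2 - n ^ 2) ^ (-(d : ℝ) / 4) := by
  have hn : (0 : ℝ) ≤ n := n.cast_nonneg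
  have hφ : 0 < t ^ 2 - (n : ℝ) ^ 2 := by nlinarith
  have h := sqrt_mul_sq_besselJ_le n ht
  have h1 : |besselJ n t| ≤ (t ^ 2 - (n : ℝ) ^ 2) ^ (-(1 : ℝ) / 4) := by
    refine le_of_sq_le_sq ?_ (by positivity)
    rw [sq_abs, ← Real.rpow_natCast (_ ^ _), ← Real.rpow_mul hφ.le]
    have h2 : -(1 : ℝ) / 4 * (2 : ℕ) = -(1 / 2) := by norm_num
    rw [h2, Real.rpow_neg hφ.le, ← Real.sqrt_eq_rpow, ← one_div,
      le_div_iff₀ (Real.sqrt_pos.mpr hφ)]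
    linarith
  calc |besselJ n t| ^ d ≤ ((t ^ 2 - (n : ℝ) ^ 2) ^ (-(1 : ℝ) / 4)) ^ d :=
        pow_le_pow_left₀ (abs_nonneg _) h1 d
    _ = _ := by
        rw [← Real.rpow_natCast, ← Real.rpow_mul hφ.le]
        congr 1
        ring

theorem pow_four_abs_besselJ_le (n : ℕ) {t : ℝ} (ht : (n : ℝ) < t) :
    |besselJ n t| ^ 4 ≤ 9 / 16 / (t ^ 2 - n ^ 2) := by
  have hn : (0 : ℝ) ≤ n := n.cast_nonneg
  have hφ : 0 < t ^ 2 - (n : ℝ) ^ 2 := by nlinarith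
  have h := pow_le_pow_left₀ (by positivity) (sqrt_mul_sq_besselJ_le n ht) 2
  rw [mul_pow, Real.sq_sqrt hφ.le] at h
  rw [le_div_iff₀ hφ]
  have h2 : |besselJ n t| ^ 4 = (besselJ n t ^ 2) ^ 2 := by
    rw [← sq_abs (besselJ n t)]; ring
  rw [h2]
  linarith

theorem lintegral_Ioc_zero_one_le (d : ℕ) {γ : ℝ} (hγ : 0 ≤ γ) :
    ∫⁻ t in Ioc (0 : ℝ) 1, ENNReal.ofReal (t ^ γ * |besselJ 0 t| ^ d) ≤ ENNReal.ofReal 1 := by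
  refine (setLIntegral_ofReal_mono measurableSet_Ioc (g := fun _ => 1) fun t ht => ?_).trans ?_
  · exact mul_le_one₀ (Real.rpow_le_one ht.1.le ht.2 hγ) (by positivity)
      (pow_le_one₀ (abs_nonneg _) (abs_besselJ_le_one _ _))
  · simp

theorem besselMoment_zero_le (d : ℕ) {γ c : ℝ} (hγ : 0 ≤ γ) (hd : γ < (d : ℝ) / 2 - 1)
    (hc : 0 ≤ c) (hJ : ∀ t : ℝ, 0 < t → |besselJ 0 t| ^ d ≤ c * t ^ (-(d : ℝ) / 2)) :
    besselMoment d 0 γ ≤ ENNReal.ofReal (1 + c * (1 / ((d : ℝ) / 2 - 1 - γ))) := by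
  have hpos : 0 < (d : ℝ) / 2 - 1 - γ := by linarith
  rw [besselMoment, ← Ioc_union_Ioi_eq_Ioi (zero_le_one (α := ℝ)),
    lintegral_union measurableSet_Ioi (Ioc_disjoint_Ioi le_rfl),
    ENNReal.ofReal_add zero_le_one (by positivity)]
  refine add_le_add (lintegral_Ioc_zero_one_le d hγ) ?_
  refine (setLIntegral_ofReal_mono measurableSet_Ioi
    (g := fun t => c * t ^ (γ - (d : ℝ) / 2)) fun t ht => ?_).trans ?_
  · have ht0 : (0 : ℝ) < t := zero_lt_one.trans ht
    rw [sub_eq_add_neg, Real.rpow_add ht0, ← neg_div, mul_left_comm]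
    exact mul_le_mul_of_nonneg_left (hJ t ht0) (by positivity)
  · rw [setLIntegral_ofReal_const_mul _ hc, lintegral_Ioi_rpow one_pos (by linarith),
      ← ENNReal.ofReal_mul hc, Real.one_rpow]
    refine ENNReal.ofReal_le_ofReal (le_of_eq ?_)
    congr 2
    ring

/-- The contribution of `t ≤ n + n^{1/3} / 2`; here `a = n^{1/3}`. -/
theorem lintegral_besselJ_transition_le (d n : ℕ) (hd : d ≠ 0) {a γ κ : ℝ} (ha : 1 ≤ a)
    (han : a ^ 3 = n) (hγ : 0 ≤ γ) (hγ1 : γ ≤ 1)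
    (hκ : ∀ x : ℝ, 0 ≤ x → x ^ 2 ≤ 9 / 11 → x ^ d ≤ κ) :
    ∫⁻ t in Ioc (0 : ℝ) (n + a / 2), ENNReal.ofReal (t ^ γ * |besselJ n t| ^ d) ≤
      ENNReal.ofReal (κ * (1 / d + 1 + γ / 2) * (n : ℝ) ^ γ * a ^ (1 - (d : ℝ))) := by
  have ha0 : 0 < a := by linarith
  have hn0 : (0 : ℝ) < n := by rw [← han]; positivity
  have hn : n ≠ 0 := by exact_mod_cast hn0.ne'
  have hd0 : (0 : ℝ) < d := by exact_mod_cast Nat.pos_of_ne_zero hd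
  have hκ0 : 0 ≤ κ := by
    have := hκ 0 le_rfl (by norm_num)
    rwa [zero_pow hd] at this
  -- With `τ = a/2` and `a³ = n` the loss factor is `1 - 1/24 = 23/24`. At `n + a/2` one has `√(t² -
  -- n²) ≥ a²`, so `a² J_n² ≤ (24/23)² · 3/4 < 9/11` on the whole interval.
  have hM : ∀ t ∈ Icc (0 : ℝ) (n + a / 2), |besselJ n t| ^ d ≤ κ * a ^ (-(d : ℝ)) := by
    intro t ht
    have h1 := abs_besselJ_le_of_le_add n hn (τ := a / 2) (by positivity) ht.1 ht.2
    have h2 : 1 - (a / 2) ^ 3 / (3 * n) = 23 / 24 := by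
      rw [← han]; field_simp; norm_num
    rw [h2] at h1
    have h3 := sqrt_mul_sq_besselJ_le n (t := n + a / 2) (by linarith)
    have h4 : a ^ 2 ≤ Real.sqrt ((n + a / 2) ^ 2 - n ^ 2) := by
      refine Real.le_sqrt_of_sq_le ?_
      rw [← han]
      nlinarith [sq_nonneg a]
    have h5 : a ^ 2 * besselJ n (n + a / 2) ^ 2 ≤ 3 / 4 :=
      (mul_le_mul_of_nonneg_right h4 (sq_nonneg _)).trans h3
    have h6 := pow_le_pow_left₀ (by positivity) h1 2
    rw [mul_pow, sq_abs, sq_abs] at h6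
    have h7 : (a * |besselJ n t|) ^ 2 ≤ 9 / 11 := by
      rw [mul_pow, sq_abs]
      have := mul_le_mul_of_nonneg_left h6 (sq_nonneg a)
      linarith
    have h8 := hκ _ (by positivity) h7
    rw [mul_pow] at h8
    rw [Real.rpow_neg ha0.le, Real.rpow_natCast, ← div_eq_mul_inv, le_div_iff₀ (by positivity)]
    linarith
  -- Below `T` the exponential decay at rate `1/a` contributes `a/d`; the transition interval `(T, n
  -- + a/2]` has length `a`.
  set T := (n : ℝ) - a / 2 with hT
  have hT0 : 0 ≤ T := by rw [hT, ← han]; nlinarith [sq_nonneg a]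
  have hTT : T ≤ n + a / 2 := by rw [hT]; linarith
  set K := (n : ℝ) ^ γ * (κ * a ^ (-(d : ℝ))) with hK
  have hK0 : 0 ≤ K := by positivity
  have hsplit : κ * (1 / d + 1 + γ / 2) * (n : ℝ) ^ γ * a ^ (1 - (d : ℝ)) =
      K * (a / d) + K * (1 + γ / 2) * a := by
    rw [sub_eq_add_neg, Real.rpow_add ha0, Real.rpow_one, hK]
    ring
  rw [hsplit, ENNReal.ofReal_add (by positivity) (by positivity),
    ← Ioc_union_Ioc_eq_Ioc hT0 hTT, lintegral_union measurableSet_Ioc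
      (Ioc_disjoint_Ioc_of_le le_rfl)]
  refine add_le_add ?_ ?_
  · refine (setLIntegral_ofReal_mono measurableSet_Ioc
      (g := fun t => K * Real.exp (d * (t - T) / a)) fun t ht => ?_).trans ?_
    · have h1 := abs_besselJ_le_exp n hn (T := T) ha0 ?_ ht.1.le ht.2
      · have h2 := pow_le_pow_left₀ (abs_nonneg _) h1 d
        rw [mul_pow, ← Real.exp_nat_mul] at h2
        rw [hK, mul_assoc]
        refine mul_le_mul (Real.rpow_le_rpow ht.1.le (by linarith [ht.2]) hγ) ?_
          (by positivity) (by positivity)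
        refine h2.trans (mul_le_mul (hM T ⟨hT0, hTT⟩) (le_of_eq ?_) (Real.exp_pos _).le
          (by positivity))
        congr 1
        ring
      -- With `n = a³`, `T²(1 + a²) = a⁸ - (3/4) a⁴ + a²/4`, which is at most `n² a² = a⁸` since `a
      -- ≥ 1`.
      · rw [hT, ← han]
        have : 0 ≤ a ^ 2 * (a ^ 2 - 1) := mul_nonneg (sq_nonneg a) (by nlinarith)
        nlinarith [sq_nonneg a]
    · rw [setLIntegral_ofReal_const_mul _ hK0, ENNReal.ofReal_mul hK0,
        lintegral_Ioc_of_hasDerivAt (F := fun t => a / d * Real.exp (d * (t - T) / a)) hT0]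
      · gcongr
        rw [sub_self, mul_zero, zero_div, Real.exp_zero, mul_one]
        exact sub_le_self _ (by positivity)
      · exact Continuous.continuousOn (by fun_prop)
      · intro x _
        refine ((((((hasDerivAt_id x).sub_const T).const_mul (d : ℝ)).div_const a).exp).const_mul
          (a / d)).congr_deriv ?_
        simp only [id]
        field_simp
      · intro x _
        positivity
  · refine (setLIntegral_ofReal_mono measurableSet_Ioc
      (g := fun t => K * (1 + γ / 2)) fun t ht => ?_).trans ?_
    · have ht0 : 0 < t := hT0.trans_lt ht.1
      -- On this interval `t ≤ 3n/2`, and `(3/2)^γ ≤ 1 + γ/2` by Bernoulli's inequality.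
      have h1 : t ^ γ ≤ (n : ℝ) ^ γ * (1 + γ / 2) := by
        have h2 : t ≤ n * (1 + 1 / 2) := by
          refine ht.2.trans ?_
          rw [← han]
          nlinarith [sq_nonneg a]
        refine (Real.rpow_le_rpow ht0.le h2 hγ).trans ?_
        rw [Real.mul_rpow hn0.le (by norm_num)]
        refine mul_le_mul_of_nonneg_left ?_ (by positivity)
        have := rpow_one_add_le_one_add_mul_self (s := 1 / 2) (by norm_num) hγ hγ1
        linarith
      calc t ^ γ * |besselJ n t| ^ d ≤ ((n : ℝ) ^ γ * (1 + γ / 2)) * (κ * a ^ (-(d : ℝ))) :=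
            mul_le_mul h1 (hM t ⟨ht0.le, ht.2⟩) (by positivity) (by positivity)
        _ = _ := by rw [hK]; ring
    · rw [setLIntegral_const, Real.volume_Ioc, ← ENNReal.ofReal_mul (by positivity)]
      refine ENNReal.ofReal_le_ofReal (le_of_eq ?_)
      rw [hT]
      ring

theorem besselMoment_split (d n : ℕ) {a γ : ℝ} (ha : 0 ≤ a) :
    besselMoment d n γ =
      (∫⁻ t in Ioc (0 : ℝ) (n + a / 2), ENNReal.ofReal (t ^ γ * |besselJ n t| ^ d)) +
      ∫⁻ t in Ioi ((n : ℝ) + a / 2), ENNReal.ofReal (t ^ γ * |besselJ n t| ^ d) := by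
  rw [besselMoment, ← Ioc_union_Ioi_eq_Ioi (show (0 : ℝ) ≤ n + a / 2 by positivity),
    lintegral_union measurableSet_Ioi (Ioc_disjoint_Ioi le_rfl)]

theorem lintegral_Ioi_two_mul_le (d n : ℕ) (hn : n ≠ 0) {γ c : ℝ} (hd : γ < (d : ℝ) / 2 - 1)
    (hc : 0 ≤ c)
    (hJ : ∀ t : ℝ, 2 * n < t → |besselJ n t| ^ d ≤ c * t ^ (-(d : ℝ) / 2)) :
    ∫⁻ t in Ioi (2 * (n : ℝ)), ENNReal.ofReal (t ^ γ * |besselJ n t| ^ d) ≤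
      ENNReal.ofReal (c * ((2 * n) ^ (γ - (d : ℝ) / 2 + 1) / ((d : ℝ) / 2 - 1 - γ))) := by
  have hn0 : (0 : ℝ) < n := by exact_mod_cast Nat.pos_of_ne_zero hn
  refine (setLIntegral_ofReal_mono measurableSet_Ioi
    (g := fun t => c * t ^ (γ - (d : ℝ) / 2)) fun t ht => ?_).trans ?_
  · have ht' : 2 * (n : ℝ) < t := ht
    have ht0 : (0 : ℝ) < t := by linarith
    rw [sub_eq_add_neg, Real.rpow_add ht0, ← neg_div, mul_left_comm]
    exact mul_le_mul_of_nonneg_left (hJ t ht) (by positivity)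
  · rw [setLIntegral_ofReal_const_mul _ hc, lintegral_Ioi_rpow (by linarith) (by linarith),
      ← ENNReal.ofReal_mul hc]
    refine ENNReal.ofReal_le_ofReal (le_of_eq ?_)
    congr 2
    ring

theorem three_quarters_mul_sq_le {n : ℕ} {t : ℝ} (ht : 2 * (n : ℝ) < t) :
    3 / 4 * t ^ 2 ≤ t ^ 2 - n ^ 2 := by
  have hn : (0 : ℝ) ≤ n := n.cast_nonneg
  nlinarith

/-- For `d = 3` the singularity `(t - n)^{-3/4}` at the turning point is integrable. The scales `t ~
n` and `t > 2n` give the order `n^{γ-1/2}`, while the region up to `n + n^{1/3}/2` contributes only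
`n^{γ-2/3}`. -/
theorem besselMoment_three_le (n : ℕ) {γ : ℝ} (hγ : 0 ≤ γ) (hγ1 : γ < 1 / 2) :
    besselMoment 3 n γ ≤
      ENNReal.ofReal ((4 / (1 - 2 * γ) + 4) * (max 1 (n : ℝ)) ^ (γ - 1 / 2)) := by
  have hL : 0 < 1 - 2 * γ := by linarith
  have hL1 : 1 ≤ 1 / (1 - 2 * γ) := by rw [le_div_iff₀ hL]; linarith
  rcases Nat.eq_zero_or_pos n with rfl | hn
  · rw [Nat.cast_zero, Nat.cast_zero, max_eq_left zero_le_one, Real.one_rpow, mul_one]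
    refine (besselMoment_zero_le 3 (c := 1) hγ (by norm_num; linarith) zero_le_one ?_).trans ?_
    · intro t ht
      have h := pow_abs_besselJ_le 0 3 (by simpa using ht)
      rw [one_mul]
      refine h.trans (le_of_eq ?_)
      rw [Nat.cast_zero, zero_pow two_ne_zero, sub_zero, ← Real.rpow_natCast, ← Real.rpow_mul ht.le]
      norm_num
    · refine ENNReal.ofReal_le_ofReal ?_
      have h1 : 1 * (1 / (((3 : ℕ) : ℝ) / 2 - 1 - γ)) = 2 * (1 / (1 - 2 * γ)) := by
        push_cast
        have : (3 : ℝ) / 2 - 1 - γ = (1 - 2 * γ) / 2 := by ring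
        rw [this]
        field_simp
      have h2 : 4 / (1 - 2 * γ) = 4 * (1 / (1 - 2 * γ)) := by ring
      rw [h1, h2]
      linarith
  have hn1 : (1 : ℝ) ≤ n := by exact_mod_cast hn
  have hn0 : (0 : ℝ) < n := by linarith
  rw [max_eq_right hn1]
  set a : ℝ := (n : ℝ) ^ ((1 : ℝ) / 3) with ha
  have ha1 : 1 ≤ a := Real.one_le_rpow hn1 (by norm_num)
  have han : a ^ 3 = n := by
    rw [ha, ← Real.rpow_natCast, ← Real.rpow_mul hn0.le]
    norm_num
  set B := (n : ℝ) ^ (γ - 1 / 2) with hB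
  have hB0 : 0 < B := by positivity
  have hγ2 : (2 : ℝ) ^ γ ≤ 1 + γ := by
    have := rpow_one_add_le_one_add_mul_self (s := 1) (by norm_num) hγ (by linarith)
    norm_num at this
    linarith
  have hnear := lintegral_besselJ_transition_le 3 n (by norm_num) (κ := 3 / 4) ha1 han hγ
    (by linarith) (by
      intro x hx hx2
      refine le_of_sq_le_sq ?_ (by norm_num)
      have := pow_le_pow_left₀ (sq_nonneg x) hx2 3
      norm_num at this ⊢
      nlinarith)
  have hnear' : 3 / 4 * (1 / ((3 : ℕ) : ℝ) + 1 + γ / 2) * (n : ℝ) ^ γ * a ^ (1 - ((3 : ℕ) : ℝ)) ≤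
      19 / 16 * B := by
    have h1 : (n : ℝ) ^ γ * a ^ (1 - ((3 : ℕ) : ℝ)) ≤ B := by
      rw [ha, ← Real.rpow_mul hn0.le, ← Real.rpow_add hn0]
      refine Real.rpow_le_rpow_of_exponent_le hn1 ?_
      norm_num
      linarith
    rw [mul_assoc]
    refine mul_le_mul ?_ h1 (by positivity) (by norm_num)
    norm_num
    linarith
  have hmid : ∫⁻ t in Ioc (n : ℝ) (2 * n), ENNReal.ofReal (t ^ γ * |besselJ n t| ^ 3) ≤
      ENNReal.ofReal (18 / 5 * B) := by
    set K : ℝ := (2 * n) ^ γ * (2 * n) ^ (-(3 : ℝ) / 4)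
    have hK0 : 0 ≤ K := by positivity
    refine (setLIntegral_ofReal_mono measurableSet_Ioc
      (g := fun t => K * (t - n) ^ (-(3 : ℝ) / 4)) fun t ht => ?_).trans ?_
    · have htn : 0 < t - n := sub_pos.mpr ht.1
      have ht0 : 0 < t := by linarith
      have h1 := pow_abs_besselJ_le n 3 ht.1
      push_cast at h1
      rw [mul_assoc]
      refine mul_le_mul (Real.rpow_le_rpow ht0.le ht.2 hγ) (h1.trans ?_) (by positivity)
        (by positivity)
      rw [← Real.mul_rpow (by positivity) htn.le]
      refine Real.rpow_le_rpow_of_nonpos (by positivity) ?_ (by norm_num)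
      nlinarith
    · rw [setLIntegral_ofReal_const_mul _ hK0,
        lintegral_Ioc_of_hasDerivAt (F := fun t => 4 * (t - n) ^ ((1 : ℝ) / 4)) (by linarith),
        ← ENNReal.ofReal_mul hK0]
      · refine ENNReal.ofReal_le_ofReal ?_
        rw [sub_self, Real.zero_rpow (by norm_num), two_mul, add_sub_cancel_right, mul_zero,
          sub_zero]
        have h1 : K * (4 * (n : ℝ) ^ ((1 : ℝ) / 4)) =
            4 * (2 : ℝ) ^ γ * (2 : ℝ) ^ (-(3 : ℝ) / 4) * B := by
          have h2 : B = (n : ℝ) ^ γ * ((n : ℝ) ^ (-(3 : ℝ) / 4) * (n : ℝ) ^ ((1 : ℝ) / 4)) := by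
            rw [hB, ← Real.rpow_add hn0, ← Real.rpow_add hn0]
            norm_num
            rfl
          rw [h2]
          simp only [K, Real.mul_rpow (zero_le_two (α := ℝ)) hn0.le]
          ring
        rw [h1]
        refine mul_le_mul_of_nonneg_right ?_ hB0.le
        have h3 : (2 : ℝ) ^ (-(3 : ℝ) / 4) ≤ 3 / 5 := by
          refine le_of_pow_le_pow_left₀ (n := 4) (by norm_num) (by norm_num) ?_
          rw [← Real.rpow_natCast, ← Real.rpow_mul (by norm_num)]
          norm_num
        have h4 : (2 : ℝ) ^ γ ≤ 3 / 2 := by linarith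
        have h5 := mul_le_mul h4 h3 (by positivity) (by norm_num)
        linarith
      · exact Continuous.continuousOn (by
          have : Continuous fun t : ℝ => (t - n) ^ ((1 : ℝ) / 4) :=
            (continuous_id.sub continuous_const).rpow_const fun _ => Or.inr (by norm_num)
          fun_prop)
      · intro x hx
        refine ((((hasDerivAt_id x).sub_const (n : ℝ)).rpow_const (p := 1 / 4)
          (Or.inl (sub_pos.mpr hx.1).ne')).const_mul 4).congr_deriv ?_
        simp only [id]
        norm_num
        ring
      · intro x hx
        exact Real.rpow_nonneg (sub_pos.mpr hx.1).le _
  have hfar := lintegral_Ioi_two_mul_le 3 n hn.ne' (γ := γ) (c := 4 / 3) (by norm_num; linarith)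
    (by norm_num) (by
      intro t ht
      have ht0 : 0 < t := by linarith
      have h1 := pow_abs_besselJ_le n 3 (t := t) (by linarith)
      refine h1.trans ?_
      have h2 := Real.rpow_le_rpow_of_nonpos (z := -((3 : ℕ) : ℝ) / 4) (by positivity)
        (three_quarters_mul_sq_le ht) (by norm_num)
      refine h2.trans ?_
      rw [Real.mul_rpow (by norm_num) (by positivity), ← Real.rpow_natCast t,
          ← Real.rpow_mul ht0.le]
      refine mul_le_mul ?_ (le_of_eq (by congr 1; push_cast; ring)) (by positivity) (by norm_num)
      refine le_of_pow_le_pow_left₀ (n := 4) (by norm_num) (by norm_num) ?_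
      rw [← Real.rpow_natCast, ← Real.rpow_mul (by norm_num)]
      have : -((3 : ℕ) : ℝ) / 4 * ((4 : ℕ) : ℝ) = ((-3 : ℤ) : ℝ) := by norm_num
      rw [this, Real.rpow_intCast]
      norm_num)
  have hfar' : 4 / 3 * ((2 * n : ℝ) ^ (γ - ((3 : ℕ) : ℝ) / 2 + 1) /
      (((3 : ℕ) : ℝ) / 2 - 1 - γ)) ≤ 8 / 3 * (1 / (1 - 2 * γ)) * B := by
    have h1 : (2 * n : ℝ) ^ (γ - ((3 : ℕ) : ℝ) / 2 + 1) ≤ B := by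
      have : γ - ((3 : ℕ) : ℝ) / 2 + 1 = γ - 1 / 2 := by push_cast; ring
      rw [this]
      exact Real.rpow_le_rpow_of_nonpos hn0 (by linarith) (by linarith)
    have h2 : ((3 : ℕ) : ℝ) / 2 - 1 - γ = (1 - 2 * γ) / 2 := by push_cast; ring
    rw [h2]
    have h3 : 8 / 3 * (1 / (1 - 2 * γ)) * B = 4 / 3 * (B / ((1 - 2 * γ) / 2)) := by
      field_simp
      norm_num
    rw [h3]
    gcongr
  -- The interval `(n, n + a/2]` is counted twice; the constants leave room for this.
  have hcover : ∫⁻ t in Ioi ((n : ℝ) + a / 2), ENNReal.ofReal (t ^ γ * |besselJ n t| ^ 3) ≤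
      (∫⁻ t in Ioc (n : ℝ) (2 * n), ENNReal.ofReal (t ^ γ * |besselJ n t| ^ 3)) +
      ∫⁻ t in Ioi (2 * (n : ℝ)), ENNReal.ofReal (t ^ γ * |besselJ n t| ^ 3) := by
    refine (lintegral_mono_set (t := Ioc (n : ℝ) (2 * n) ∪ Ioi (2 * (n : ℝ))) ?_).trans
      (lintegral_union_le _ _ _)
    rw [Ioc_union_Ioi_eq_Ioi (by linarith)]
    exact Ioi_subset_Ioi (by linarith)
  rw [besselMoment_split 3 n (a := a) (by linarith)]
  calc _ ≤ ENNReal.ofReal (19 / 16 * B) + (ENNReal.ofReal (18 / 5 * B) +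
        ENNReal.ofReal (8 / 3 * (1 / (1 - 2 * γ)) * B)) :=
        add_le_add (hnear.trans (ENNReal.ofReal_le_ofReal hnear'))
          (hcover.trans (add_le_add hmid (hfar.trans (ENNReal.ofReal_le_ofReal hfar'))))
    _ ≤ _ := by
        rw [← ENNReal.ofReal_add (by positivity) (by positivity),
          ← ENNReal.ofReal_add (by positivity) (by positivity)]
        refine ENNReal.ofReal_le_ofReal ?_
        rw [← add_mul, ← add_mul]
        refine mul_le_mul_of_nonneg_right ?_ hB0.le
        have h2 : 4 / (1 - 2 * γ) = 4 * (1 / (1 - 2 * γ)) := by ring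
        rw [h2]
        linarith

/-- For `d = 4` the singularity is `1/(t - n)`, exactly critical. Cut off at distance `n^{1/3}/2`,
it produces the factor `(2/3) log n + log 2`, the origin of the logarithm. -/
theorem besselMoment_four_le (n : ℕ) {γ : ℝ} (hγ : 0 ≤ γ) (hγ1 : γ < 1) :
    besselMoment 4 n γ ≤ ENNReal.ofReal (2 / (1 - γ) *
      ((max 1 (n : ℝ)) ^ (γ - 1) * (1 + Real.log (max 1 (n : ℝ)) / 4))) := by
  have hL : 0 < 1 - γ := by linarith
  have hL1 : 1 + γ ≤ 1 / (1 - γ) := by rw [le_div_iff₀ hL]; nlinarith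
  have hLe : 2 / (1 - γ) = 2 * (1 / (1 - γ)) := by ring
  have hden : ((4 : ℕ) : ℝ) / 2 - 1 - γ = 1 - γ := by push_cast; ring
  rcases Nat.eq_zero_or_pos n with rfl | hn
  · rw [Nat.cast_zero, Nat.cast_zero, max_eq_left zero_le_one, Real.one_rpow, Real.log_one,
      zero_div, add_zero, mul_one, mul_one]
    refine (besselMoment_zero_le 4 (c := 9 / 16) hγ (by norm_num; linarith) (by norm_num) ?_).trans
      ?_
    · intro t ht
      have h := pow_four_abs_besselJ_le 0 (by simpa using ht)
      refine h.trans (le_of_eq ?_)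
      rw [Nat.cast_zero, zero_pow two_ne_zero, sub_zero, div_eq_mul_inv, ← Real.rpow_natCast,
        ← Real.rpow_neg ht.le]
      norm_num
    · refine ENNReal.ofReal_le_ofReal ?_
      rw [hden, hLe]
      linarith
  have hn1 : (1 : ℝ) ≤ n := by exact_mod_cast hn
  have hn0 : (0 : ℝ) < n := by linarith
  rw [max_eq_right hn1]
  set a : ℝ := (n : ℝ) ^ ((1 : ℝ) / 3) with ha
  have ha1 : 1 ≤ a := Real.one_le_rpow hn1 (by norm_num)
  have han : a ^ 3 = n := by
    rw [ha, ← Real.rpow_natCast, ← Real.rpow_mul hn0.le]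
    norm_num
  set B := (n : ℝ) ^ (γ - 1) with hB
  have hB0 : 0 < B := by positivity
  set lg := Real.log n with hlg
  have hlg0 : 0 ≤ lg := Real.log_nonneg hn1
  have hγ2 : (2 : ℝ) ^ γ ≤ 1 + γ := by
    have := rpow_one_add_le_one_add_mul_self (s := 1) (by norm_num) hγ hγ1.le
    norm_num at this
    linarith
  have h2n : (2 * n : ℝ) ^ (γ - 1) ≤ (1 + γ) / 2 * B := by
    rw [Real.mul_rpow (by norm_num) hn0.le, Real.rpow_sub_one (by norm_num)]
    gcongr
  have hnear := lintegral_besselJ_transition_le 4 n (by norm_num) (κ := 81 / 121) ha1 han hγ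
    hγ1.le (by
      intro x hx hx2
      have := pow_le_pow_left₀ (sq_nonneg x) hx2 2
      norm_num at this ⊢
      nlinarith)
  have hnear' : 81 / 121 * (1 / ((4 : ℕ) : ℝ) + 1 + γ / 2) * (n : ℝ) ^ γ *
      a ^ (1 - ((4 : ℕ) : ℝ)) = 81 / 121 * (5 / 4 + γ / 2) * B := by
    have h1 : (n : ℝ) ^ γ * a ^ (1 - ((4 : ℕ) : ℝ)) = B := by
      rw [ha, ← Real.rpow_mul hn0.le, ← Real.rpow_add hn0, hB]
      congr 1
      norm_num
      ring
    rw [mul_assoc, h1]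
    norm_num
  have hmid : ∫⁻ t in Ioc ((n : ℝ) + a / 2) (2 * n), ENNReal.ofReal (t ^ γ * |besselJ n t| ^ 4) ≤
      ENNReal.ofReal (9 / 16 * ((1 + γ) / 2) * (7 / 10 + 2 / 3 * lg) * B) := by
    set K : ℝ := 9 / 16 * (2 * n) ^ (γ - 1)
    have hK0 : 0 ≤ K := by positivity
    have hlog : Real.log (2 * n - n) - Real.log (n + a / 2 - n) ≤ 7 / 10 + 2 / 3 * lg := by
      have h1 : (2 : ℝ) * n - n = n := by ring
      rw [h1, add_sub_cancel_left, Real.log_div (by positivity) two_ne_zero, ha, Real.log_rpow hn0]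
      linarith [Real.log_two_lt_d9]
    refine (setLIntegral_ofReal_mono measurableSet_Ioc
      (g := fun t => K * (1 / (t - n))) fun t ht => ?_).trans ?_
    · have htn : 0 < t - n := by linarith [ht.1]
      have ht0 : 0 < t := by linarith
      have h1 := pow_four_abs_besselJ_le n (t := t) (by linarith)
      calc t ^ γ * |besselJ n t| ^ 4 ≤ (2 * n) ^ γ * (9 / 16 / (2 * n * (t - n))) := by
            refine mul_le_mul (Real.rpow_le_rpow ht0.le ht.2 hγ) (h1.trans ?_) (by positivity)
              (by positivity)
            refine div_le_div_of_nonneg_left (by norm_num) (by positivity) ?_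
            nlinarith
        _ = _ := by
            simp only [K]
            rw [Real.rpow_sub_one (by positivity)]
            field_simp
    · rcases le_or_gt (2 * (n : ℝ)) (n + a / 2) with hle | hlt
      · rw [Ioc_eq_empty (not_lt.mpr hle)]
        simp
      · rw [setLIntegral_ofReal_const_mul _ hK0,
          lintegral_Ioc_of_hasDerivAt (F := fun t => Real.log (t - n)) hlt.le,
          ← ENNReal.ofReal_mul hK0]
        · refine ENNReal.ofReal_le_ofReal ?_
          refine (mul_le_mul_of_nonneg_left hlog hK0).trans ?_
          have := mul_le_mul_of_nonneg_right h2n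
            (show 0 ≤ 9 / 16 * (7 / 10 + 2 / 3 * lg) by positivity)
          simp only [K]
          linarith
        · refine ContinuousOn.log (by fun_prop) fun x hx => ?_
          have := hx.1
          exact (by linarith : 0 < x - n).ne'
        · intro x hx
          exact ((hasDerivAt_id x).sub_const (n : ℝ)).log
            (by simp only [id]; linarith [hx.1] : 0 < id x - (n : ℝ)).ne'
        · intro x hx
          have := hx.1
          exact one_div_nonneg.mpr (by linarith)
  have hfar := lintegral_Ioi_two_mul_le 4 n hn.ne' (γ := γ) (c := 3 / 4) (by norm_num; linarith)
    (by norm_num) (by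
      intro t ht
      have ht0 : 0 < t := by linarith
      have h1 := pow_four_abs_besselJ_le n (t := t) (by linarith)
      refine h1.trans ?_
      have h2 := div_le_div_of_nonneg_left (show (0 : ℝ) ≤ 9 / 16 by norm_num) (by positivity)
        (three_quarters_mul_sq_le ht)
      refine h2.trans (le_of_eq ?_)
      have : -((4 : ℕ) : ℝ) / 2 = -((2 : ℕ) : ℝ) := by norm_num
      rw [this, Real.rpow_neg ht0.le, Real.rpow_natCast]
      field_simp
      norm_num)
  have hfar' : 3 / 4 * ((2 * n : ℝ) ^ (γ - ((4 : ℕ) : ℝ) / 2 + 1) /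
      (((4 : ℕ) : ℝ) / 2 - 1 - γ)) ≤ 3 / 4 * (1 / (1 - γ)) * B := by
    have h1 : (2 * n : ℝ) ^ (γ - ((4 : ℕ) : ℝ) / 2 + 1) ≤ B := by
      have : γ - ((4 : ℕ) : ℝ) / 2 + 1 = γ - 1 := by push_cast; ring
      rw [this]
      exact Real.rpow_le_rpow_of_nonpos hn0 (by linarith) (by linarith)
    rw [hden]
    have h3 : 3 / 4 * (1 / (1 - γ)) * B = 3 / 4 * (B / (1 - γ)) := by ring
    rw [h3]
    gcongr
  have hcover : ∫⁻ t in Ioi ((n : ℝ) + a / 2), ENNReal.ofReal (t ^ γ * |besselJ n t| ^ 4) ≤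
      (∫⁻ t in Ioc ((n : ℝ) + a / 2) (2 * n), ENNReal.ofReal (t ^ γ * |besselJ n t| ^ 4)) +
      ∫⁻ t in Ioi (2 * (n : ℝ)), ENNReal.ofReal (t ^ γ * |besselJ n t| ^ 4) := by
    refine (lintegral_mono_set ?_).trans (lintegral_union_le _ _ _)
    exact Ioi_subset_Ioc_union_Ioi
  rw [besselMoment_split 4 n (a := a) (by linarith)]
  rw [hnear'] at hnear
  calc _ ≤ ENNReal.ofReal (81 / 121 * (5 / 4 + γ / 2) * B) +
        (ENNReal.ofReal (9 / 16 * ((1 + γ) / 2) * (7 / 10 + 2 / 3 * lg) * B) +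
        ENNReal.ofReal (3 / 4 * (1 / (1 - γ)) * B)) :=
        add_le_add hnear (hcover.trans
          (add_le_add hmid (hfar.trans (ENNReal.ofReal_le_ofReal hfar'))))
    _ ≤ _ := by
        have hLp : 0 < 1 / (1 - γ) := by positivity
        rw [← ENNReal.ofReal_add (by positivity) (by positivity),
          ← ENNReal.ofReal_add (by positivity) (by positivity)]
        refine ENNReal.ofReal_le_ofReal ?_
        rw [← add_mul, ← add_mul, mul_comm B, ← mul_assoc]
        refine mul_le_mul_of_nonneg_right ?_ hB0.le
        rw [hLe]
        have := mul_le_mul_of_nonneg_right hL1 hlg0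
        nlinarith

/-- For `d ≥ 5` the singularity `(t - n)^{-d/4}` is not integrable and the turning point dominates:
width `n^{1/3}` times height `n^{γ-d/3}`. -/
theorem besselMoment_le_of_five_le (d n : ℕ) (hd : 5 ≤ d) {γ : ℝ} (hγ : 0 ≤ γ) (hγ1 : γ ≤ 1) :
    besselMoment d n γ ≤ ENNReal.ofReal (7 * (2 : ℝ) ^ ((d : ℝ) / 4) / (d - 4) *
      (max 1 (n : ℝ)) ^ (γ - ((d : ℝ) - 1) / 3)) := by
  have hd5 : (5 : ℝ) ≤ d := by exact_mod_cast hd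
  have hd4 : (0 : ℝ) < d - 4 := by linarith
  -- `57/50` bounds the part up to `n + n^{1/3}/2` and `2/(d-4)` the rest. The comparison uses
  -- `2^{d/4} ≥ 1 + d/4`.
  have hC : 57 / 50 + 2 / ((d : ℝ) - 4) ≤ 7 * (2 : ℝ) ^ ((d : ℝ) / 4) / (d - 4) := by
    rw [le_div_iff₀ hd4, add_mul, div_mul_cancel₀ _ hd4.ne']
    have h1 := one_add_mul_self_le_rpow_one_add (s := 1) (by norm_num)
      (p := (d : ℝ) / 4) (by linarith)
    norm_num at h1
    linarith
  rcases Nat.eq_zero_or_pos n with rfl | hn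
  · rw [Nat.cast_zero, Nat.cast_zero, max_eq_left zero_le_one, Real.one_rpow, mul_one]
    refine (besselMoment_zero_le d (c := 1) hγ (by linarith) zero_le_one ?_).trans ?_
    · intro t ht
      have h := pow_abs_besselJ_le 0 d (by simpa using ht)
      rw [one_mul]
      refine h.trans (le_of_eq ?_)
      rw [Nat.cast_zero, zero_pow two_ne_zero, sub_zero, ← Real.rpow_natCast, ← Real.rpow_mul ht.le]
      congr 1
      push_cast
      ring
    · refine ENNReal.ofReal_le_ofReal (le_trans ?_ hC)
      have : 1 / ((d : ℝ) / 2 - 1 - γ) ≤ 1 / (((d : ℝ) - 4) / 2) :=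
        one_div_le_one_div_of_le (by linarith) (by linarith)
      have h2 : 1 / (((d : ℝ) - 4) / 2) = 2 / ((d : ℝ) - 4) := one_div_div _ _
      linarith
  have hn1 : (1 : ℝ) ≤ n := by exact_mod_cast hn
  have hn0 : (0 : ℝ) < n := by linarith
  rw [max_eq_right hn1]
  set a : ℝ := (n : ℝ) ^ ((1 : ℝ) / 3) with ha
  have ha1 : 1 ≤ a := Real.one_le_rpow hn1 (by norm_num)
  have ha0 : 0 < a := by linarith
  have han : a ^ 3 = n := by
    rw [ha, ← Real.rpow_natCast, ← Real.rpow_mul hn0.le]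
    norm_num
  set B := (n : ℝ) ^ (γ - ((d : ℝ) - 1) / 3) with hB
  have hB0 : 0 < B := by positivity
  have hBa : (n : ℝ) ^ γ * a ^ (1 - (d : ℝ)) = B := by
    rw [ha, ← Real.rpow_mul hn0.le, ← Real.rpow_add hn0, hB]
    congr 1
    ring
  have hnear := lintegral_besselJ_transition_le d n (by omega) (κ := 81 / 121) ha1 han hγ
    hγ1 (by
      intro x hx hx2
      have h4 := pow_le_pow_left₀ (sq_nonneg x) hx2 2
      have hx1 : x ≤ 1 := by nlinarith
      have h5 : x ^ d ≤ x ^ 4 := pow_le_pow_of_le_one hx hx1 (by omega)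
      norm_num at h4 ⊢
      nlinarith)
  have hnear' : 81 / 121 * (1 / (d : ℝ) + 1 + γ / 2) * (n : ℝ) ^ γ * a ^ (1 - (d : ℝ)) ≤
      57 / 50 * B := by
    rw [mul_assoc, hBa]
    refine mul_le_mul_of_nonneg_right ?_ hB0.le
    have : 1 / (d : ℝ) ≤ 1 / 5 := one_div_le_one_div_of_le (by norm_num) hd5
    linarith
  have hfar : ∫⁻ t in Ioi ((n : ℝ) + a / 2), ENNReal.ofReal (t ^ γ * |besselJ n t| ^ d) ≤
      ENNReal.ofReal (2 / ((d : ℝ) - 4) * B) := by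
    set K : ℝ := (n : ℝ) ^ γ / n
    have hK0 : 0 ≤ K := by positivity
    have hφ : ∀ t ∈ Ici ((n : ℝ) + a / 2), a ^ 4 ≤ t ^ 2 - (n : ℝ) ^ 2 := by
      intro t ht
      have ht' : (n : ℝ) + a / 2 ≤ t := ht
      have h1 : ((n : ℝ) + a / 2) ^ 2 ≤ t ^ 2 := pow_le_pow_left₀ (by positivity) ht' 2
      rw [← han] at h1 ⊢
      nlinarith [sq_nonneg a]
    have hder : ∀ x ∈ Ici ((n : ℝ) + a / 2), HasDerivAt
        (fun t => -(2 / ((d : ℝ) - 4)) * (t ^ 2 - (n : ℝ) ^ 2) ^ (1 - (d : ℝ) / 4))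
        (x * (x ^ 2 - (n : ℝ) ^ 2) ^ (-(d : ℝ) / 4)) x := by
      intro x hx
      have h0 : 0 < x ^ 2 - (n : ℝ) ^ 2 := lt_of_lt_of_le (by positivity) (hφ x hx)
      refine (((((hasDerivAt_id x).pow 2).sub_const ((n : ℝ) ^ 2)).rpow_const
        (p := 1 - (d : ℝ) / 4) (Or.inl h0.ne')).const_mul (-(2 / ((d : ℝ) - 4)))).congr_deriv ?_
      simp only [id, Pi.pow_apply]
      have : (1 : ℝ) - d / 4 - 1 = -(d : ℝ) / 4 := by ring
      rw [this]
      push_cast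
      field_simp
      ring
    refine (setLIntegral_ofReal_mono measurableSet_Ioi
      (g := fun t => K * (t * (t ^ 2 - (n : ℝ) ^ 2) ^ (-(d : ℝ) / 4))) fun t ht => ?_).trans ?_
    · have ht' : (n : ℝ) + a / 2 < t := ht
      have htn : (n : ℝ) < t := by linarith
      have h1 := pow_abs_besselJ_le n d htn
      -- Since `γ ≤ 1` and `t ≥ n`, the weight may be replaced by a multiple of `t`, for which `t
      -- (t² - n²)^{-d/4}` has an explicit primitive.
      have h2 : t ^ γ ≤ (n : ℝ) ^ γ * (t / n) := by
        have h3 : t = n * (t / n) := by field_simp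
        have h4 : 1 ≤ t / n := by rw [le_div_iff₀ hn0]; linarith
        conv_lhs => rw [h3, Real.mul_rpow hn0.le (by positivity)]
        refine mul_le_mul_of_nonneg_left ?_ (by positivity)
        exact (Real.rpow_le_rpow_of_exponent_le h4 hγ1).trans (Real.rpow_one _).le
      have h5 : K * (t * (t ^ 2 - (n : ℝ) ^ 2) ^ (-(d : ℝ) / 4)) =
          (n : ℝ) ^ γ * (t / n) * (t ^ 2 - (n : ℝ) ^ 2) ^ (-(d : ℝ) / 4) := by
        simp only [K]; ring
      rw [h5]
      have : 0 < t := by linarith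
      exact mul_le_mul h2 h1 (by positivity) (by positivity)
    · rw [setLIntegral_ofReal_const_mul _ hK0,
        lintegral_Ioi_of_hasDerivAt (m := -(2 / ((d : ℝ) - 4)) * 0)
          (hder _ self_mem_Ici).continuousAt.continuousWithinAt
          (fun x hx => hder x (Ioi_subset_Ici_self hx)), ← ENNReal.ofReal_mul hK0]
      · refine ENNReal.ofReal_le_ofReal ?_
        have h1 : (((n : ℝ) + a / 2) ^ 2 - (n : ℝ) ^ 2) ^ (1 - (d : ℝ) / 4) ≤
            (a ^ 4) ^ (1 - (d : ℝ) / 4) :=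
          Real.rpow_le_rpow_of_nonpos (by positivity) (hφ _ self_mem_Ici) (by linarith)
        have h2 : K * (a ^ 4) ^ (1 - (d : ℝ) / 4) = B := by
          rw [← hBa, ← Real.rpow_natCast a 4, ← Real.rpow_mul ha0.le]
          simp only [K]
          rw [← han, ← Real.rpow_natCast a 3, div_eq_mul_inv, ← Real.rpow_neg ha0.le, mul_assoc,
            ← Real.rpow_add ha0]
          congr 2
          push_cast
          ring
        have h3 := mul_le_mul_of_nonneg_left h1
          (show 0 ≤ 2 / ((d : ℝ) - 4) * K by positivity)
        rw [mul_assoc _ K, mul_assoc _ K, h2] at h3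
        linarith
      · intro x hx
        have hx' : (n : ℝ) + a / 2 < x := hx
        have h0 : 0 ≤ x ^ 2 - (n : ℝ) ^ 2 := le_trans (by positivity) (hφ x hx'.le)
        have : 0 < x := by linarith
        positivity
      · refine Tendsto.const_mul _ ?_
        have h1 : Tendsto (fun t : ℝ => t ^ 2 - (n : ℝ) ^ 2) atTop atTop :=
          tendsto_atTop_add_const_right _ _ (tendsto_pow_atTop two_ne_zero)
        have h2 := (tendsto_rpow_neg_atTop (y := (d : ℝ) / 4 - 1) (by linarith)).comp h1
        refine h2.congr fun t => ?_
        simp only [Function.comp]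
        congr 1
        ring
  rw [besselMoment_split d n (a := a) (by linarith)]
  calc _ ≤ ENNReal.ofReal (57 / 50 * B) + ENNReal.ofReal (2 / ((d : ℝ) - 4) * B) :=
        add_le_add (hnear.trans (ENNReal.ofReal_le_ofReal hnear')) hfar
    _ ≤ _ := by
        rw [← ENNReal.ofReal_add (by positivity) (by positivity)]
        refine ENNReal.ofReal_le_ofReal ?_
        rw [← add_mul]
        exact mul_le_mul_of_nonneg_right hC hB0.le

end LatticeResolvent

namespace LatticeResolvent

/-! ### Hilbert-Schmidt operators given by kernels -/

theorem summable_and_tsum_le_of_ofReal {α : Type*} {f : α → ℝ} {c : ℝ} (hf : ∀ x, 0 ≤ f x)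
    (hc : 0 ≤ c) (h : ∑' x, ENNReal.ofReal (f x) ≤ ENNReal.ofReal c) :
    Summable f ∧ ∑' x, f x ≤ c := by
  have hs : ∀ s : Finset α, ∑ x ∈ s, f x ≤ c := by
    intro s
    rw [← ENNReal.ofReal_le_ofReal_iff hc, ENNReal.ofReal_sum_of_nonneg fun x _ => hf x]
    exact (ENNReal.sum_le_tsum s).trans h
  have hsum := summable_of_sum_le hf hs
  exact ⟨hsum, hsum.tsum_le_of_sum_le hs⟩

namespace HSOp

variable {ι : Type}

/-- The matrix entry `⟨eₙ, T eₘ⟩`. -/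
def entry [DecidableEq ι] (T : HSOp ι) (n m : ι) : ℂ := toCLM T (lp.single 2 m (1 : ℂ)) n

theorem ext_entry [DecidableEq ι] {S T : HSOp ι} (h : ∀ n m, entry S n m = entry T n m) :
    S = T := by
  apply columns_injective
  apply lp.ext
  funext m
  apply lp.ext
  funext n
  exact h n m

theorem toCLM_eq_of_entry [DecidableEq ι] (T : HSOp ι) (A : L2 ι →L[ℂ] L2 ι)
    (h : ∀ n m, entry T n m = A (lp.single 2 m (1 : ℂ)) n) : toCLM T = A := by
  have hcol : ∀ m, toCLM T (lp.single 2 m (1 : ℂ)) = A (lp.single 2 m (1 : ℂ)) := by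
    intro m
    apply lp.ext
    funext n
    exact h n m
  ext1 f
  have hf := lp.hasSum_single (p := 2) (by norm_num) f
  have key : ∀ n, toCLM T (lp.single 2 n (f n)) = A (lp.single 2 n (f n)) := by
    intro n
    have h2 : lp.single (E := fun _ : ι => ℂ) 2 n (f n) = f n • lp.single 2 n (1 : ℂ) := by
      rw [← lp.single_smul]
      simp
    rw [h2, map_smul, map_smul, hcol n]
  have hT := hf.mapL (toCLM T)
  simp only [key] at hT
  exact hT.unique (hf.mapL A)

/-- The rows of a square summable kernel, conjugated. -/
def kernelRow (k : ι → ι → ℂ) (hk : Summable fun x : ι × ι => ‖k x.1 x.2‖ ^ 2) (n : ι) : L2 ι :=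
  ⟨fun m => starRingEnd ℂ (k n m), memℓp_gen (by simpa using hk.prod_factor n)⟩

theorem norm_sq_kernelRow (k : ι → ι → ℂ) (hk : Summable fun x : ι × ι => ‖k x.1 x.2‖ ^ 2)
    (n : ι) : ‖kernelRow k hk n‖ ^ 2 = ∑' m, ‖k n m‖ ^ 2 := by
  have h := lp.norm_rpow_eq_tsum (p := 2) (by norm_num) (kernelRow k hk n)
  simpa [kernelRow] using h

theorem hasSum_norm_sq_kernelRow (k : ι → ι → ℂ)
    (hk : Summable fun x : ι × ι => ‖k x.1 x.2‖ ^ 2) :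
    HasSum (fun n => ‖kernelRow k hk n‖ ^ 2) (∑' x : ι × ι, ‖k x.1 x.2‖ ^ 2) := by
  simp only [norm_sq_kernelRow]
  exact hk.hasSum.prod_fiberwise fun n => (hk.prod_factor n).hasSum

/-- The bounded operator with square summable kernel `k`. -/
def kernelCLM (k : ι → ι → ℂ) (hk : Summable fun x : ι × ι => ‖k x.1 x.2‖ ^ 2) :
    L2 ι →L[ℂ] L2 ι :=
  LinearMap.mkContinuous
    { toFun := fun f => ⟨fun n => inner ℂ (kernelRow k hk n) f, by
        refine memℓp_gen ?_
        refine Summable.of_nonneg_of_le (fun n => by positivity) (fun n => ?_)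
          ((hasSum_norm_sq_kernelRow k hk).summable.mul_right (‖f‖ ^ 2))
        rw [← mul_pow]
        simpa using pow_le_pow_left₀ (norm_nonneg _) (norm_inner_le_norm (𝕜 := ℂ)
          (kernelRow k hk n) f) 2⟩
      map_add' := fun f g => by
        apply lp.ext
        funext n
        exact inner_add_right _ _ _
      map_smul' := fun c f => by
        apply lp.ext
        funext n
        exact inner_smul_right _ _ _ }
    (Real.sqrt (∑' x : ι × ι, ‖k x.1 x.2‖ ^ 2)) (fun f => by
      have h0 : 0 ≤ ∑' x : ι × ι, ‖k x.1 x.2‖ ^ 2 := tsum_nonneg fun _ => sq_nonneg _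
      refine lp.norm_le_of_forall_sum_le (by norm_num) (by positivity) fun s => ?_
      simp only [ENNReal.toReal_ofNat, Real.rpow_ofNat, mul_pow, Real.sq_sqrt h0]
      calc ∑ n ∈ s, ‖inner ℂ (kernelRow k hk n) f‖ ^ 2
          ≤ ∑ n ∈ s, ‖kernelRow k hk n‖ ^ 2 * ‖f‖ ^ 2 := by
            refine Finset.sum_le_sum fun n _ => ?_
            rw [← mul_pow]
            exact pow_le_pow_left₀ (norm_nonneg _) (norm_inner_le_norm _ _) 2
        _ ≤ _ := by
            rw [← Finset.sum_mul]
            exact mul_le_mul_of_nonneg_right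
              (sum_le_hasSum s (fun n _ => sq_nonneg _) (hasSum_norm_sq_kernelRow k hk))
              (sq_nonneg _))

theorem kernelCLM_single [DecidableEq ι] (k : ι → ι → ℂ)
    (hk : Summable fun x : ι × ι => ‖k x.1 x.2‖ ^ 2)
    (n m : ι) : kernelCLM k hk (lp.single 2 m (1 : ℂ)) n = k n m := by
  change inner ℂ (kernelRow k hk n) (lp.single 2 m (1 : ℂ)) = k n m
  rw [lp.inner_single_right]
  simp [kernelRow]

theorem norm_sq_kernelCLM_single [DecidableEq ι] (k : ι → ι → ℂ)
    (hk : Summable fun x : ι × ι => ‖k x.1 x.2‖ ^ 2) (m : ι) :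
    ‖kernelCLM k hk (lp.single 2 m (1 : ℂ))‖ ^ 2 = ∑' n, ‖k n m‖ ^ 2 := by
  have h := lp.norm_rpow_eq_tsum (p := 2) (by norm_num) (kernelCLM k hk (lp.single 2 m (1 : ℂ)))
  simpa [kernelCLM_single] using h

theorem hasSum_norm_sq_kernelCLM_single [DecidableEq ι] (k : ι → ι → ℂ)
    (hk : Summable fun x : ι × ι => ‖k x.1 x.2‖ ^ 2) :
    HasSum (fun m => ‖kernelCLM k hk (lp.single 2 m (1 : ℂ))‖ ^ 2)
      (∑' x : ι × ι, ‖k x.1 x.2‖ ^ 2) := by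
  simp only [norm_sq_kernelCLM_single]
  have hk' : HasSum (fun x : ι × ι => ‖k x.2 x.1‖ ^ 2) (∑' x : ι × ι, ‖k x.1 x.2‖ ^ 2) :=
    (Equiv.prodComm ι ι).hasSum_iff.mpr hk.hasSum
  exact hk'.prod_fiberwise fun m => (hk'.summable.prod_factor m).hasSum

/-- The Hilbert-Schmidt operator with square summable kernel `k`. -/
def ofKernel [DecidableEq ι] (k : ι → ι → ℂ)
    (hk : Summable fun x : ι × ι => ‖k x.1 x.2‖ ^ 2) : HSOp ι :=
  ⟨kernelCLM k hk, by
    refine memℓp_gen ?_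
    simpa using (hasSum_norm_sq_kernelCLM_single k hk).summable⟩

theorem entry_ofKernel [DecidableEq ι] (k : ι → ι → ℂ)
    (hk : Summable fun x : ι × ι => ‖k x.1 x.2‖ ^ 2)
    (n m : ι) : entry (ofKernel k hk) n m = k n m :=
  kernelCLM_single k hk n m

theorem norm_sq_ofKernel [DecidableEq ι] (k : ι → ι → ℂ)
    (hk : Summable fun x : ι × ι => ‖k x.1 x.2‖ ^ 2) :
    ‖ofKernel k hk‖ ^ 2 = ∑' x : ι × ι, ‖k x.1 x.2‖ ^ 2 := by
  rw [norm_sq_eq_tsum]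
  exact (hasSum_norm_sq_kernelCLM_single k hk).tsum_eq

theorem entry_sub [DecidableEq ι] (S T : HSOp ι) (n m : ι) :
    entry (S - T) n m = entry S n m - entry T n m := by
  simp [entry]

theorem entry_add [DecidableEq ι] (S T : HSOp ι) (n m : ι) :
    entry (S + T) n m = entry S n m + entry T n m := by
  simp [entry]

theorem entry_smul [DecidableEq ι] (c : ℂ) (T : HSOp ι) (n m : ι) :
    entry (c • T) n m = c * entry T n m := by
  simp [entry]

end HSOp

/-! ### Young's inequality and weighted convolution operators -/

-- Hölder's inequality on `G × G` for the three products `UV`, `UW`, `VW`: each depends on two of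
-- `n`, `m`, `n - m`, any two of which are free coordinates, so each sum factors.
open MeasureTheory in
theorem tsum_young_le {G : Type*} [AddCommGroup G] [Countable G] (U V W : G → ℝ≥0∞) {α β : ℝ}
    (hα : 0 ≤ α) (hβ : 0 ≤ β) (hαβ : α + 2 * β = 1) :
    ∑' x : G × G, (U x.1 * V x.2) ^ α * ((U x.1 * W (x.1 - x.2)) ^ β *
        (V x.2 * W (x.1 - x.2)) ^ β) ≤
      ((∑' n, U n) * ∑' n, V n) ^ α * (((∑' n, U n) * ∑' n, W n) ^ β *
        ((∑' n, V n) * ∑' n, W n) ^ β) := by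
  let _ : MeasurableSpace (G × G) := ⊤
  set f : Fin 3 → G × G → ℝ≥0∞ := ![fun x => U x.1 * V x.2, fun x => U x.1 * W (x.1 - x.2),
    fun x => V x.2 * W (x.1 - x.2)] with hf
  have h := ENNReal.lintegral_prod_norm_pow_le (μ := Measure.count) Finset.univ (f := f)
    (p := ![α, β, β]) (fun i _ => (measurable_from_top).aemeasurable)
    (by simp [Fin.sum_univ_three]; linarith)
    (by intro i _; fin_cases i <;> simpa)
  simp only [lintegral_count, Fin.prod_univ_three, hf] at h
  have h1 : ∑' x : G × G, U x.1 * V x.2 = (∑' n, U n) * ∑' n, V n := by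
    rw [ENNReal.tsum_prod (f := fun a b => U a * V b)]
    simp only [ENNReal.tsum_mul_left, ENNReal.tsum_mul_right]
  have h2 : ∑' x : G × G, U x.1 * W (x.1 - x.2) = (∑' n, U n) * ∑' n, W n := by
    rw [ENNReal.tsum_prod (f := fun a b => U a * W (a - b))]
    have : ∀ a, ∑' b, W (a - b) = ∑' n, W n := fun a => (Equiv.subLeft a).tsum_eq W
    simp only [ENNReal.tsum_mul_left, ENNReal.tsum_mul_right, this]
  have h3 : ∑' x : G × G, V x.2 * W (x.1 - x.2) = (∑' n, V n) * ∑' n, W n := by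
    rw [ENNReal.tsum_prod (f := fun a b => V b * W (a - b)), ENNReal.tsum_comm]
    have : ∀ b, ∑' a, W (a - b) = ∑' n, W n := fun b => (Equiv.subRight b).tsum_eq W
    simp only [ENNReal.tsum_mul_left, ENNReal.tsum_mul_right, this]
  simp only [Matrix.cons_val_zero, Matrix.cons_val_one, Matrix.cons_val, h1, h2, h3] at h
  simpa only [mul_assoc] using h

/-- The convolution kernel `K` satisfies `‖K‖_p ≤ B` for the exponent `p = q / (q - 2)` for which
Young's inequality bounds the operator with kernel `u_n K_{n-m} v_m`, where `u, v ∈ ℓ^q`. -/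
def ConvolutionBound {d : ℕ} (q : ℝ) (K : Zd d → ℂ) (B : ℝ) : Prop :=
  if q = 2 then ∀ n, ‖K n‖ ≤ B
  else ∀ s : Finset (Zd d), ∑ n ∈ s, ‖K n‖ ^ (q / (q - 2)) ≤ B ^ (q / (q - 2))

theorem tsum_ofReal_norm_rpow {ι : Type} {q : ℝ} (hq : 0 < q)
    (u : lp (fun _ : ι => ℂ) (ENNReal.ofReal q)) :
    ∑' n, ENNReal.ofReal (‖u n‖ ^ q) = ENNReal.ofReal (‖u‖ ^ q) := by
  have hu0 := lp.norm_nonneg' u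
  have hq' : (ENNReal.ofReal q).toReal = q := ENNReal.toReal_ofReal hq.le
  have h0 : 0 < (ENNReal.ofReal q).toReal := by rwa [hq']
  have h := lp.norm_rpow_eq_tsum h0 u
  have hs := (lp.memℓp u).summable h0
  simp only [hq'] at h hs
  rw [h, ENNReal.ofReal_tsum_of_nonneg (fun n => by positivity) hs]

theorem tsum_young_lp_le {d : ℕ} {q : ℝ} (hq : 2 ≤ q) (hq4 : q ≤ 4)
    (u v : lp (fun _ : Zd d => ℂ) (ENNReal.ofReal q)) {K : Zd d → ℂ} {B : ℝ} (hB : 0 ≤ B)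
    (hK : ConvolutionBound q K B) :
    ∑' x : Zd d × Zd d, ENNReal.ofReal (‖u x.1 * K (x.1 - x.2) * v x.2‖ ^ 2) ≤
      ENNReal.ofReal ((B * ‖u‖ * ‖v‖) ^ 2) := by
  have hq0 : 0 < q := by linarith
  have hu0 := lp.norm_nonneg' u
  have hv0 := lp.norm_nonneg' v
  rcases hq.eq_or_lt with rfl | hq2
  · simp only [ConvolutionBound, if_true] at hK
    have hu := tsum_ofReal_norm_rpow hq0 u
    have hv := tsum_ofReal_norm_rpow hq0 v
    simp only [Real.rpow_two] at hu hv
    calc _ ≤ ∑' x : Zd d × Zd d, ENNReal.ofReal (B ^ 2) *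
          (ENNReal.ofReal (‖u x.1‖ ^ 2) * ENNReal.ofReal (‖v x.2‖ ^ 2)) := by
          refine ENNReal.tsum_le_tsum fun x => ?_
          rw [← ENNReal.ofReal_mul (by positivity), ← ENNReal.ofReal_mul (by positivity)]
          refine ENNReal.ofReal_le_ofReal ?_
          rw [norm_mul, norm_mul, ← mul_pow, ← mul_pow]
          refine pow_le_pow_left₀ (by positivity) ?_ 2
          have := mul_le_mul_of_nonneg_right (hK (x.1 - x.2))
            (show 0 ≤ ‖u x.1‖ * ‖v x.2‖ by positivity)
          linarith
      _ = _ := by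
          rw [ENNReal.tsum_mul_left, ENNReal.tsum_prod
            (f := fun a b => ENNReal.ofReal (‖u a‖ ^ 2) * ENNReal.ofReal (‖v b‖ ^ 2))]
          simp only [ENNReal.tsum_mul_left, ENNReal.tsum_mul_right, hu, hv]
          rw [← ENNReal.ofReal_mul (by positivity), ← ENNReal.ofReal_mul (by positivity)]
          congr 1
          ring
  · simp only [ConvolutionBound, hq2.ne', if_false] at hK
    set p := q / (q - 2) with hp
    have hq20 : 0 < q - 2 := by linarith
    have hp0 : 0 < p := by positivity
    have hα : 0 ≤ 4 / q - 1 := by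
      rw [sub_nonneg, le_div_iff₀ hq0]; linarith
    have hβ : 0 ≤ 1 - 2 / q := by
      rw [sub_nonneg, div_le_one hq0]; linarith
    -- With `α = 4/q - 1` and `β = 1 - 2/q`, the total powers are `q(α+β) = 2` on `u` and on `v`,
    -- and `2pβ = 2` on `K`. The condition `α ≥ 0` is `q ≤ 4`.
    have h := tsum_young_le (G := Zd d) (fun n => ENNReal.ofReal (‖u n‖ ^ q))
      (fun n => ENNReal.ofReal (‖v n‖ ^ q)) (fun n => ENNReal.ofReal (‖K n‖ ^ p)) hα hβ (by ring)
    have hKs : ∑' n, ENNReal.ofReal (‖K n‖ ^ p) ≤ ENNReal.ofReal (B ^ p) := by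
      rw [ENNReal.tsum_eq_iSup_sum]
      refine iSup_le fun s => ?_
      rw [← ENNReal.ofReal_sum_of_nonneg fun n _ => by positivity]
      exact ENNReal.ofReal_le_ofReal (hK s)
    have key : ∀ x y z : ℝ, 0 ≤ x → 0 ≤ y → 0 ≤ z →
        (ENNReal.ofReal (x ^ q) * ENNReal.ofReal (y ^ q)) ^ (4 / q - 1) *
        ((ENNReal.ofReal (x ^ q) * ENNReal.ofReal (z ^ p)) ^ (1 - 2 / q) *
        (ENNReal.ofReal (y ^ q) * ENNReal.ofReal (z ^ p)) ^ (1 - 2 / q)) =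
        ENNReal.ofReal ((z * x * y) ^ 2) := by
      intro x y z hx hy hz
      have e1 : ∀ w : ℝ, 0 ≤ w → (w ^ q) ^ (4 / q - 1) * (w ^ q) ^ (1 - 2 / q) = w ^ 2 := by
        intro w hw
        rcases hw.eq_or_lt with rfl | hw
        · rw [Real.zero_rpow hq0.ne', Real.zero_rpow (x := 1 - 2 / q), mul_zero]
          · norm_num
          · rw [sub_ne_zero]
            exact ((div_lt_one hq0).mpr hq2).ne'
        · rw [← Real.rpow_mul hw.le, ← Real.rpow_mul hw.le, ← Real.rpow_add hw,
            ← Real.rpow_natCast]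
          congr 1
          field_simp
          push_cast
          ring
      have e2 : (z ^ p) ^ (1 - 2 / q) * (z ^ p) ^ (1 - 2 / q) = z ^ 2 := by
        rw [← Real.rpow_mul hz, ← sq, ← Real.rpow_natCast, ← Real.rpow_mul hz,
          ← Real.rpow_natCast]
        congr 1
        rw [hp]
        field_simp
      rw [← ENNReal.ofReal_mul (by positivity), ← ENNReal.ofReal_mul (by positivity),
        ← ENNReal.ofReal_mul (by positivity), ENNReal.ofReal_rpow_of_nonneg (by positivity) hα,
        ENNReal.ofReal_rpow_of_nonneg (by positivity) hβ,
        ENNReal.ofReal_rpow_of_nonneg (by positivity) hβ, ← ENNReal.ofReal_mul (by positivity),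
        ← ENNReal.ofReal_mul (by positivity)]
      congr 1
      rw [Real.mul_rpow (by positivity) (by positivity),
        Real.mul_rpow (by positivity) (by positivity),
        Real.mul_rpow (by positivity) (by positivity), mul_pow, mul_pow, ← e2, ← e1 x hx, ← e1 y hy]
      ring
    calc _ = ∑' x : Zd d × Zd d,
          (ENNReal.ofReal (‖u x.1‖ ^ q) * ENNReal.ofReal (‖v x.2‖ ^ q)) ^ (4 / q - 1) *
          ((ENNReal.ofReal (‖u x.1‖ ^ q) * ENNReal.ofReal (‖K (x.1 - x.2)‖ ^ p)) ^ (1 - 2 / q) *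
          (ENNReal.ofReal (‖v x.2‖ ^ q) * ENNReal.ofReal (‖K (x.1 - x.2)‖ ^ p)) ^ (1 - 2 / q)) := by
          refine tsum_congr fun x => ?_
          rw [key _ _ _ (norm_nonneg _) (norm_nonneg _) (norm_nonneg _), norm_mul, norm_mul,
            mul_comm ‖u x.1‖]
      _ ≤ _ := h
      _ ≤ (ENNReal.ofReal (‖u‖ ^ q) * ENNReal.ofReal (‖v‖ ^ q)) ^ (4 / q - 1) *
          ((ENNReal.ofReal (‖u‖ ^ q) * ENNReal.ofReal (B ^ p)) ^ (1 - 2 / q) *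
          (ENNReal.ofReal (‖v‖ ^ q) * ENNReal.ofReal (B ^ p)) ^ (1 - 2 / q)) := by
          rw [tsum_ofReal_norm_rpow hq0 u, tsum_ofReal_norm_rpow hq0 v]
          gcongr
      _ = _ := key _ _ _ (lp.norm_nonneg' u) (lp.norm_nonneg' v) hB

/-- The Hilbert-Schmidt operator with kernel `u_n K_{n-m} v_m`, if this kernel is square
summable. -/
def weightedConvolution {d : ℕ} {p : ℝ≥0∞} (u v : lp (fun _ : Zd d => ℂ) p) (K : Zd d → ℂ) :
    HSOp (Zd d) :=
  open Classical in
  if h : Summable fun x : Zd d × Zd d => ‖u x.1 * K (x.1 - x.2) * v x.2‖ ^ 2 then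
    HSOp.ofKernel (fun n m => u n * K (n - m) * v m) h else 0


theorem summable_weightedConvolution {d : ℕ} {q : ℝ} (hq : 2 ≤ q) (hq4 : q ≤ 4)
    (u v : lp (fun _ : Zd d => ℂ) (ENNReal.ofReal q)) {K : Zd d → ℂ} {B : ℝ} (hB : 0 ≤ B)
    (hK : ConvolutionBound q K B) :
    Summable fun x : Zd d × Zd d => ‖u x.1 * K (x.1 - x.2) * v x.2‖ ^ 2 :=
  (summable_and_tsum_le_of_ofReal (fun _ => by positivity) (by positivity)
    (tsum_young_lp_le hq hq4 u v hB hK)).1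

theorem entry_weightedConvolution {d : ℕ} {q : ℝ} (hq : 2 ≤ q) (hq4 : q ≤ 4)
    (u v : lp (fun _ : Zd d => ℂ) (ENNReal.ofReal q)) {K : Zd d → ℂ} {B : ℝ} (hB : 0 ≤ B)
    (hK : ConvolutionBound q K B) (n m : Zd d) :
    HSOp.entry (weightedConvolution u v K) n m = u n * K (n - m) * v m := by
  rw [weightedConvolution, dif_pos (summable_weightedConvolution hq hq4 u v hB hK),
    HSOp.entry_ofKernel]

theorem norm_weightedConvolution_le {d : ℕ} {q : ℝ} (hq : 2 ≤ q) (hq4 : q ≤ 4)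
    (u v : lp (fun _ : Zd d => ℂ) (ENNReal.ofReal q)) {K : Zd d → ℂ} {B : ℝ} (hB : 0 ≤ B)
    (hK : ConvolutionBound q K B) : ‖weightedConvolution u v K‖ ≤ B * ‖u‖ * ‖v‖ := by
  have h := summable_and_tsum_le_of_ofReal (fun _ => by positivity) (by positivity)
    (tsum_young_lp_le hq hq4 u v hB hK)
  have hu := lp.norm_nonneg' u
  have hv := lp.norm_nonneg' v
  refine le_of_sq_le_sq ?_ (by positivity)
  rw [weightedConvolution, dif_pos h.1, HSOp.norm_sq_ofKernel]
  exact h.2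

theorem weightedConvolution_sub {d : ℕ} {q : ℝ} (hq : 2 ≤ q) (hq4 : q ≤ 4)
    (u v : lp (fun _ : Zd d => ℂ) (ENNReal.ofReal q)) {K K' : Zd d → ℂ} {B B' B'' : ℝ} (hB : 0 ≤ B)
    (hK : ConvolutionBound q K B) (hB' : 0 ≤ B') (hK' : ConvolutionBound q K' B') (hB'' : 0 ≤ B'')
    (hKK' : ConvolutionBound q (fun n => K n - K' n) B'') :
    weightedConvolution u v K - weightedConvolution u v K' =
      weightedConvolution u v (fun n => K n - K' n) := by
  refine HSOp.ext_entry fun n m => ?_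
  rw [HSOp.entry_sub, entry_weightedConvolution hq hq4 u v hB hK,
    entry_weightedConvolution hq hq4 u v hB' hK',
    entry_weightedConvolution hq hq4 u v hB'' hKK']
  ring

/-- The embedding `ℓ² ⊂ ℓ^p`, valid because `p = q/(q-2) ≥ 2` exactly when `q ≤ 4`. -/
theorem convolutionBound_norm {d : ℕ} {q : ℝ} (hq : 2 ≤ q) (hq4 : q ≤ 4) (f : L2 (Zd d)) :
    ConvolutionBound q (fun n => f n) ‖f‖ := by
  rcases hq.eq_or_lt with rfl | hq2
  · simp only [ConvolutionBound, if_true]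
    exact fun n => lp.norm_apply_le_norm (by norm_num) f n
  · simp only [ConvolutionBound, hq2.ne', if_false]
    intro s
    have hq20 : 0 < q - 2 := by linarith
    have hp : 2 ≤ q / (q - 2) := by rw [le_div_iff₀ hq20]; linarith
    have hr : 0 ≤ q / (q - 2) - 2 := by linarith
    have h := lp.sum_rpow_le_norm_rpow (p := 2) (by norm_num) f s
    simp only [ENNReal.toReal_ofNat, Real.rpow_ofNat] at h
    have hsplit : ∀ x : ℝ, 0 ≤ x → x ^ (q / (q - 2)) = x ^ (q / (q - 2) - 2) * x ^ 2 := by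
      intro x hx
      rw [← Real.rpow_two, ← Real.rpow_add_of_nonneg hx hr zero_le_two, sub_add_cancel]
    rw [hsplit _ (norm_nonneg f)]
    calc ∑ n ∈ s, ‖f n‖ ^ (q / (q - 2))
        ≤ ∑ n ∈ s, ‖f‖ ^ (q / (q - 2) - 2) * ‖f n‖ ^ 2 := by
          refine Finset.sum_le_sum fun n _ => ?_
          rw [hsplit _ (norm_nonneg _)]
          refine mul_le_mul_of_nonneg_right ?_ (sq_nonneg _)
          exact Real.rpow_le_rpow (norm_nonneg _) (lp.norm_apply_le_norm (by norm_num) f n) hr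
      _ ≤ _ := by
          rw [← Finset.mul_sum]
          exact mul_le_mul_of_nonneg_left h (by positivity)

/-- The map `K ↦ u K v` from `ℓ²` convolution kernels to Hilbert-Schmidt operators. -/
def weightedConvolutionCLM {d : ℕ} {q : ℝ} (hq : 2 ≤ q) (hq4 : q ≤ 4)
    (u v : lp (fun _ : Zd d => ℂ) (ENNReal.ofReal q)) : L2 (Zd d) →L[ℂ] HSOp (Zd d) :=
  LinearMap.mkContinuous
    { toFun := fun f => weightedConvolution u v (fun n => f n)
      map_add' := fun f g => by
        refine HSOp.ext_entry fun n m => ?_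
        rw [HSOp.entry_add, entry_weightedConvolution hq hq4 u v (norm_nonneg _)
            (convolutionBound_norm hq hq4 (f + g)),
          entry_weightedConvolution hq hq4 u v (norm_nonneg _) (convolutionBound_norm hq hq4 f),
          entry_weightedConvolution hq hq4 u v (norm_nonneg _) (convolutionBound_norm hq hq4 g),
          lp.coeFn_add, Pi.add_apply]
        ring
      map_smul' := fun c f => by
        refine HSOp.ext_entry fun n m => ?_
        rw [RingHom.id_apply, HSOp.entry_smul, entry_weightedConvolution hq hq4 u v (norm_nonneg _)
            (convolutionBound_norm hq hq4 (c • f)),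
          entry_weightedConvolution hq hq4 u v (norm_nonneg _) (convolutionBound_norm hq hq4 f),
          lp.coeFn_smul, Pi.smul_apply, smul_eq_mul]
        ring }
    (‖u‖ * ‖v‖) (fun f => by
      have h := norm_weightedConvolution_le hq hq4 u v (norm_nonneg _)
        (convolutionBound_norm hq hq4 f)
      refine h.trans (le_of_eq ?_)
      ring)

theorem weightedConvolutionCLM_apply {d : ℕ} {q : ℝ} (hq : 2 ≤ q) (hq4 : q ≤ 4)
    (u v : lp (fun _ : Zd d => ℂ) (ENNReal.ofReal q)) (f : L2 (Zd d)) :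
    weightedConvolutionCLM hq hq4 u v f = weightedConvolution u v (fun n => f n) := rfl

end LatticeResolvent

namespace LatticeResolvent

/-! ### The resolvent kernel -/

open MeasureTheory Set Filter Topology

/-- A finite subset of `ℤ^d` lies in a cube `t^d`, on which the sum of products factors. -/
theorem sum_prod_le_pow {d : ℕ} {w : ℤ → ℝ} (hw : ∀ m, 0 ≤ w m) {S : ℝ}
    (hS : ∀ s : Finset ℤ, ∑ m ∈ s, w m ≤ S) (s : Finset (Zd d)) :
    ∑ n ∈ s, ∏ j, w (n j) ≤ S ^ d := by
  classical
  set t : Finset ℤ := s.biUnion fun n => Finset.univ.image n with ht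
  have hsub : s ⊆ Fintype.piFinset fun _ : Fin d => t := by
    intro n hn
    rw [Fintype.mem_piFinset]
    intro j
    exact Finset.mem_biUnion.mpr ⟨n, hn, Finset.mem_image_of_mem _ (Finset.mem_univ j)⟩
  calc ∑ n ∈ s, ∏ j, w (n j) ≤ ∑ n ∈ Fintype.piFinset fun _ : Fin d => t, ∏ j, w (n j) :=
        Finset.sum_le_sum_of_subset_of_nonneg hsub fun n _ _ => Finset.prod_nonneg fun j _ => hw _
    _ = (∑ m ∈ t, w m) ^ d := by
        rw [Finset.sum_prod_piFinset t fun _ => w]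
        simp
    _ ≤ S ^ d := pow_le_pow_left₀ (Finset.sum_nonneg fun m _ => hw m) (hS t) d

/-- The kernel of the unitary group `exp (-i t Δ)`. -/
def evolutionKernel {d : ℕ} (t : ℝ) (n : Zd d) : ℂ :=
  ∏ j, (-Complex.I) ^ (n j) * (besselJ (n j) t : ℂ)

theorem norm_evolutionKernel {d : ℕ} (t : ℝ) (n : Zd d) :
    ‖evolutionKernel t n‖ = ∏ j, |besselJ (n j) t| := by
  simp [evolutionKernel, norm_prod]

theorem norm_evolutionKernel_le_one {d : ℕ} (t : ℝ) (n : Zd d) : ‖evolutionKernel t n‖ ≤ 1 := by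
  rw [norm_evolutionKernel]
  exact Finset.prod_le_one (fun _ _ => abs_nonneg _) fun _ _ => abs_besselJ_le_one _ _

theorem evolutionKernel_zero_left {d : ℕ} (n : Zd d) :
    evolutionKernel 0 n = if n = 0 then 1 else 0 := by
  split_ifs with h
  · subst h
    simp [evolutionKernel, besselJ_zero_right]
  · obtain ⟨j, hj⟩ := Function.ne_iff.mp h
    refine Finset.prod_eq_zero (Finset.mem_univ j) ?_
    rw [besselJ_zero_right, if_neg (by simpa using hj)]
    simp

theorem sum_sq_norm_evolutionKernel_le_one {d : ℕ} (t : ℝ) (s : Finset (Zd d)) :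
    ∑ n ∈ s, ‖evolutionKernel t n‖ ^ 2 ≤ 1 := by
  have h := sum_prod_le_pow (d := d) (w := fun m => besselJ m t ^ 2) (fun m => sq_nonneg _)
    (fun s => sum_sq_besselJ_le_one s t) s
  rw [one_pow] at h
  simpa only [norm_evolutionKernel, ← Finset.prod_pow, sq_abs] using h

/-- The phase `(-i)^m` turns the difference `J_{m-1} - J_{m+1}` into a sum, that is, into a
one-dimensional Laplacian. Multiplying over the coordinates gives `∂ₜ = -iΔ`. -/
theorem hasDerivAt_evolutionKernel_factor (m : ℤ) (t : ℝ) :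
    HasDerivAt (fun t : ℝ => (-Complex.I) ^ m * (besselJ m t : ℂ))
      (-Complex.I / 2 * ((-Complex.I) ^ (m + 1) * (besselJ (m + 1) t : ℂ) +
        (-Complex.I) ^ (m - 1) * (besselJ (m - 1) t : ℂ))) t := by
  refine ((hasDerivAt_besselJ m t).ofReal_comp.const_mul _).congr_deriv ?_
  have hI : -Complex.I ≠ 0 := neg_ne_zero.mpr Complex.I_ne_zero
  rw [zpow_add_one₀ hI, zpow_sub_one₀ hI]
  push_cast
  have h2 := Complex.I_sq
  field_simp
  linear_combination (-besselJ (m + 1) t : ℂ) * h2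

theorem hasDerivAt_evolutionKernel {d : ℕ} (n : Zd d) (t : ℝ) :
    HasDerivAt (fun t : ℝ => evolutionKernel t n)
      (-Complex.I * ((1 / 2 : ℂ) * ∑ j : Fin d, (evolutionKernel t (n + Pi.single j 1) +
        evolutionKernel t (n - Pi.single j 1)))) t := by
  have h := HasDerivAt.fun_finsetProd (u := Finset.univ)
    (f := fun (j : Fin d) (t : ℝ) => (-Complex.I) ^ (n j) * (besselJ (n j) t : ℂ))
    (fun j _ => hasDerivAt_evolutionKernel_factor (n j) t)
  refine h.congr_deriv ?_
  have key : ∀ (j : Fin d) (e : ℤ), evolutionKernel t (n + Pi.single j e) =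
      (∏ i ∈ Finset.univ.erase j, (-Complex.I) ^ (n i) * (besselJ (n i) t : ℂ)) *
        ((-Complex.I) ^ (n j + e) * (besselJ (n j + e) t : ℂ)) := by
    intro j e
    rw [evolutionKernel, ← Finset.prod_erase_mul _ _ (Finset.mem_univ j)]
    congr 1
    · refine Finset.prod_congr rfl fun i hi => ?_
      simp [Finset.ne_of_mem_erase hi]
    · simp
  rw [Finset.mul_sum, Finset.mul_sum]
  refine Finset.sum_congr rfl fun j _ => ?_
  rw [sub_eq_add_neg n, ← Pi.single_neg, key, key, smul_eq_mul, ← sub_eq_add_neg]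
  ring

theorem continuous_evolutionKernel {d : ℕ} (n : Zd d) :
    Continuous fun t : ℝ => evolutionKernel t n :=
  continuous_iff_continuousAt.mpr fun t => (hasDerivAt_evolutionKernel n t).continuousAt

/-- Hölder's inequality for the moments of the evolution kernel. -/
theorem lintegral_evolutionKernel_le {d : ℕ} (hd : d ≠ 0) (n : Zd d) (γ : ℝ) :
    ∫⁻ t in Ioi (0 : ℝ), ENNReal.ofReal (t ^ γ * ‖evolutionKernel t n‖) ≤
      ∏ j, besselMoment d (n j) γ ^ (1 / (d : ℝ)) := by
  have hd0 : (d : ℝ) ≠ 0 := by exact_mod_cast hd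
  have h := ENNReal.lintegral_prod_norm_pow_le (μ := volume.restrict (Ioi (0 : ℝ))) Finset.univ
    (f := fun (j : Fin d) t => ENNReal.ofReal (t ^ γ * |besselJ (n j) t| ^ d))
    (p := fun _ => 1 / (d : ℝ)) (fun j _ => by
      have := (continuous_besselJ (n j)).measurable
      exact Measurable.aemeasurable (by fun_prop))
    (by simp [hd0]) (fun _ _ => by positivity)
  refine le_trans (le_of_eq ?_) h
  refine setLIntegral_congr_fun measurableSet_Ioi fun t ht => ?_
  have ht0 : (0 : ℝ) < t := ht
  have h1 : ∀ j : Fin d, ENNReal.ofReal (t ^ γ * |besselJ (n j) t| ^ d) ^ (1 / (d : ℝ)) =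
      ENNReal.ofReal (t ^ (γ / d) * |besselJ (n j) t|) := by
    intro j
    rw [ENNReal.ofReal_rpow_of_nonneg (by positivity) (by positivity),
      Real.mul_rpow (by positivity) (by positivity), ← Real.rpow_mul ht0.le, one_div,
      Real.pow_rpow_inv_natCast (abs_nonneg _) hd, div_eq_mul_inv]
  simp only [h1]
  rw [← ENNReal.ofReal_prod_of_nonneg (fun j _ => by positivity), Finset.prod_mul_distrib,
    Finset.prod_const, Finset.card_univ, Fintype.card_fin, norm_evolutionKernel,
    ← Real.rpow_natCast, ← Real.rpow_mul ht0.le, div_mul_cancel₀ _ hd0]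

/-- The kernel of the boundary values of the resolvent, as an absolutely convergent Laplace
transform of the evolution kernel (`d ≥ 3`, `Im z ≥ 0`). -/
def greenKernel {d : ℕ} (z : ℂ) (n : Zd d) : ℂ :=
  Complex.I * ∫ t in Ioi (0 : ℝ), Complex.exp (Complex.I * t * z) * evolutionKernel t n

theorem norm_exp_I_mul (t : ℝ) (z : ℂ) :
    ‖Complex.exp (Complex.I * t * z)‖ = Real.exp (-(z.im * t)) := by
  rw [Complex.norm_exp]
  congr 1
  simp
  ring

theorem norm_exp_I_mul_le_one {t : ℝ} {z : ℂ} (ht : 0 ≤ t) (hz : 0 ≤ z.im) :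
    ‖Complex.exp (Complex.I * t * z)‖ ≤ 1 := by
  rw [norm_exp_I_mul, Real.exp_le_one_iff]
  nlinarith

theorem norm_exp_sub_exp_le {a b : ℂ} (ha : a.re ≤ 0) (hb : b.re ≤ 0) :
    ‖Complex.exp a - Complex.exp b‖ ≤ ‖a - b‖ := by
  have h := Convex.norm_image_sub_le_of_norm_deriv_le (𝕜 := ℂ) (f := Complex.exp)
    (s := {w : ℂ | w.re ≤ 0}) (C := 1) (x := b) (y := a)
    (fun w _ => Complex.differentiable_exp w)
    (fun w hw => by
      rw [Complex.deriv_exp, Complex.norm_exp, Real.exp_le_one_iff]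
      exact hw)
    (convex_halfSpace_re_le 0) hb ha
  rwa [one_mul] at h

theorem norm_exp_I_mul_sub_le {t γ : ℝ} {z z' : ℂ} (ht : 0 < t) (hz : 0 ≤ z.im) (hz' : 0 ≤ z'.im)
    (hγ : 0 ≤ γ) (hγ1 : γ ≤ 1) :
    ‖Complex.exp (Complex.I * t * z) - Complex.exp (Complex.I * t * z')‖ ≤
      2 * ‖z - z'‖ ^ γ * t ^ γ := by
  have hre : ∀ w : ℂ, 0 ≤ w.im → (Complex.I * t * w).re ≤ 0 := by
    intro w hw
    simp
    positivity
  have h1 : ‖Complex.exp (Complex.I * t * z) - Complex.exp (Complex.I * t * z')‖ ≤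
      ‖z - z'‖ * t := by
    refine (norm_exp_sub_exp_le (hre z hz) (hre z' hz')).trans (le_of_eq ?_)
    rw [← mul_sub, norm_mul, norm_mul, Complex.norm_I, one_mul, Complex.norm_real,
      Real.norm_of_nonneg ht.le, mul_comm]
  have h2 : ‖Complex.exp (Complex.I * t * z) - Complex.exp (Complex.I * t * z')‖ ≤ 2 := by
    refine (norm_sub_le _ _).trans ?_
    linarith [norm_exp_I_mul_le_one ht.le hz, norm_exp_I_mul_le_one ht.le hz']
  rw [mul_assoc 2, ← Real.mul_rpow (norm_nonneg _) ht.le]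
  -- The elementary fact used is `min(x, 2) ≤ 2 x^γ` for `0 ≤ γ ≤ 1`.
  set x := ‖z - z'‖ * t
  have hx : 0 ≤ x := by positivity
  rcases le_total x 1 with hx1 | hx1
  · have : x ≤ x ^ γ := by
      rcases hx.eq_or_lt with h0 | h0
      · rw [← h0]; positivity
      · simpa using Real.rpow_le_rpow_of_exponent_ge h0 hx1 hγ1
    have h0 : 0 ≤ x ^ γ := by positivity
    linarith
  · have : 1 ≤ x ^ γ := Real.one_le_rpow hx1 hγ
    linarith

theorem norm_setIntegral_le_of_lintegral_le {f : ℝ → ℂ} {g : ℝ → ℝ} {c : ℝ} (hc : 0 ≤ c)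
    (hfg : ∀ t ∈ Ioi (0 : ℝ), ‖f t‖ ≤ g t)
    (hg : ∫⁻ t in Ioi (0 : ℝ), ENNReal.ofReal (g t) ≤ ENNReal.ofReal c) :
    ‖∫ t in Ioi (0 : ℝ), f t‖ ≤ c := by
  have h1 : ‖∫ t in Ioi (0 : ℝ), f t‖ₑ ≤ ∫⁻ t in Ioi (0 : ℝ), ‖f t‖ₑ :=
    enorm_integral_le_lintegral_enorm _
  have h2 : ∫⁻ t in Ioi (0 : ℝ), ‖f t‖ₑ ≤ ∫⁻ t in Ioi (0 : ℝ), ENNReal.ofReal (g t) := by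
    refine setLIntegral_mono' measurableSet_Ioi fun t ht => ?_
    rw [← ofReal_norm]
    exact ENNReal.ofReal_le_ofReal (hfg t ht)
  have h3 := (h1.trans h2).trans hg
  rwa [← ofReal_norm, ENNReal.ofReal_le_ofReal_iff hc] at h3

theorem prod_besselMoment_rpow_le {d : ℕ} {γ : ℝ} {h : ℤ → ℝ} (h0 : ∀ m, 0 ≤ h m)
    (hM : ∀ m, besselMoment d m γ ≤ ENNReal.ofReal (h m)) (n : Zd d) :
    ∏ j, besselMoment d (n j) γ ^ (1 / (d : ℝ)) ≤
      ENNReal.ofReal (∏ j, h (n j) ^ (1 / (d : ℝ))) := by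
  rw [ENNReal.ofReal_prod_of_nonneg fun j _ => Real.rpow_nonneg (h0 _) _]
  refine Finset.prod_le_prod' fun j _ => ?_
  rw [← ENNReal.ofReal_rpow_of_nonneg (h0 _) (by positivity)]
  exact ENNReal.rpow_le_rpow (hM _) (by positivity)

theorem norm_greenKernel_le {d : ℕ} (hd : d ≠ 0) {h : ℤ → ℝ} (h0 : ∀ m, 0 ≤ h m)
    (hM : ∀ m, besselMoment d m 0 ≤ ENNReal.ofReal (h m)) {z : ℂ} (hz : 0 ≤ z.im) (n : Zd d) :
    ‖greenKernel z n‖ ≤ ∏ j, h (n j) ^ (1 / (d : ℝ)) := by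
  rw [greenKernel, norm_mul, Complex.norm_I, one_mul]
  refine norm_setIntegral_le_of_lintegral_le
    (Finset.prod_nonneg fun j _ => Real.rpow_nonneg (h0 _) _)
    (g := fun t => t ^ (0 : ℝ) * ‖evolutionKernel t n‖) (fun t ht => ?_)
    ((lintegral_evolutionKernel_le hd n 0).trans (prod_besselMoment_rpow_le h0 hM n))
  rw [norm_mul, Real.rpow_zero]
  exact mul_le_mul_of_nonneg_right (norm_exp_I_mul_le_one (le_of_lt ht) hz) (norm_nonneg _)

theorem continuous_exp_mul_evolutionKernel {d : ℕ} (z : ℂ) (n : Zd d) :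
    Continuous fun t : ℝ => Complex.exp (Complex.I * t * z) * evolutionKernel t n := by
  have := continuous_evolutionKernel n
  fun_prop

theorem integrableOn_evolutionKernel {d : ℕ} (hd : d ≠ 0)
    (hM : ∀ m, besselMoment d m 0 ≠ ∞) (n : Zd d) :
    IntegrableOn (fun t : ℝ => evolutionKernel t n) (Ioi 0) := by
  refine ⟨(continuous_evolutionKernel n).aestronglyMeasurable, ?_⟩
  have h := lintegral_evolutionKernel_le hd n 0
  simp only [Real.rpow_zero, one_mul, ofReal_norm] at h
  refine lt_of_le_of_lt h ?_
  refine ENNReal.prod_lt_top fun j _ => ?_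
  exact ENNReal.rpow_lt_top_of_nonneg (by positivity) (hM _)

theorem integrableOn_exp_mul_evolutionKernel {d : ℕ} (hd : d ≠ 0)
    (hM : ∀ m, besselMoment d m 0 ≠ ∞) {z : ℂ} (hz : 0 ≤ z.im) (n : Zd d) :
    IntegrableOn (fun t : ℝ => Complex.exp (Complex.I * t * z) * evolutionKernel t n) (Ioi 0) := by
  refine Integrable.mono (integrableOn_evolutionKernel hd hM n)
    (continuous_exp_mul_evolutionKernel z n).aestronglyMeasurable ?_
  refine (ae_restrict_iff' measurableSet_Ioi).mpr (Eventually.of_forall fun t ht => ?_)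
  rw [norm_mul]
  exact mul_le_of_le_one_left (norm_nonneg _) (norm_exp_I_mul_le_one (le_of_lt ht) hz)

theorem norm_greenKernel_sub_le {d : ℕ} (hd : d ≠ 0) (hM0 : ∀ m, besselMoment d m 0 ≠ ∞) {γ : ℝ}
    (hγ : 0 ≤ γ) (hγ1 : γ ≤ 1) {h : ℤ → ℝ} (h0 : ∀ m, 0 ≤ h m)
    (hM : ∀ m, besselMoment d m γ ≤ ENNReal.ofReal (h m)) {z z' : ℂ} (hz : 0 ≤ z.im)
    (hz' : 0 ≤ z'.im) (n : Zd d) :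
    ‖greenKernel z n - greenKernel z' n‖ ≤
      2 * ‖z - z'‖ ^ γ * ∏ j, h (n j) ^ (1 / (d : ℝ)) := by
  have hp0 : 0 ≤ ∏ j, h (n j) ^ (1 / (d : ℝ)) :=
    Finset.prod_nonneg fun j _ => Real.rpow_nonneg (h0 _) _
  rw [greenKernel, greenKernel, ← mul_sub, norm_mul, Complex.norm_I, one_mul,
    ← integral_sub (integrableOn_exp_mul_evolutionKernel hd hM0 hz n)
      (integrableOn_exp_mul_evolutionKernel hd hM0 hz' n)]
  refine norm_setIntegral_le_of_lintegral_le (by positivity)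
    (g := fun t => 2 * ‖z - z'‖ ^ γ * (t ^ γ * ‖evolutionKernel t n‖)) (fun t ht => ?_) ?_
  · rw [← sub_mul, norm_mul, ← mul_assoc]
    exact mul_le_mul_of_nonneg_right (norm_exp_I_mul_sub_le ht hz hz' hγ hγ1) (norm_nonneg _)
  · rw [setLIntegral_ofReal_const_mul _ (by positivity),
      ENNReal.ofReal_mul (p := 2 * ‖z - z'‖ ^ γ) (by positivity)]
    refine mul_le_mul_right ?_ _
    exact (lintegral_evolutionKernel_le hd n γ).trans (prod_besselMoment_rpow_le h0 hM n)

theorem continuousOn_greenKernel {d : ℕ} (hd : d ≠ 0) (hM : ∀ m, besselMoment d m 0 ≠ ∞)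
    (n : Zd d) : ContinuousOn (fun z => greenKernel z n) {z : ℂ | 0 ≤ z.im} := by
  refine ContinuousOn.mul continuousOn_const ?_
  intro z hz
  refine tendsto_integral_filter_of_dominated_convergence (fun t => ‖evolutionKernel t n‖)
    (Eventually.of_forall fun w => (continuous_exp_mul_evolutionKernel w n).aestronglyMeasurable)
    ?_ (integrableOn_evolutionKernel hd hM n).norm ?_
  · filter_upwards [self_mem_nhdsWithin] with w hw
    refine (ae_restrict_iff' measurableSet_Ioi).mpr (Eventually.of_forall fun t ht => ?_)
    rw [norm_mul]
    exact mul_le_of_le_one_left (norm_nonneg _) (norm_exp_I_mul_le_one (le_of_lt ht) hw)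
  · refine Eventually.of_forall fun t => ?_
    have : Continuous fun w : ℂ => Complex.exp (Complex.I * t * w) * evolutionKernel t n := by
      fun_prop
    exact this.continuousAt.continuousWithinAt

/-- Integrate `∂ₜ(e^{itz} E) = i(z - Δ)(e^{itz} E)` over `(0, ∞)`, where `E` is the evolution
kernel: the boundary term at infinity vanishes because `Im z > 0`, and the one at `0` is the delta
function. -/
theorem laplacian_greenKernel {d : ℕ} (hd : d ≠ 0) (hM : ∀ m, besselMoment d m 0 ≠ ∞) {z : ℂ}
    (hz : 0 < z.im) (n : Zd d) :
    (1 / 2 : ℂ) * ∑ j : Fin d, (greenKernel z (n + Pi.single j 1) +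
      greenKernel z (n - Pi.single j 1)) - z * greenKernel z n = if n = 0 then 1 else 0 := by
  obtain ⟨E, hE⟩ : ∃ E : Zd d → ℝ → ℂ,
      ∀ n t, E n t = Complex.exp (Complex.I * t * z) * evolutionKernel t n :=
    ⟨_, fun _ _ => rfl⟩
  have hEn : ∀ n, E n = fun t : ℝ => Complex.exp (Complex.I * t * z) * evolutionKernel t n :=
    fun n => funext (hE n)
  have hEint : ∀ n, IntegrableOn (E n) (Ioi 0) := fun n => by
    rw [hEn]
    exact integrableOn_exp_mul_evolutionKernel hd hM hz.le n
  have hgreen : ∀ n, greenKernel z n = Complex.I * ∫ t in Ioi (0 : ℝ), E n t := fun n => by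
    rw [hEn, greenKernel]
  set E' : ℝ → ℂ := fun t => Complex.I * (z * E n t) - Complex.I * ((1 / 2 : ℂ) *
    ∑ j : Fin d, (E (n + Pi.single j 1) t + E (n - Pi.single j 1) t)) with hE'
  have hder : ∀ t, HasDerivAt (E n) (E' t) t := by
    intro t
    have h1 : HasDerivAt (fun t : ℝ => Complex.exp (Complex.I * t * z))
        (Complex.exp (Complex.I * t * z) * (Complex.I * 1 * z)) t :=
      (((hasDerivAt_id t).ofReal_comp.const_mul Complex.I).mul_const z).cexp
    rw [hEn n]
    refine (h1.mul (hasDerivAt_evolutionKernel n t)).congr_deriv ?_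
    simp only [hE', hE, ← mul_add, ← Finset.mul_sum]
    ring
  have hj : ∀ j : Fin d, IntegrableOn (fun t => E (n + Pi.single j 1) t +
      E (n - Pi.single j 1) t) (Ioi 0) := fun j => (hEint _).add (hEint _)
  have hsumint : IntegrableOn (fun t => ∑ j : Fin d, (E (n + Pi.single j 1) t +
      E (n - Pi.single j 1) t)) (Ioi 0) :=
    integrable_finsetSum _ fun j _ => hj j
  have hI1 : IntegrableOn (fun t => Complex.I * (z * E n t)) (Ioi 0) :=
    ((hEint n).const_mul z).const_mul Complex.I
  have hI2 : IntegrableOn (fun t => Complex.I * ((1 / 2 : ℂ) *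
    ∑ j : Fin d, (E (n + Pi.single j 1) t + E (n - Pi.single j 1) t))) (Ioi 0) :=
    (hsumint.const_mul _).const_mul _
  have hlim : Tendsto (E n) atTop (𝓝 0) := by
    have h1 : Tendsto (fun t : ℝ => Real.exp (-(z.im * t))) atTop (𝓝 0) :=
      Real.tendsto_exp_neg_atTop_nhds_zero.comp (tendsto_id.const_mul_atTop hz)
    refine squeeze_zero_norm (fun t => ?_) h1
    rw [hE, norm_mul, norm_exp_I_mul]
    exact mul_le_of_le_one_right (Real.exp_pos _).le (norm_evolutionKernel_le_one t n)
  have hFTC := integral_Ioi_of_hasDerivAt_of_tendsto' (fun t _ => hder t) (hI1.sub hI2) hlim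
  have hsplit : ∫ t in Ioi (0 : ℝ), E' t = Complex.I * (z * ∫ t in Ioi (0 : ℝ), E n t) -
      Complex.I * ((1 / 2 : ℂ) * ∑ j : Fin d, ((∫ t in Ioi (0 : ℝ), E (n + Pi.single j 1) t) +
        ∫ t in Ioi (0 : ℝ), E (n - Pi.single j 1) t)) := by
    rw [hE', integral_sub hI1 hI2, integral_const_mul, integral_const_mul, integral_const_mul,
      integral_const_mul, integral_finsetSum _ fun j _ => hj j]
    congr 3
    refine Finset.sum_congr rfl fun j _ => ?_
    exact integral_add (hEint _) (hEint _)
  rw [hsplit] at hFTC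
  have hE0 : E n 0 = if n = 0 then 1 else 0 := by
    simp [hE, evolutionKernel_zero_left]
  simp only [hgreen, ← mul_add, ← Finset.mul_sum]
  rw [← hE0]
  linear_combination -hFTC

/-- Cauchy-Schwarz for the weight `e^{-t Im z} dt`, of total mass `1/Im z`, followed by the bound
`1` for the `ℓ²` norm of the evolution kernel. It places the kernel in `ℓ²`, where the resolvent
equation has only one solution. -/
theorem sum_sq_norm_greenKernel_le {d : ℕ} {z : ℂ} (hz : 0 < z.im) (s : Finset (Zd d)) :
    ∑ n ∈ s, ‖greenKernel z n‖ ^ 2 ≤ 1 / z.im ^ 2 := by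
  set η := z.im
  have hw : IntegrableOn (fun t : ℝ => Real.exp (-η * t)) (Ioi 0) :=
    integrableOn_exp_mul_Ioi (by linarith) 0
  have hw1 : ∫ t in Ioi (0 : ℝ), Real.exp (-η * t) = 1 / η := by
    rw [integral_exp_mul_Ioi (by linarith) 0]
    simp
  have hwi : ∀ (n : Zd d) (k : ℕ),
      IntegrableOn (fun t : ℝ => Real.exp (-η * t) * ‖evolutionKernel t n‖ ^ k) (Ioi 0) := by
    intro n k
    have hc := continuous_evolutionKernel n
    refine Integrable.mono hw (Continuous.aestronglyMeasurable (by fun_prop)) ?_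
    refine Eventually.of_forall fun t => ?_
    rw [norm_mul, norm_pow, norm_norm]
    exact mul_le_of_le_one_right (norm_nonneg _)
      (pow_le_one₀ (norm_nonneg _) (norm_evolutionKernel_le_one t n))
  have hcs : ∀ n : Zd d, ‖greenKernel z n‖ ^ 2 ≤
      1 / η * ∫ t in Ioi (0 : ℝ), Real.exp (-η * t) * ‖evolutionKernel t n‖ ^ 2 := by
    intro n
    set m := ∫ t in Ioi (0 : ℝ), Real.exp (-η * t) * ‖evolutionKernel t n‖ ^ 1 with hm
    have h1 : ‖greenKernel z n‖ ≤ m := by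
      rw [greenKernel, norm_mul, Complex.norm_I, one_mul]
      refine (norm_integral_le_integral_norm _).trans (le_of_eq ?_)
      refine setIntegral_congr_fun measurableSet_Ioi fun t _ => ?_
      simp only [norm_mul, norm_exp_I_mul, pow_one, neg_mul, η]
    -- Cauchy-Schwarz in the form of a nonnegative variance: `ηm` is the mean of the kernel's
    -- modulus for the probability weight `η e^{-ηt} dt`.
    have h2 : 0 ≤ ∫ t in Ioi (0 : ℝ),
        (Real.exp (-η * t) * ‖evolutionKernel t n‖ ^ 2 -
          2 * (η * m) * (Real.exp (-η * t) * ‖evolutionKernel t n‖ ^ 1) +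
          (η * m) ^ 2 * Real.exp (-η * t)) := by
      refine integral_nonneg fun t => ?_
      have : Real.exp (-η * t) * ‖evolutionKernel t n‖ ^ 2 -
          2 * (η * m) * (Real.exp (-η * t) * ‖evolutionKernel t n‖ ^ 1) +
          (η * m) ^ 2 * Real.exp (-η * t) =
          Real.exp (-η * t) * (‖evolutionKernel t n‖ - η * m) ^ 2 := by ring
      simp only [this]
      positivity
    have hA : IntegrableOn (fun t : ℝ => Real.exp (-η * t) * ‖evolutionKernel t n‖ ^ 2 -
        2 * (η * m) * (Real.exp (-η * t) * ‖evolutionKernel t n‖ ^ 1)) (Ioi 0) :=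
      (hwi n 2).sub ((hwi n 1).const_mul _)
    rw [integral_add hA (hw.const_mul _),
      integral_sub (hwi n 2) ((hwi n 1).const_mul _), integral_const_mul, integral_const_mul,
      ← hm, hw1] at h2
    have h3 : η * m ^ 2 ≤ ∫ t in Ioi (0 : ℝ), Real.exp (-η * t) * ‖evolutionKernel t n‖ ^ 2 := by
      have : (η * m) ^ 2 * (1 / η) = η * m ^ 2 := by field_simp
      rw [this] at h2
      linarith
    rw [one_div, ← div_eq_inv_mul, le_div_iff₀ hz]
    have h4 := pow_le_pow_left₀ (norm_nonneg _) h1 2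
    have h5 := mul_le_mul_of_nonneg_right h4 hz.le
    linarith
  refine (Finset.sum_le_sum fun n _ => hcs n).trans ?_
  rw [← Finset.mul_sum, ← integral_finsetSum _ fun n _ => hwi n 2]
  have h6 : ∫ t in Ioi (0 : ℝ), ∑ n ∈ s, Real.exp (-η * t) * ‖evolutionKernel t n‖ ^ 2 ≤
      1 / η := by
    rw [← hw1]
    refine integral_mono (integrable_finsetSum _ fun n _ => hwi n 2) hw fun t => ?_
    simp only
    rw [← Finset.mul_sum]
    exact mul_le_of_le_one_right (Real.exp_pos _).le (sum_sq_norm_evolutionKernel_le_one t s)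
  calc _ ≤ 1 / η * (1 / η) := mul_le_mul_of_nonneg_left h6 (by positivity)
    _ = _ := by ring

theorem memℓp_greenKernel {d : ℕ} {z : ℂ} (hz : 0 < z.im) :
    Memℓp (fun n : Zd d => greenKernel z n) 2 := by
  refine memℓp_gen (summable_of_sum_le (fun _ => by positivity) (c := 1 / z.im ^ 2) fun s => ?_)
  simpa using sum_sq_norm_greenKernel_le hz s

/-! ### Identification with the resolvent -/

/-- The resolvent applied to the delta function at the origin. -/
def resolventDelta (d : ℕ) (z : ℂ) : L2 (Zd d) :=
  Ring.inverse (laplacian d - algebraMap ℂ (L2 (Zd d) →L[ℂ] L2 (Zd d)) z)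
    (lp.single 2 0 (1 : ℂ))

theorem inverse_apply_eq {d : ℕ} {z : ℂ} (hz : z ∈ cutPlane d) {f g : L2 (Zd d)}
    (hf : laplacian d f - z • f = g) :
    Ring.inverse (laplacian d - algebraMap ℂ (L2 (Zd d) →L[ℂ] L2 (Zd d)) z) g = f := by
  have h := Ring.inverse_mul_cancel _ (isUnit_laplacian_sub hz)
  have h2 : (laplacian d - algebraMap ℂ (L2 (Zd d) →L[ℂ] L2 (Zd d)) z) f = g := by
    rw [← hf, sub_apply, Algebra.algebraMap_eq_smul_one]
    rfl
  rw [← h2, ← mul_apply_eq_comp, h]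
  rfl

theorem laplacian_resolvent_apply {d : ℕ} {z : ℂ} (hz : z ∈ cutPlane d) (g : L2 (Zd d)) :
    laplacian d (Ring.inverse (laplacian d - algebraMap ℂ (L2 (Zd d) →L[ℂ] L2 (Zd d)) z) g) -
      z • Ring.inverse (laplacian d - algebraMap ℂ (L2 (Zd d) →L[ℂ] L2 (Zd d)) z) g = g := by
  have h := Ring.mul_inverse_cancel _ (isUnit_laplacian_sub hz)
  have h2 := congrArg (fun A : L2 (Zd d) →L[ℂ] L2 (Zd d) => A g) h
  simp only [mul_apply_eq_comp, sub_apply, Algebra.algebraMap_eq_smul_one] at h2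
  exact h2

theorem laplacian_shift {d : ℕ} (a : Zd d) (f : L2 (Zd d)) :
    laplacian d (shift a f) = shift a (laplacian d f) := by
  apply lp.ext
  funext n
  have h1 : (shift a (laplacian d f)) n = laplacian d f (n + a) := rfl
  rw [h1, laplacian_apply, laplacian_apply]
  congr 1
  refine Finset.sum_congr rfl fun j _ => ?_
  have h2 : ∀ m, shift a f m = f (m + a) := fun m => rfl
  rw [h2, h2, add_right_comm, sub_add_eq_add_sub]

theorem shift_single {d : ℕ} (m : Zd d) :
    shift (-m) (lp.single 2 0 (1 : ℂ)) = lp.single 2 m (1 : ℂ) := by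
  apply lp.ext
  funext n
  have h : shift (-m) (lp.single 2 (0 : Zd d) (1 : ℂ)) n =
    lp.single (E := fun _ : Zd d => ℂ) 2 0 (1 : ℂ) (n + -m) := rfl
  rw [h, lp.coeFn_single, lp.coeFn_single, Pi.single_apply, Pi.single_apply]
  simp only [← sub_eq_add_neg, sub_eq_zero]

/-- The Laplacian commutes with translations, so one column determines the resolvent as a
convolution. -/
theorem resolvent_single_apply {d : ℕ} {z : ℂ} (hz : z ∈ cutPlane d) (n m : Zd d) :
    Ring.inverse (laplacian d - algebraMap ℂ (L2 (Zd d) →L[ℂ] L2 (Zd d)) z)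
      (lp.single 2 m (1 : ℂ)) n = resolventDelta d z (n - m) := by
  have h : Ring.inverse (laplacian d - algebraMap ℂ (L2 (Zd d) →L[ℂ] L2 (Zd d)) z)
      (lp.single 2 m (1 : ℂ)) = shift (-m) (resolventDelta d z) := by
    refine inverse_apply_eq hz ?_
    rw [laplacian_shift, ← map_smul, ← map_sub, resolventDelta, laplacian_resolvent_apply hz,
      shift_single]
  rw [h]
  change resolventDelta d z (n + -m) = _
  rw [sub_eq_add_neg]

theorem resolventDelta_eq_of_laplacian {d : ℕ} {z : ℂ} (hz : z ∈ cutPlane d) {K : Zd d → ℂ}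
    (hK2 : Memℓp K 2)
    (hK : ∀ n, (1 / 2 : ℂ) * ∑ j : Fin d, (K (n + Pi.single j 1) + K (n - Pi.single j 1)) -
      z * K n = if n = 0 then 1 else 0) (n : Zd d) : resolventDelta d z n = K n := by
  have h := inverse_apply_eq hz (f := (⟨K, hK2⟩ : L2 (Zd d))) (g := lp.single 2 0 (1 : ℂ)) (by
    apply lp.ext
    funext n
    rw [lp.coeFn_sub, Pi.sub_apply, lp.coeFn_smul, Pi.smul_apply, laplacian_apply, lp.coeFn_single,
      Pi.single_apply]
    exact hK n)
  rw [resolventDelta, h]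

theorem analyticAt_resolventDelta {d : ℕ} {z : ℂ} (hz : z ∈ cutPlane d) :
    AnalyticAt ℂ (resolventDelta d) z := by
  have h1 : AnalyticAt ℂ (fun w : ℂ => laplacian d -
      algebraMap ℂ (L2 (Zd d) →L[ℂ] L2 (Zd d)) w) z :=
    analyticAt_const.sub
      ((Algebra.linearMap ℂ (L2 (Zd d) →L[ℂ] L2 (Zd d))).toContinuousLinearMap.analyticAt z)
  obtain ⟨x, hx⟩ := isUnit_laplacian_sub hz
  have h2 : AnalyticAt ℂ Ring.inverse (laplacian d -
      algebraMap ℂ (L2 (Zd d) →L[ℂ] L2 (Zd d)) z) := by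
    rw [← hx]
    exact analyticAt_inverse x
  have h3 : AnalyticAt ℂ (fun w : ℂ => Ring.inverse (laplacian d -
      algebraMap ℂ (L2 (Zd d) →L[ℂ] L2 (Zd d)) w)) z :=
    AnalyticAt.fun_comp (g := Ring.inverse) (f := fun w : ℂ => laplacian d -
      algebraMap ℂ (L2 (Zd d) →L[ℂ] L2 (Zd d)) w) h2 h1
  exact AnalyticAt.fun_comp
    (g := ContinuousLinearMap.apply ℂ (L2 (Zd d)) (lp.single 2 (0 : Zd d) (1 : ℂ)))
    (f := fun w : ℂ => Ring.inverse (laplacian d -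
      algebraMap ℂ (L2 (Zd d) →L[ℂ] L2 (Zd d)) w))
    (ContinuousLinearMap.analyticAt _ _) h3

theorem mem_cutPlane_of_im_ne_zero {d : ℕ} {z : ℂ} (hz : z.im ≠ 0) : z ∈ cutPlane d := by
  rintro ⟨x, _, rfl⟩
  exact hz (Complex.ofReal_im x)

theorem conj_mem_cutPlane {d : ℕ} {z : ℂ} (hz : z ∈ cutPlane d) :
    starRingEnd ℂ z ∈ cutPlane d := by
  rintro ⟨x, hx, h⟩
  refine hz ⟨x, hx, ?_⟩
  rw [← Complex.conj_conj z, ← h, Complex.conj_ofReal]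

/-- For `Im z > 0` this is uniqueness of the `ℓ²` solution. A real `z` off the spectrum is reached
as a vertical limit, since both sides are continuous up to it. -/
theorem resolventDelta_eq_greenKernel {d : ℕ} (hd : d ≠ 0) (hM : ∀ m, besselMoment d m 0 ≠ ∞)
    {z : ℂ} (hz : z ∈ cutPlane d) (hz0 : 0 ≤ z.im) (n : Zd d) :
    resolventDelta d z n = greenKernel z n := by
  have hpos : ∀ w : ℂ, 0 < w.im → resolventDelta d w n = greenKernel w n := fun w hw =>
    resolventDelta_eq_of_laplacian (mem_cutPlane_of_im_ne_zero hw.ne') (memℓp_greenKernel hw)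
      (laplacian_greenKernel hd hM hw) n
  have hpath : Tendsto (fun ε : ℝ => z + ε * Complex.I) (𝓝[>] 0) (𝓝 z) := by
    have hc : Continuous fun ε : ℝ => z + ε * Complex.I := by fun_prop
    have := hc.tendsto 0
    simp only [Complex.ofReal_zero, zero_mul, add_zero] at this
    exact this.mono_left nhdsWithin_le_nhds
  have him : ∀ ε : ℝ, (z + ε * Complex.I).im = z.im + ε := by intro ε; simp
  have h1 : Tendsto (fun ε : ℝ => resolventDelta d (z + ε * Complex.I) n) (𝓝[>] 0)
      (𝓝 (resolventDelta d z n)) := by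
    have hc : Continuous fun f : L2 (Zd d) => f n := by
      refine (LipschitzWith.of_dist_le_mul (K := 1) fun f g => ?_).continuous
      rw [NNReal.coe_one, one_mul, dist_eq_norm, dist_eq_norm]
      exact lp.norm_apply_le_norm (by norm_num) (f - g) n
    exact (hc.tendsto _).comp ((analyticAt_resolventDelta hz).continuousAt.tendsto.comp hpath)
  have h2 : Tendsto (fun ε : ℝ => greenKernel (z + ε * Complex.I) n) (𝓝[>] 0)
      (𝓝 (greenKernel z n)) := by
    refine ((continuousOn_greenKernel hd hM n) z hz0).tendsto.comp
      (tendsto_nhdsWithin_iff.mpr ⟨hpath, ?_⟩)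
    filter_upwards [self_mem_nhdsWithin] with ε hε
    rw [him]
    exact add_nonneg hz0 (le_of_lt hε)
  refine tendsto_nhds_unique (h1.congr' ?_) h2
  filter_upwards [self_mem_nhdsWithin] with ε hε
  refine hpos _ ?_
  rw [him]
  exact add_pos_of_nonneg_of_pos hz0 hε

/-- The Laplacian has real coefficients, so conjugating the equation for `z` solves that for the
conjugate of `z`. -/
theorem resolventDelta_conj {d : ℕ} {z : ℂ} (hz : z ∈ cutPlane d) (n : Zd d) :
    resolventDelta d (starRingEnd ℂ z) n = starRingEnd ℂ (resolventDelta d z n) := by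
  refine resolventDelta_eq_of_laplacian (conj_mem_cutPlane hz)
    (K := fun n => starRingEnd ℂ (resolventDelta d z n)) ?_ (fun n => ?_) n
  · have h := lp.memℓp (resolventDelta d z)
    refine memℓp_gen ?_
    simpa using h.summable (by norm_num)
  · have h : laplacian d (resolventDelta d z) n - z * resolventDelta d z n =
        if n = 0 then 1 else 0 := by
      have h1 := congrArg (fun f : L2 (Zd d) => f n)
        (laplacian_resolvent_apply hz (lp.single 2 (0 : Zd d) (1 : ℂ)))
      simp only [lp.coeFn_sub, Pi.sub_apply, lp.coeFn_smul, Pi.smul_apply, lp.coeFn_single,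
        Pi.single_apply] at h1
      exact h1
    rw [laplacian_apply] at h
    have h2 := congrArg (starRingEnd ℂ) h
    simp only [map_sub, map_mul, map_sum, map_add, map_div₀, map_one, map_ofNat] at h2
    rw [h2]
    split_ifs <;> simp

end LatticeResolvent

namespace LatticeResolvent

/-! ### Summation of the kernel bounds -/

open Filter Topology

theorem sum_range_add_two_rpow_le {s : ℝ} (hs : 1 < s) (N : ℕ) :
    ∑ k ∈ Finset.range N, ((k : ℝ) + 2) ^ (-s) ≤ 1 / (s - 1) := by
  have hanti : AntitoneOn (fun x : ℝ => x ^ (-s)) (Set.Icc 1 (1 + (N : ℝ))) := by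
    intro x hx y hy hxy
    exact Real.rpow_le_rpow_of_nonpos (by linarith [hx.1]) hxy (by linarith)
  have h := hanti.sum_le_integral
  rw [integral_rpow (Or.inr ⟨by linarith, by
    rw [Set.uIcc_of_le (by simp)]
    exact fun h => absurd h.1 (by norm_num)⟩), Real.one_rpow] at h
  have h2 : ∑ k ∈ Finset.range N, ((k : ℝ) + 2) ^ (-s) =
      ∑ k ∈ Finset.range N, (1 + ((k + 1 : ℕ) : ℝ)) ^ (-s) := by
    refine Finset.sum_congr rfl fun k _ => ?_
    congr 1
    push_cast
    ring
  rw [h2]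
  refine h.trans ?_
  rw [← neg_div_neg_eq]
  have h3 : 0 ≤ (1 + (N : ℝ)) ^ (-s + 1) := by positivity
  refine div_le_div₀ zero_le_one (by linarith) (by linarith) (by linarith)

/-- The indices `0`, `±1` contribute at most `3`, which is the `3` in `Γ(q,d,γ)`; the two tails from
`|m| = 2` on are compared with `∫₁^∞ x^{-s} dx`. -/
theorem sum_int_le {w : ℤ → ℝ} {Y s : ℝ} (hw : ∀ m, 0 ≤ w m) (hY : 0 ≤ Y) (hs : 1 < s)
    (h1 : ∀ m : ℤ, m.natAbs ≤ 1 → w m ≤ 1)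
    (h2 : ∀ m : ℤ, 2 ≤ m.natAbs → w m ≤ Y * (m.natAbs : ℝ) ^ (-s)) (S : Finset ℤ) :
    ∑ m ∈ S, w m ≤ 3 + 2 * (Y / (s - 1)) := by
  have hs0 : 0 < s - 1 := by linarith
  have htail : ∀ (e : ℕ → ℤ), (∀ k, (e k).natAbs = k + 2) → ∀ N,
      ∑ k ∈ Finset.range N, w (e k) ≤ Y / (s - 1) := by
    intro e he N
    calc ∑ k ∈ Finset.range N, w (e k) ≤ ∑ k ∈ Finset.range N, Y * ((k : ℝ) + 2) ^ (-s) := by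
          refine Finset.sum_le_sum fun k _ => ?_
          have := h2 (e k) (by rw [he]; omega)
          rw [he] at this
          push_cast at this
          exact this
      _ ≤ Y * (1 / (s - 1)) := by
          rw [← Finset.mul_sum]
          exact mul_le_mul_of_nonneg_left (sum_range_add_two_rpow_le hs N) hY
      _ = _ := by ring
  have hpos : ∀ N : ℕ, ∑ k ∈ Finset.range N, w (k : ℤ) ≤ 2 + Y / (s - 1) := by
    intro N
    calc ∑ k ∈ Finset.range N, w (k : ℤ) ≤ ∑ k ∈ Finset.range (N + 2), w (k : ℤ) :=
          Finset.sum_le_sum_of_subset_of_nonneg (Finset.range_mono (by omega)) fun _ _ _ => hw _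
      _ = w 0 + w 1 + ∑ k ∈ Finset.range N, w ((k + 2 : ℕ) : ℤ) := by
          rw [Finset.sum_range_succ', Finset.sum_range_succ']
          push_cast
          simp only [add_assoc, one_add_one_eq_two]
          ring
      _ ≤ _ := by
          have := htail (fun k => ((k + 2 : ℕ) : ℤ)) (fun k => Int.natAbs_natCast _) N
          linarith [h1 0 (by simp), h1 1 (by simp)]
  have hneg : ∀ N : ℕ, ∑ k ∈ Finset.range N, w (-((k : ℤ) + 1)) ≤ 1 + Y / (s - 1) := by
    intro N
    calc ∑ k ∈ Finset.range N, w (-((k : ℤ) + 1))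
        ≤ ∑ k ∈ Finset.range (N + 1), w (-((k : ℤ) + 1)) :=
          Finset.sum_le_sum_of_subset_of_nonneg (Finset.range_mono (by omega)) fun _ _ _ => hw _
      _ = w (-1) + ∑ k ∈ Finset.range N, w (-((k : ℤ) + 2)) := by
          rw [Finset.sum_range_succ']
          push_cast
          simp only [add_assoc, one_add_one_eq_two]
          ring
      _ ≤ _ := by
          have := htail (fun k => -((k : ℤ) + 2)) (fun k => by omega) N
          linarith [h1 (-1) (by simp)]
  have hp := summable_of_sum_range_le (fun k : ℕ => hw (k : ℤ)) hpos
  have hn := summable_of_sum_range_le (fun k : ℕ => hw (-((k : ℤ) + 1))) hneg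
  have htot := HasSum.of_nat_of_neg_add_one hp.hasSum hn.hasSum
  refine (sum_le_hasSum S (fun m _ => hw m) htot).trans ?_
  have a1 := Real.tsum_le_of_sum_range_le (fun k : ℕ => hw (k : ℤ)) hpos
  have a2 := Real.tsum_le_of_sum_range_le (fun k : ℕ => hw (-((k : ℤ) + 1))) hneg
  linarith

theorem sum_max_one_rpow_le {β r : ℝ} (hβr : 1 < β * r) (S : Finset ℤ) :
    ∑ m ∈ S, ((max 1 (m.natAbs : ℝ)) ^ (-β)) ^ r ≤ 3 + 2 * (1 / (β * r - 1)) := by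
  refine sum_int_le (fun m => by positivity) zero_le_one hβr (fun m hm => ?_) (fun m hm => ?_) S
  · rw [max_eq_left (by exact_mod_cast hm), Real.one_rpow, Real.one_rpow]
  · have h1 : (1 : ℝ) ≤ m.natAbs := by exact_mod_cast (by omega : 1 ≤ m.natAbs)
    rw [max_eq_right h1, ← Real.rpow_mul (by linarith), one_mul, neg_mul]

/-- The one-dimensional moment bounds match the constants `C_d^γ` and `Γ(q, d, γ)` through a
weight `h` on `ℤ`. -/
theorem exists_moment_weight (d : ℕ) (hd : 3 ≤ d) {q : ℝ} (hq : 2 ≤ q) {γ : ℝ} (hγ : 0 ≤ γ)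
    (hγ1 : γ ≤ 1) (hγm : γ < gammaMax d q) :
    0 ≤ Cconst d γ ∧ 0 ≤ Gconst q d γ ∧ ∃ h : ℤ → ℝ, (∀ m, 0 ≤ h m) ∧
      (∀ m, besselMoment d m γ ≤ ENNReal.ofReal (Cconst d γ / 2 * h m)) ∧
      (q = 2 → ∀ m, h m ≤ Gconst q d γ) ∧
      (q ≠ 2 → ∃ X, 0 ≤ X ∧ Gconst q d γ = X ^ (d * (q - 2) / q) ∧
        ∀ S : Finset ℤ, ∑ m ∈ S, h m ^ (q / (q - 2) / d) ≤ X) := by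
  have hq0 : 0 < q := by linarith
  have hq2 : q ≠ 2 → 0 < q - 2 := fun h => sub_pos.mpr (lt_of_le_of_ne hq (Ne.symm h))
  rcases (by omega : d = 3 ∨ d = 4 ∨ 5 ≤ d) with rfl | rfl | hd5
  · simp only [gammaMax, if_true] at hγm
    have hden : 0 < 12 - (5 + 2 * γ) * q := by
      have := mul_lt_mul_of_pos_right hγm hq0
      rw [sub_mul, div_mul_cancel₀ _ hq0.ne'] at this
      linarith
    have hγ2 : γ < 1 / 2 := by nlinarith
    have hL : 0 < 1 - 2 * γ := by linarith
    have hG : Gconst q 3 γ = if q = 2 then 1 else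
        (3 + 12 * (q - 2) / (12 - (5 + 2 * γ) * q)) ^ (3 * (q - 2) / q) := by
      simp [Gconst]
    have hC : Cconst 3 γ = 8 / (1 - 2 * γ) + 8 := by simp [Cconst]
    refine ⟨by rw [hC]; positivity, ?_, fun m => (max 1 (m.natAbs : ℝ)) ^ (-(1 / 2 - γ)),
      fun m => by positivity, fun m => ?_, fun h m => ?_, fun h => ?_⟩
    · rw [hG]
      split_ifs with h
      · exact zero_le_one
      · have := hq2 h
        positivity
    · rw [← besselMoment_natAbs, hC]
      refine (besselMoment_three_le _ hγ hγ2).trans (ENNReal.ofReal_le_ofReal (le_of_eq ?_))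
      rw [neg_sub]
      ring
    · rw [hG, if_pos h]
      exact Real.rpow_le_one_of_one_le_of_nonpos (le_max_left _ _) (by linarith)
    · have hp := hq2 h
      -- This positive quantity is the excess of the decay exponent over summability; `2` divided by
      -- it is the fraction in `Γ(q,3,γ)`.
      have hid : (1 / 2 - γ) * (q / (q - 2) / (3 : ℕ)) - 1 =
          (12 - (5 + 2 * γ) * q) / (6 * (q - 2)) := by
        push_cast
        field_simp
        ring
      refine ⟨3 + 12 * (q - 2) / (12 - (5 + 2 * γ) * q), by positivity, ?_, fun S => ?_⟩
      · rw [hG, if_neg h]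
        norm_num
      · have hs : 0 < (1 / 2 - γ) * (q / (q - 2) / (3 : ℕ)) - 1 := by
          rw [hid]; positivity
        refine (sum_max_one_rpow_le (by linarith) S).trans (le_of_eq ?_)
        rw [hid]
        field_simp
        norm_num
  · simp only [gammaMax, show ¬((4 : ℕ) = 3) by norm_num, if_false] at hγm
    push_cast at hγm
    have hden : 0 < 8 - (3 + γ) * q := by
      have := mul_lt_mul_of_pos_right hγm hq0
      rw [sub_mul, div_mul_cancel₀ _ hq0.ne'] at this
      linarith
    have hγ2 : γ < 1 := by nlinarith
    have hL : 0 < 1 - γ := by linarith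
    have hG : Gconst q 4 γ = if q = 2 then (1 - γ)⁻¹ else
        (3 + 2 * ((5 * q - 2) / (8 - (3 + γ) * q)) ^ (1 + q / (4 * (q - 2)))) ^
          (4 * (q - 2) / q) := by
      simp [Gconst]
    have hC : Cconst 4 γ = 4 / (1 - γ) := by simp [Cconst]
    have hC2 : Cconst 4 γ / 2 = 2 / (1 - γ) := by rw [hC]; ring
    refine ⟨by rw [hC]; positivity, ?_, ?_⟩
    · rw [hG]
      split_ifs with h
      · positivity
      · have h1 : 0 ≤ 5 * q - 2 := by linarith
        positivity
    rw [hC2]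
    have hmom : ∀ (m : ℤ) (x : ℝ), (max 1 (m.natAbs : ℝ)) ^ (γ - 1) *
        (1 + Real.log (max 1 (m.natAbs : ℝ)) / 4) ≤ x →
        besselMoment 4 m γ ≤ ENNReal.ofReal (2 / (1 - γ) * x) := by
      intro m x hx
      rw [← besselMoment_natAbs]
      refine (besselMoment_four_le _ hγ hγ2).trans (ENNReal.ofReal_le_ofReal ?_)
      exact mul_le_mul_of_nonneg_left hx (by positivity)
    have hexp : ∀ (y ε : ℝ), 1 ≤ y → 1 + ε * Real.log y ≤ y ^ ε := by
      intro y ε hy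
      rw [Real.rpow_def_of_pos (by linarith)]
      have := Real.add_one_le_exp (Real.log y * ε)
      linarith
    by_cases h : q = 2
    -- For `q = 2` only a supremum is needed, and `y^{1-γ} ≥ 1 + (1-γ) log y` dominates `(1-γ)(1 +
    -- (log y)/4)`.
    · refine ⟨fun _ => (1 - γ)⁻¹, fun m => by positivity, fun m => hmom m _ ?_,
        fun _ m => ?_, fun h' => absurd h h'⟩
      · set y := max 1 (m.natAbs : ℝ)
        have hy : 1 ≤ y := le_max_left _ _
        have hlog := Real.log_nonneg hy
        have h1 := hexp y (1 - γ) hy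
        have h2 : y ^ (γ - 1) = (y ^ (1 - γ))⁻¹ := by
          rw [← Real.rpow_neg (by linarith), neg_sub]
        have h3 : 0 < y ^ (1 - γ) := Real.rpow_pos_of_pos (by linarith) _
        rw [h2, ← div_eq_inv_mul, ← one_div, div_le_div_iff₀ h3 hL]
        nlinarith [mul_nonneg hL.le hlog]
      · rw [hG, if_pos h]
    · have hp := hq2 h
      -- The logarithm is absorbed in a small power: `X y^{1/X} ≥ X + log y ≥ 1 + (log y)/4`. The
      -- loss `1/X` in the exponent must leave the sum convergent with a margin, as checked in `hs`.
      set X := (5 * q - 2) / (8 - (3 + γ) * q) with hX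
      have hX1 : 1 ≤ X := by
        rw [hX, le_div_iff₀ hden]
        nlinarith
      have hX0 : 0 < X := by linarith
      have hr : (0 : ℝ) < q / (q - 2) / (4 : ℕ) := by positivity
      have hr' : q / (q - 2) / (4 : ℕ) = q / (4 * (q - 2)) := by
        push_cast
        field_simp
      refine ⟨fun m => if m.natAbs ≤ 1 then 1 else X * (m.natAbs : ℝ) ^ (1 / X - (1 - γ)),
        fun m => ?_, fun m => hmom m _ ?_, fun h' => absurd h' h, fun _ =>
        ⟨3 + 2 * X ^ (1 + q / (4 * (q - 2))), by positivity, ?_, fun S => ?_⟩⟩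
      · beta_reduce
        split_ifs
        · exact zero_le_one
        · positivity
      · beta_reduce
        split_ifs with hm
        · rw [max_eq_left (by exact_mod_cast hm)]
          simp
        · have hy : (1 : ℝ) ≤ m.natAbs := by exact_mod_cast (by omega : 1 ≤ m.natAbs)
          rw [max_eq_right hy]
          set y := (m.natAbs : ℝ)
          have hlog := Real.log_nonneg hy
          have h1 := hexp y (1 / X) hy
          rw [show 1 / X - (1 - γ) = 1 / X + (γ - 1) by ring, Real.rpow_add (by linarith : 0 < y),
            ← mul_assoc, mul_comm]
          refine mul_le_mul_of_nonneg_right ?_ (by positivity)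
          have h2 := mul_le_mul_of_nonneg_left h1 hX0.le
          have h3 : X * (1 + 1 / X * Real.log y) = X + Real.log y := by field_simp
          linarith
      · rw [hG, if_neg h]
        norm_num
      -- With `r = q/(4(q-2))` the margin is at least `1/X`, so the tail `X^r/(s-1)` is at most
      -- `X^{1+r}`, the power in `Γ(q,4,γ)`.
      · have hs : 1 / X ≤ (1 - γ - 1 / X) * (q / (q - 2) / (4 : ℕ)) - 1 := by
          have h5 : 0 < 5 * q - 2 := by linarith
          have e1 : (1 - γ - 1 / X) * (q / (q - 2) / (4 : ℕ)) - 1 - 1 / X =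
              (8 - (3 + γ) * q) * 6 / (4 * (q - 2) * (5 * q - 2)) := by
            rw [hX]
            push_cast
            field_simp
            ring
          have : 0 ≤ (8 - (3 + γ) * q) * 6 / (4 * (q - 2) * (5 * q - 2)) := by positivity
          linarith
        have hX' : 0 < 1 / X := by positivity
        have hsum := sum_int_le (w := fun m : ℤ => (if m.natAbs ≤ 1 then (1 : ℝ) else
            X * (m.natAbs : ℝ) ^ (1 / X - (1 - γ))) ^ (q / (q - 2) / (4 : ℕ)))
          (Y := X ^ (q / (q - 2) / (4 : ℕ)))
          (s := (1 - γ - 1 / X) * (q / (q - 2) / (4 : ℕ)))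
          (fun m => by
            refine Real.rpow_nonneg ?_ _
            split_ifs
            · exact zero_le_one
            · positivity) (by positivity) (by linarith)
          (fun m hm => by simp only [hm, if_true, Real.one_rpow, le_refl])
          (fun m hm => by
            have hm' : ¬ m.natAbs ≤ 1 := by omega
            simp only [hm', if_false]
            rw [Real.mul_rpow hX0.le (by positivity), ← Real.rpow_mul (by positivity)]
            refine le_of_eq ?_
            congr 2
            ring) S
        refine hsum.trans ?_
        have h6 : X ^ (q / (q - 2) / (4 : ℕ)) /
            ((1 - γ - 1 / X) * (q / (q - 2) / (4 : ℕ)) - 1) ≤ X ^ (1 + q / (4 * (q - 2))) := by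
          rw [Real.rpow_add hX0, Real.rpow_one, hr', mul_comm X]
          rw [hr'] at hs
          refine (div_le_div_of_nonneg_left (by positivity) hX' hs).trans (le_of_eq ?_)
          field_simp
        linarith
  · have hd3 : d ≠ 3 := by omega
    have hd4 : d ≠ 4 := by omega
    have hdr : (5 : ℝ) ≤ d := by exact_mod_cast hd5
    have hd40 : (0 : ℝ) < d - 4 := by linarith
    simp only [gammaMax, hd3, if_false] at hγm
    have hden : 0 < 6 * d - (2 * d + 1 + 3 * γ) * q := by
      have := mul_lt_mul_of_pos_right hγm hq0
      rw [sub_mul, div_mul_cancel₀ _ hq0.ne'] at this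
      linarith
    have hG : Gconst q d γ = if q = 2 then 1 else
        (3 + 6 * d * (q - 2) / (6 * d - (2 * d + 1 + 3 * γ) * q)) ^ (d * (q - 2) / q) := by
      simp [Gconst, hd3, hd4]
    have hC : Cconst d γ = 14 * (2 : ℝ) ^ ((d : ℝ) / 4) / (d - 4) := by simp [Cconst, hd3, hd4]
    refine ⟨by rw [hC]; positivity, ?_,
      fun m => (max 1 (m.natAbs : ℝ)) ^ (-(((d : ℝ) - 1) / 3 - γ)),
      fun m => by positivity, fun m => ?_, fun h m => ?_, fun h => ?_⟩
    · rw [hG]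
      split_ifs with h
      · exact zero_le_one
      · have := hq2 h
        positivity
    · rw [← besselMoment_natAbs, hC]
      refine (besselMoment_le_of_five_le d _ hd5 hγ hγ1).trans
        (ENNReal.ofReal_le_ofReal (le_of_eq ?_))
      rw [neg_sub]
      ring
    · rw [hG, if_pos h]
      exact Real.rpow_le_one_of_one_le_of_nonpos (le_max_left _ _) (by linarith)
    · have hp := hq2 h
      have hid : (((d : ℝ) - 1) / 3 - γ) * (q / (q - 2) / d) - 1 =
          (6 * d - (2 * d + 1 + 3 * γ) * q) / (3 * d * (q - 2)) := by
        field_simp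
        ring
      refine ⟨3 + 6 * d * (q - 2) / (6 * d - (2 * d + 1 + 3 * γ) * q), by positivity, ?_,
        fun S => ?_⟩
      · rw [hG, if_neg h]
      · have hs : 0 < (((d : ℝ) - 1) / 3 - γ) * (q / (q - 2) / d) - 1 := by
          rw [hid]; positivity
        refine (sum_max_one_rpow_le (by linarith) S).trans (le_of_eq ?_)
        rw [hid]
        field_simp
        ring

/-- The `p`-th powers of the product weight sum to at most `X^d`, and `(X^d)^{1/p} = X^{d(q-2)/q}`;
this is the outer exponent in `Γ`. For `q = 2` the supremum replaces the sum. -/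
theorem convolutionBound_of_prod {d : ℕ} (hd : d ≠ 0) {q : ℝ} (hq : 2 ≤ q) {A c G : ℝ}
    (hA : 0 ≤ A) (hc : 0 ≤ c) (hG : 0 ≤ G) {h : ℤ → ℝ} (h0 : ∀ m, 0 ≤ h m)
    (hinf : q = 2 → ∀ m, h m ≤ G)
    (hsum : q ≠ 2 → ∃ X, 0 ≤ X ∧ G = X ^ (d * (q - 2) / q) ∧
      ∀ S : Finset ℤ, ∑ m ∈ S, h m ^ (q / (q - 2) / d) ≤ X)
    {K : Zd d → ℂ} (hK : ∀ n, ‖K n‖ ≤ A * ∏ j, (c * h (n j)) ^ (1 / (d : ℝ))) :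
    ConvolutionBound q K (A * (c * G)) := by
  have hd0 : (d : ℝ) ≠ 0 := by exact_mod_cast hd
  have hroot : ∀ x : ℝ, 0 ≤ x → ∏ _j : Fin d, x ^ (1 / (d : ℝ)) = x := by
    intro x hx
    rw [Finset.prod_const, Finset.card_univ, Fintype.card_fin, one_div,
      Real.rpow_inv_natCast_pow hx hd]
  have hK' : ∀ n, ‖K n‖ ≤ A * (c * ∏ j, h (n j) ^ (1 / (d : ℝ))) := by
    intro n
    refine (hK n).trans (le_of_eq ?_)
    simp only [Real.mul_rpow hc (h0 _), Finset.prod_mul_distrib, hroot c hc]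
  rw [ConvolutionBound]
  split_ifs with hq2
  · intro n
    refine (hK' n).trans ?_
    gcongr
    rw [← hroot G hG]
    refine Finset.prod_le_prod (fun j _ => Real.rpow_nonneg (h0 _) _) fun j _ => ?_
    exact Real.rpow_le_rpow (h0 _) (hinf hq2 _) (by positivity)
  · intro s
    obtain ⟨X, hX0, hGX, hX⟩ := hsum hq2
    have hp : 0 < q - 2 := sub_pos.mpr (lt_of_le_of_ne hq (Ne.symm hq2))
    have hq0 : 0 < q := by linarith
    set p := q / (q - 2) with hpdef
    have hp0 : 0 < p := by positivity
    calc ∑ n ∈ s, ‖K n‖ ^ p ≤ ∑ n ∈ s, (A * c) ^ p * ∏ j, h (n j) ^ (p / d) := by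
          refine Finset.sum_le_sum fun n _ => ?_
          have h1 := Real.rpow_le_rpow (norm_nonneg _) (hK' n) hp0.le
          rw [← mul_assoc, Real.mul_rpow (by positivity)
            (Finset.prod_nonneg fun j _ => Real.rpow_nonneg (h0 _) _),
            ← Real.finsetProd_rpow _ _ fun j _ => Real.rpow_nonneg (h0 _) _] at h1
          refine h1.trans (le_of_eq ?_)
          congr 1
          refine Finset.prod_congr rfl fun j _ => ?_
          rw [← Real.rpow_mul (h0 _)]
          congr 1
          ring
      _ ≤ (A * c) ^ p * X ^ d := by
          rw [← Finset.mul_sum]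
          exact mul_le_mul_of_nonneg_left (sum_prod_le_pow (w := fun m => h m ^ (p / d))
            (fun m => Real.rpow_nonneg (h0 _) _) hX s) (by positivity)
      _ = _ := by
          rw [← mul_assoc, Real.mul_rpow (by positivity) hG, hGX, ← Real.rpow_mul hX0,
            ← Real.rpow_natCast]
          congr 2
          rw [hpdef]
          field_simp

end LatticeResolvent

end

/-! ### Assembly of the main theorem -/

theorem theorem3p3 (d : ℕ) (hd : 3 ≤ d) (q : ℝ) (hq : 2 ≤ q) (hq' : q < qMax d)
    (u v : lp (fun _ : Zd d => ℂ) (ENNReal.ofReal q)) :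
    ∃ Y : ℂ → HSOp (Zd d),
      (∀ z ∈ cutPlane d, HSOp.toCLM (Y z) = weightedResolvent u v z) ∧
      AnalyticOnNhd ℂ Y (cutPlane d) ∧
      (∀ z ∈ cutPlane d,
        ‖Y z‖ ≤ (Dconst q d + Cconst d 0 * Gconst q d 0) * ‖u‖ * ‖v‖) ∧
      (∀ γ : ℝ, 0 ≤ γ → γ ≤ 1 → γ < gammaMax d q →
        ∀ z ∈ cutPlane d, ∀ z' ∈ cutPlane d, 0 ≤ z.im → 0 ≤ z'.im →
          ‖Y z - Y z'‖ ≤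
            ‖z - z'‖ ^ γ * (Dconst q d + Cconst d γ * Gconst q d γ) * ‖u‖ * ‖v‖) ∧
      (∃ Yplus : ℂ → HSOp (Zd d),
        (∀ z ∈ cutPlane d, 0 ≤ z.im → Yplus z = Y z) ∧
        ∀ γ : ℝ, 0 ≤ γ → γ ≤ 1 → γ < gammaMax d q →
          ∀ z z' : ℂ, 0 ≤ z.im → 0 ≤ z'.im →
            ‖Yplus z - Yplus z'‖ ≤
              ‖z - z'‖ ^ γ * (Dconst q d + Cconst d γ * Gconst q d γ) * ‖u‖ * ‖v‖) ∧
      (∃ Yminus : ℂ → HSOp (Zd d),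
        (∀ z ∈ cutPlane d, z.im ≤ 0 → Yminus z = Y z) ∧
        ∀ γ : ℝ, 0 ≤ γ → γ ≤ 1 → γ < gammaMax d q →
          ∀ z z' : ℂ, z.im ≤ 0 → z'.im ≤ 0 →
            ‖Yminus z - Yminus z'‖ ≤
              ‖z - z'‖ ^ γ * (Dconst q d + Cconst d γ * Gconst q d γ) * ‖u‖ * ‖v‖) := by
  have hd0 : d ≠ 0 := by omega
  have hdr : (3 : ℝ) ≤ d := by exact_mod_cast hd
  have hq0 : 0 < q := by linarith
  have hq4 : q ≤ 4 := by
    refine hq'.le.trans ?_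
    rw [qMax]
    split_ifs
    · norm_num
    · rw [div_le_iff₀ (by positivity)]
      linarith
  -- The upper bound on `q` is exactly the admissibility of `γ = 0`, which yields finiteness of the
  -- moments and part (a).
  have hγ0 : 0 < gammaMax d q := by
    rw [qMax] at hq'
    rw [gammaMax]
    split_ifs at hq' ⊢ with h3
    · rw [sub_pos, lt_div_iff₀ hq0]
      linarith
    · rw [lt_div_iff₀ (by positivity)] at hq'
      rw [sub_pos, div_lt_div_iff₀ (by norm_num) hq0]
      linarith
  have hu := lp.norm_nonneg' u
  have hv := lp.norm_nonneg' v
  have hD : 0 ≤ Dconst q d := Real.rpow_nonneg (by linarith) _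
  obtain ⟨hC0, hG0, h₀, h₀0, h₀M, h₀inf, h₀sum⟩ :=
    exists_moment_weight d hd hq le_rfl zero_le_one hγ0
  have hfin : ∀ m, besselMoment d m 0 ≠ ∞ := fun m =>
    ne_top_of_le_ne_top ENNReal.ofReal_ne_top (h₀M m)
  have hbound : ∀ z : ℂ, 0 ≤ z.im → ∀ K : Zd d → ℂ, (∀ n, ‖K n‖ = ‖greenKernel z n‖) →
      ConvolutionBound q K (1 * (Cconst d 0 / 2 * Gconst q d 0)) := by
    intro z hz K hK
    refine convolutionBound_of_prod hd0 hq zero_le_one (by positivity) hG0 h₀0 h₀inf h₀sum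
      fun n => ?_
    rw [hK, one_mul]
    exact norm_greenKernel_le hd0 (fun m => mul_nonneg (by positivity) (h₀0 m)) h₀M hz n
  have hB0 : 0 ≤ 1 * (Cconst d 0 / 2 * Gconst q d 0) := by positivity
  have hdiff : ∀ γ : ℝ, 0 ≤ γ → γ ≤ 1 → γ < gammaMax d q → ∀ z z' : ℂ, 0 ≤ z.im → 0 ≤ z'.im →
      ∀ K K' : Zd d → ℂ, (∀ n, ‖K n‖ = ‖greenKernel z n‖) → (∀ n, ‖K' n‖ = ‖greenKernel z' n‖) →
      (∀ n, ‖K n - K' n‖ = ‖greenKernel z n - greenKernel z' n‖) →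
      ‖weightedConvolution u v K - weightedConvolution u v K'‖ ≤
        ‖z - z'‖ ^ γ * (Dconst q d + Cconst d γ * Gconst q d γ) * ‖u‖ * ‖v‖ := by
    intro γ hγ hγ1 hγm z z' hz hz' K K' hK hK' hKK'
    obtain ⟨hC, hG, h, h0, hM, hinf, hsum⟩ := exists_moment_weight d hd hq hγ hγ1 hγm
    have hb : ConvolutionBound q (fun n => K n - K' n)
        (2 * ‖z - z'‖ ^ γ * (Cconst d γ / 2 * Gconst q d γ)) := by
      refine convolutionBound_of_prod hd0 hq (by positivity) (by positivity) hG h0 hinf hsum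
        fun n => ?_
      rw [hKK']
      exact norm_greenKernel_sub_le hd0 hfin hγ hγ1 (fun m => mul_nonneg (by positivity) (h0 m))
        hM hz hz' n
    have hb0 : 0 ≤ 2 * ‖z - z'‖ ^ γ * (Cconst d γ / 2 * Gconst q d γ) := by positivity
    rw [weightedConvolution_sub hq hq4 u v hB0 (hbound z hz K hK) hB0 (hbound z' hz' K' hK') hb0 hb]
    refine (norm_weightedConvolution_le hq hq4 u v hb0 hb).trans ?_
    refine mul_le_mul_of_nonneg_right (mul_le_mul_of_nonneg_right ?_ hu) hv
    have : 0 ≤ ‖z - z'‖ ^ γ * Dconst q d := by positivity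
    linarith
  -- `Y` is built from the resolvent, hence analytic; `Yp` and `Ym` are built from the Laplace
  -- transform and its conjugate, hence defined up to the boundary. They agree where both
  -- descriptions apply.
  set Y : ℂ → HSOp (Zd d) := fun z => weightedConvolutionCLM hq hq4 u v (resolventDelta d z) with hY
  set Yp : ℂ → HSOp (Zd d) := fun z => weightedConvolution u v (greenKernel z) with hYp
  set Ym : ℂ → HSOp (Zd d) := fun z => weightedConvolution u v
    (fun n => starRingEnd ℂ (greenKernel (starRingEnd ℂ z) n)) with hYm
  have hplus : ∀ z ∈ cutPlane d, 0 ≤ z.im → Yp z = Y z := by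
    intro z hz hz0
    simp only [hY, hYp, weightedConvolutionCLM_apply]
    congr 1
    funext n
    exact (resolventDelta_eq_greenKernel hd0 hfin hz hz0 n).symm
  have hconj_im : ∀ z : ℂ, z.im ≤ 0 → 0 ≤ (starRingEnd ℂ z).im := by
    intro z hz
    rw [Complex.conj_im]
    linarith
  have hminus : ∀ z ∈ cutPlane d, z.im ≤ 0 → Ym z = Y z := by
    intro z hz hz0
    simp only [hY, hYm, weightedConvolutionCLM_apply]
    congr 1
    funext n
    rw [← resolventDelta_eq_greenKernel hd0 hfin (conj_mem_cutPlane hz) (hconj_im z hz0) n,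
      resolventDelta_conj hz, Complex.conj_conj]
  have hholder : ∀ γ : ℝ, 0 ≤ γ → γ ≤ 1 → γ < gammaMax d q → ∀ z z' : ℂ, 0 ≤ z.im → 0 ≤ z'.im →
      ‖Yp z - Yp z'‖ ≤
        ‖z - z'‖ ^ γ * (Dconst q d + Cconst d γ * Gconst q d γ) * ‖u‖ * ‖v‖ :=
    fun γ hγ hγ1 hγm z z' hz hz' => hdiff γ hγ hγ1 hγm z z' hz hz' _ _ (fun _ => rfl)
      (fun _ => rfl) (fun _ => rfl)
  refine ⟨Y, fun z hz => ?_, fun z hz => ?_, fun z hz => ?_, ?_, ⟨Yp, hplus, hholder⟩,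
    ⟨Ym, hminus, ?_⟩⟩
  · refine HSOp.toCLM_eq_of_entry _ _ fun n m => ?_
    simp only [hY, weightedConvolutionCLM_apply]
    rw [entry_weightedConvolution hq hq4 u v (norm_nonneg _)
      (convolutionBound_norm hq hq4 (resolventDelta d z)), ← resolvent_single_apply hz]
    have hvm : mulOp v (lp.single 2 m (1 : ℂ)) = v m • lp.single 2 m (1 : ℂ) := by
      apply lp.ext
      funext k
      rw [mulOp_apply, lp.coeFn_smul, Pi.smul_apply, lp.coeFn_single, Pi.single_apply, smul_eq_mul]
      split_ifs with hk
      · rw [hk]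
      · simp
    rw [weightedResolvent, ContinuousLinearMap.comp_apply, ContinuousLinearMap.comp_apply,
      mulOp_apply, hvm, map_smul, lp.coeFn_smul, Pi.smul_apply, smul_eq_mul]
    ring
  · exact AnalyticAt.fun_comp (g := weightedConvolutionCLM hq hq4 u v) (f := resolventDelta d)
      (ContinuousLinearMap.analyticAt _ _) (analyticAt_resolventDelta hz)
  -- The estimate obtained is `(C/2) Γ`: the `2` in the Hölder bound is not lost here, and `D ≥ 0`
  -- is added freely.
  · have hfinal : ∀ w : ℂ, 0 ≤ w.im → ∀ K : Zd d → ℂ, (∀ n, ‖K n‖ = ‖greenKernel w n‖) →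
        ‖weightedConvolution u v K‖ ≤
          (Dconst q d + Cconst d 0 * Gconst q d 0) * ‖u‖ * ‖v‖ := by
      intro w hw K hK
      refine (norm_weightedConvolution_le hq hq4 u v hB0 (hbound w hw K hK)).trans ?_
      gcongr
      have : 0 ≤ Cconst d 0 * Gconst q d 0 := mul_nonneg hC0 hG0
      linarith
    rcases le_total 0 z.im with hz0 | hz0
    · rw [← hplus z hz hz0]
      exact hfinal z hz0 _ fun _ => rfl
    · rw [← hminus z hz hz0]
      exact hfinal _ (hconj_im z hz0) _ fun n => by simp
  · intro γ hγ hγ1 hγm z hz z' hz' hz0 hz0'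
    rw [← hplus z hz hz0, ← hplus z' hz' hz0']
    exact hholder γ hγ hγ1 hγm z z' hz0 hz0'
  · intro γ hγ hγ1 hγm z z' hz hz'
    -- Conjugation preserves all the moduli involved, including `|z - z'|`, so the lower half-plane
    -- inherits the upper bound.
    have h := hdiff γ hγ hγ1 hγm _ _ (hconj_im z hz) (hconj_im z' hz')
      (fun n => starRingEnd ℂ (greenKernel (starRingEnd ℂ z) n))
      (fun n => starRingEnd ℂ (greenKernel (starRingEnd ℂ z') n))
      (fun n => by simp) (fun n => by simp) (fun n => by rw [← map_sub, RCLike.norm_conj])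
    rw [← map_sub, RCLike.norm_conj] at h
    exact h
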